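/- Let $d\ge 1$, let $\mathbb{S}^d$ be the unit sphere of $\mathbb{R}^{d+1}$ with angular (great circle) distance $d_{\mathbb{S}^d}$, surface measure $\sigma$ and north pole $N$, and put $B_u(\theta)=\{\eta\in\mathbb{S}^d: d_{\mathbb{S}^d}(\eta,\theta)\le u\}$. On a probability space let $\Lambda^{(i)}(\theta)$, $\theta\in\mathbb{S}^d$, $i\in\mathbb{N}_0$, be independent, jointly measurable random fields which are almost surely nonnegative everywhere, with $E\Lambda^{(i)}(\theta)=1$ and $E(\Lambda^{(i)}(\theta))^2<\infty$. Let $\Lambda_n=\prod_{i=0}^n\Lambda^{(i)}$ and $\mu_n(B)=\int_B\Lambda_n(\theta)\,\sigma(d\theta)$ for Borel sets $B\subseteq\mathbb{S}^d$. Assume the following. (A) There are $b>1$, $k\ge2$, $p_1,\dots,p_k\ge1$ with $\sum_j p_j=p\ge2$, and a non-increasing function $\rho$ on $[0,\infty)$ such that $$E\prod_{j=1}^k(\Lambda^{(i)}(\theta_j))^{p_j}\le\rho\Bigl(b^i\min_{m\ne h}d_{\mathbb{S}^d}(\theta_m,\theta_h)\Bigr)\quad\text{for all } i\in\mathbb{N}_0,\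 \theta_1,\dots,\theta_k\in\mathbb{S}^d,$$ $b>\rho(0)^{1/d}$, and $\sum_{i=0}^\infty\ln\rho(b^i)<\infty$. (B) The fields $\Lambda^{(i)}$ are strongly isotropic (their finite-dimensional distributions are invariant under $SO(d+1)$), and for every $q\in[0,p]$ the moment $E(\Lambda^{(i)}(\theta))^q$ depends neither on $i$ nor on $\theta$. Then there is a limiting measure, that is, a random measure $\mu$ on $\mathbb{S}^d$ such that for each Borel set $B$ one has $\mu_n(B)\to\mu(B)$ with probability one. For every such $\mu$ one has $E\mu^p(B)<\infty$ for all Borel sets $B$, and the following holds for every $q\in(0,p]$. Suppose that (C) if $q\in(0,1)$: there is a non-decreasing function $\rho_q$ on $[0,\infty)$ such that $$E\bigl[(\Lambda^{(i)}(\theta_1))^{q-1}\Lambda^{(i)}(\theta_2)\bigr]\le\rho_q\bigl(b^i d_{\mathbb{S}^d}(\theta_1,\theta_2)\bigr)\quad\text{for all } i\in\mathbb{N}_0,\ \theta_1,\theta_2\in\mathbb{S}^d,$$ and $$\sum_{i=0}^\infty\ln\left(\frac{\rho_q(b^{-i})}{E(\Lambda^{(i)}(N))^q}\right)<\infty$$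 (here $0^{q-1}=\infty$ and $\infty\cdot0=0$); (D) if $q\in[1,p]$: there are a point $\widetilde\theta\in\mathbb{S}^d$, an integer $m\ge2$ and a positive non-increasing function $\upsilon$ on $[0,\infty)$ such that $$\upsilon(b^ix)\le E\prod_{j=1}^m(\Lambda^{(i)}(\theta_j))^{q/m}\quad\text{for all } i\in\mathbb{N}_0,\ x\in[0,\pi],\ \theta_1,\dots,\theta_m\in B_x(\widetilde\theta),$$ and $$\sum_{i=0}^\infty\ln\left(\frac{E(\Lambda^{(i)}(\widetilde\theta))^q}{\upsilon(b^{-i})}\right)<\infty.$$ Then there are constants $C_1,C_2>0$ such that for all sufficiently small $u>0$ and all $\theta\in\mathbb{S}^d$ $$C_1u^{dq-\log_bE(\Lambda^{(0)}(N))^q}\le E\mu^q(B_u(\theta))\le C_2u^{dq-\log_bE(\Lambda^{(0)}(N))^q}.$$ -/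

import Mathlib

open MeasureTheory ProbabilityTheory Filter Topology
open scoped ENNReal

noncomputable section

namespace SphField

/-- The unit sphere `𝕊^d` of `ℝ^(d+1)`. It carries the Borel `σ`-algebra. -/
abbrev Sph (d : ℕ) : Type := Metric.sphere (0 : EuclideanSpace ℝ (Fin (d + 1))) 1

/-- The angular (great circle) distance on `𝕊^d`, with values in `[0, π]`. -/
def geodDist {d : ℕ} (x y : Sph d) : ℝ :=
  InnerProductGeometry.angle (x : EuclideanSpace ℝ (Fin (d + 1))) y

/-- The closed spherical cap `B_u(θ)`. -/
def cap {d : ℕ} (θ : Sph d) (u : ℝ) : Set (Sph d) := {η | geodDist η θ ≤ u}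

/-- The north pole: the point all of whose spherical coordinates vanish. -/
def northPole (d : ℕ) : Sph d := ⟨EuclideanSpace.single 0 1, by simp⟩

/-- The Lebesgue (surface) measure on `𝕊^d`. -/
def surf (d : ℕ) : Measure (Sph d) :=
  (volume : Measure (EuclideanSpace ℝ (Fin (d + 1)))).toSphere

/-- The image of a point of the sphere under a linear isometry of `ℝ^(d+1)`. -/
def rot {d : ℕ} (g : EuclideanSpace ℝ (Fin (d + 1)) ≃ₗᵢ[ℝ] EuclideanSpace ℝ (Fin (d + 1)))
    (x : Sph d) : Sph d :=
  ⟨g x, by simp⟩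

variable {Ω : Type*} [MeasurableSpace Ω]

/-- A jointly measurable random field on `𝕊^d`, almost surely nonnegative everywhere, with mean one
and finite second moments. -/
structure IsMeanOneField {d : ℕ} (P : Measure Ω) (T : Sph d → Ω → ℝ) : Prop where
  measurable : Measurable (Function.uncurry T)
  nonneg : ∀ᵐ ω ∂P, ∀ θ, 0 ≤ T θ ω
  mean_one : ∀ θ, ∫ ω, T θ ω ∂P = 1
  memLp_two : ∀ θ, MemLp (T θ) 2 P

/-- Strong isotropy: the finite-dimensional distributions are invariant under `SO(d+1)`. -/
def StronglyIsotropic {d : ℕ} (P : Measure Ω) (T : Sph d → Ω → ℝ) : Prop :=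
  ∀ (k : ℕ) (θ : Fin k → Sph d)
    (g : EuclideanSpace ℝ (Fin (d + 1)) ≃ₗᵢ[ℝ] EuclideanSpace ℝ (Fin (d + 1))),
    LinearMap.det (g.toLinearEquiv :
      EuclideanSpace ℝ (Fin (d + 1)) →ₗ[ℝ] EuclideanSpace ℝ (Fin (d + 1))) = 1 →
    IdentDistrib (fun ω j => T (θ j) ω) (fun ω j => T (rot g (θ j)) ω) P P

/-- `E X^q` for a nonnegative random variable `X`, as an extended nonnegative number. -/
def moment (P : Measure Ω) (X : Ω → ℝ) (q : ℝ) : ℝ≥0∞ :=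
  ∫⁻ ω, ENNReal.ofReal (X ω) ^ q ∂P

/-- `E ∏ⱼ T(θⱼ)^(pⱼ)` for a nonnegative field `T`, as an extended nonnegative number. A negative
power of `0` is `∞`, and `∞ * 0 = 0`. -/
def mixedMoment {d k : ℕ} (P : Measure Ω) (T : Sph d → Ω → ℝ) (p : Fin k → ℝ)
    (θ : Fin k → Sph d) : ℝ≥0∞ :=
  ∫⁻ ω, ∏ j, ENNReal.ofReal (T (θ j) ω) ^ p j ∂P

/-- The smallest angular distance between two points with different indices (used for `k ≥ 2`). -/
def minSep {d k : ℕ} (θ : Fin k → Sph d) : ℝ :=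
  ⨅ mh : {mh : Fin k × Fin k // mh.1 ≠ mh.2}, geodDist (θ mh.1.1) (θ mh.1.2)

/-- The mixing inequality
`E ∏ⱼ (Λ⁽ⁱ⁾(θⱼ))^(pⱼ) ≤ ρ(bⁱ min_{m ≠ h} d(θₘ, θₕ))` for all `i` and all points `θⱼ`. -/
def MixingBound {d k : ℕ} (P : Measure Ω) (Λ : ℕ → Sph d → Ω → ℝ) (b : ℝ) (p : Fin k → ℝ)
    (ρ : ℝ → ℝ) : Prop :=
  ∀ (i : ℕ) (θ : Fin k → Sph d),
    mixedMoment P (Λ i) p θ ≤ ENNReal.ofReal (ρ (b ^ i * minSep θ))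

/-- The conditions for the convergence of the cumulative measures: an exponent vector
`p = (p₁, …, pₖ)`, a scale `b` and a non-increasing function `ρ` on `[0, ∞)`. -/
structure ConvergenceConditions {d k : ℕ} (P : Measure Ω) (Λ : ℕ → Sph d → Ω → ℝ) (b : ℝ)
    (p : Fin k → ℝ) (ρ : ℝ → ℝ) : Prop where
  field : ∀ i, IsMeanOneField P (Λ i)
  indep : iIndepFun (fun i ω θ => Λ i θ ω) P
  two_le : 2 ≤ k
  one_le_exponent : ∀ j, 1 ≤ p j
  two_le_sum : 2 ≤ ∑ j, p j
  one_lt_scale : 1 < b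
  antitone : AntitoneOn ρ (Set.Ici 0)
  mixing : MixingBound P Λ b p ρ
  scale : ρ 0 ^ (1 / (d : ℝ)) < b
  summable : Summable fun i : ℕ => Real.log (ρ (b ^ i))

/-- Strongly isotropic fields whose `q`-th moments, `q ∈ [0, p]`, do not depend on the field
and on the point. -/
structure IsotropicEqualMoments {d : ℕ} (P : Measure Ω) (Λ : ℕ → Sph d → Ω → ℝ) (p : ℝ) :
    Prop where
  isotropic : ∀ i, StronglyIsotropic P (Λ i)
  moment_eq : ∀ q ∈ Set.Icc 0 p, ∀ (i j : ℕ) (θ : Sph d),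
    moment P (Λ i (northPole d)) q = moment P (Λ j θ) q

/-- The condition for an exponent `q ∈ (0, 1)`: the mixing inequality for the vector `(q - 1, 1)`
with a non-decreasing function `ρ` on `[0, ∞)` and a summability condition. -/
structure SmallExponentCondition {d : ℕ} (P : Measure Ω) (Λ : ℕ → Sph d → Ω → ℝ) (b q : ℝ)
    (ρ : ℝ → ℝ) : Prop where
  monotone : MonotoneOn ρ (Set.Ici 0)
  mixing : MixingBound P Λ b ![q - 1, 1] ρ
  summable : Summable fun i : ℕ =>
    Real.log (ρ (b ^ (-(i : ℤ))) / (moment P (Λ i (northPole d)) q).toReal)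

/-- The non-degeneracy condition for an exponent `q ≥ 1`: a point `θ₀`, a dimension `k ≥ 2` and a
positive non-increasing function `υ` on `[0, ∞)` with
`υ(bⁱ x) ≤ E ∏ⱼ (Λ⁽ⁱ⁾(θⱼ))^(q/k)` for `θ₁, …, θₖ ∈ B_x(θ₀)`, and a summability condition. -/
structure NondegeneracyCondition {d : ℕ} (P : Measure Ω) (Λ : ℕ → Sph d → Ω → ℝ) (b q : ℝ)
    (θ₀ : Sph d) (k : ℕ) (υ : ℝ → ℝ) : Prop where
  two_le : 2 ≤ k
  pos : ∀ x, 0 ≤ x → 0 < υ x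
  antitone : AntitoneOn υ (Set.Ici 0)
  bound : ∀ (i : ℕ), ∀ x ∈ Set.Icc 0 Real.pi, ∀ θ : Fin k → Sph d, (∀ j, θ j ∈ cap θ₀ x) →
    ENNReal.ofReal (υ (b ^ i * x)) ≤ mixedMoment P (Λ i) (fun _ => q / k) θ
  summable : Summable fun i : ℕ =>
    Real.log ((moment P (Λ i θ₀) q).toReal / υ (b ^ (-(i : ℤ))))

/-- The cumulative random measures `μₙ(B) = ∫_B Λ⁽⁰⁾(θ) ⋯ Λ⁽ⁿ⁾(θ) σ(dθ)`. -/
def cumMeasure {d : ℕ} (Λ : ℕ → Sph d → Ω → ℝ) (n : ℕ) (ω : Ω) : Measure (Sph d) :=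
  (surf d).withDensity fun θ => ENNReal.ofReal (∏ i ∈ Finset.range (n + 1), Λ i θ ω)

/-- `μ` is a limiting measure: a random measure on `𝕊^d` such that, for every fixed Borel set `B`,
`μₙ(B) → μ(B)` with probability one. -/
structure IsLimitingMeasure {d : ℕ} (P : Measure Ω) (Λ : ℕ → Sph d → Ω → ℝ)
    (μ : Ω → Measure (Sph d)) : Prop where
  measurable : Measurable μ
  tendsto : ∀ B, MeasurableSet B →
    ∀ᵐ ω ∂P, Tendsto (fun n => cumMeasure Λ n ω B) atTop (𝓝 (μ ω B))

end SphField

end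

/-!
The cumulative measures of the caps are analysed one scale at a time. For a cap of radius `u` with
`b⁻⁽ⁿ⁺¹⁾ < u ≤ b⁻ⁿ` let `ν` be the normalised surface measure on the cap, `M` the common moment of
order `q` of the fields, and split the product of the fields into the first `n` factors and the
rest. The claim is that the `q`-th moment of the normalised limiting mass is comparable to `Mⁿ`: as
the measure of the cap is of order `u ^ d`, and `Mⁿ` is of order `u ^ (-log_b M)`, this is the power
law.

*The fields from the `n`-th on.* The moment of order `p = ∑ pⱼ` of the mass of the remaining product
is at most an integral of mixed moments over `k` independent points with law `ν`
(`IsIndepMeanOne.lintegral_rpow_sum_le`). The mixing inequality bounds these by a product of values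
of `ρ` at `bⁱ` times the smallest separation `t` of the points. At most the factors with `bⁱ t < 1`
are of size `ρ 0`, the product of the others is bounded as `∑ log ρ(bⁱ)` converges; since
`ρ 0 < b ^ d` and `ν` of a ball of radius `b⁻⁽ⁿ⁺ˡ⁾` is of order `b⁻ˡᵈ`, the integral is bounded
uniformly in `n` (`ConvergenceConditions.exists_lintegral_mixedProd_le`).

*The first `n` fields.* Hölder's inequality reduces all four bounds to expectations of products of
the fields at finitely many points, which factorise by independence. For the upper bound with
`q ≥ 1` and the lower bound with `q < 1` the fields are weighted with their own `q`-th power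
(`IsIndepMeanOne.lintegral_rpow_le_of_one_le`, `IsIndepMeanOne.le_lintegral_rpow_of_lt_one`). For
the other two the weight is the power of order `q - 1` of the fields at the centre of the cap
(`IsIndepMeanOne.lintegral_rpow_le_of_lt_one`, `IsIndepMeanOne.le_lintegral_rpow_of_one_le`), and
the conditions on `ρq` and `υ` compare the two-point moments with `M`; the condition on `υ` is
transported to all centres by rotations.

*The limiting measure.* The masses of a fixed set form a nonnegative martingale, bounded in `Lᵖ`.
When the sphere is embedded into the real line, the almost sure limits on the half-lines with
rational end points define a distribution function, and thereby a random measure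
(`ConvergesSetwise.exists_measure`).

A recurring point is measurability: independence of the fields concerns the product `σ`-algebra, for
which integrals of the fields need not be measurable. Independence is therefore only applied to
values at finitely many points, after an exchange of integrals.
-/

namespace SphField

/-! ### Spherical distance, caps and rotations -/

section Geometry

open scoped Pointwise

/-- The ambient Euclidean space of the sphere `Sph d`. -/
abbrev Euc (d : ℕ) : Type := EuclideanSpace ℝ (Fin (d + 1))

variable {d : ℕ}

theorem dist_eq_two_mul_sin_geodDist (x y : Sph d) :
    dist x y = 2 * Real.sin (geodDist x y / 2) := by
  have hx : ‖(x : Euc d)‖ = 1 := by simp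
  have hy : ‖(y : Euc d)‖ = 1 := by simp
  have h0 := InnerProductGeometry.angle_nonneg (x : Euc d) y
  have h1 := InnerProductGeometry.angle_le_pi (x : Euc d) y
  have hs : 0 ≤ Real.sin (geodDist x y / 2) :=
    Real.sin_nonneg_of_nonneg_of_le_pi (by unfold geodDist; linarith) (by unfold geodDist; linarith)
  have hc := InnerProductGeometry.cos_angle (x : Euc d) y
  rw [hx, hy, mul_one, div_one] at hc
  have hn := @norm_sub_sq_real _ _ _ (x : Euc d) y
  rw [hx, hy, ← hc] at hn
  rw [Subtype.dist_eq, dist_eq_norm]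
  refine (sq_eq_sq₀ (norm_nonneg _) (by positivity)).1 ?_
  have h2 : Real.cos (InnerProductGeometry.angle (x : Euc d) y)
      = 1 - 2 * Real.sin (geodDist x y / 2) ^ 2 := by
    have := Real.cos_two_mul' (geodDist x y / 2)
    rw [Real.cos_sq'] at this
    rw [show InnerProductGeometry.angle (x : Euc d) y
      = 2 * (geodDist x y / 2) by unfold geodDist; ring, this]
    ring
  rw [hn, h2]; ring

theorem geodDist_nonneg (x y : Sph d) : 0 ≤ geodDist x y := InnerProductGeometry.angle_nonneg _ _

theorem geodDist_le_pi (x y : Sph d) : geodDist x y ≤ Real.pi :=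
  InnerProductGeometry.angle_le_pi _ _

theorem geodDist_comm (x y : Sph d) : geodDist x y = geodDist y x :=
  InnerProductGeometry.angle_comm _ _

theorem dist_le_geodDist (x y : Sph d) : dist x y ≤ geodDist x y := by
  rw [dist_eq_two_mul_sin_geodDist]
  have := Real.sin_le (x := geodDist x y / 2) (by linarith [geodDist_nonneg x y])
  linarith

theorem geodDist_le_two_mul_dist (x y : Sph d) : geodDist x y ≤ 2 * dist x y := by
  rw [dist_eq_two_mul_sin_geodDist]
  have h := Real.mul_le_sin (x := geodDist x y / 2) (by linarith [geodDist_nonneg x y])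
    (by linarith [geodDist_le_pi x y])
  have hpi := Real.pi_le_four
  have : (1 / 2 : ℝ) ≤ 2 / Real.pi := by
    rw [div_le_div_iff₀ two_pos Real.pi_pos]; linarith
  have h3 : 1 / 2 * (geodDist x y / 2) ≤ 2 / Real.pi * (geodDist x y / 2) :=
    mul_le_mul_of_nonneg_right this (by linarith [geodDist_nonneg x y])
  linarith

theorem geodDist_self (x : Sph d) : geodDist x x = 0 :=
  le_antisymm (by simpa using geodDist_le_two_mul_dist x x) (geodDist_nonneg _ _)

theorem continuous_geodDist : Continuous fun x : Sph d × Sph d => geodDist x.1 x.2 := by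
  rw [continuous_iff_continuousAt]
  intro x
  have h := InnerProductGeometry.continuousAt_angle
    (x := ((x.1 : Euc d), (x.2 : Euc d)))
    (ne_zero_of_mem_unit_sphere x.1) (ne_zero_of_mem_unit_sphere x.2)
  exact ContinuousAt.comp (f := fun x : Sph d × Sph d =>
    ((x.1 : Euc d), (x.2 : Euc d))) h
    (by fun_prop)

theorem measurable_geodDist : Measurable fun x : Sph d × Sph d => geodDist x.1 x.2 :=
  continuous_geodDist.measurable

theorem measurableSet_cap (θ : Sph d) (u : ℝ) : MeasurableSet (cap θ u) := by
  have h : Continuous fun η : Sph d => geodDist η θ :=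
    Continuous.comp (g := fun x : Sph d × Sph d => geodDist x.1 x.2) (f := fun η => (η, θ))
      continuous_geodDist (by fun_prop)
  exact (isClosed_le h continuous_const).measurableSet

instance : IsFiniteMeasure (surf d) := by unfold surf; infer_instance

/-- A cone over a set of the unit sphere, cut off at norm one, is the union of its homothetic copy
of ratio `1 - u` and of a shell lying within distance `2 * u` of the centre of the cap. Comparing
volumes bounds the measure of a small cap from above. -/
theorem surf_cap_le (θ : Sph d) {u : ℝ} (hu : 0 < u) (hu1 : u ≤ 1) :
    surf d (cap θ u) ≤ ENNReal.ofReal (u ^ d) *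
      ((d + 1) * (ENNReal.ofReal (2 ^ (d + 1)) *
        volume (Metric.ball (0 : Euc d) 1))) := by
  set C : Set (Euc d) := Set.Ioo (0 : ℝ) 1 • (Subtype.val '' cap θ u) with hC
  have hsub : C ⊆ ((1 - u : ℝ) • C) ∪ Metric.closedBall (θ : Euc d) (2 * u) := by
    rintro _ ⟨r, hr, _, ⟨x, hx, rfl⟩, rfl⟩
    have hx1 : ‖(x : Euc d)‖ = 1 := by simp
    by_cases hru : r < 1 - u
    · left
      have h1u : 0 < 1 - u := hr.1.trans hru
      refine ⟨(r / (1 - u)) • (x : Euc d), ⟨r / (1 - u), ⟨div_pos hr.1 h1u, (div_lt_one h1u).2 hru⟩,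
        _, ⟨x, hx, rfl⟩, rfl⟩, ?_⟩
      simp only [smul_smul]
      rw [mul_div_cancel₀ _ h1u.ne']
    · right
      have hd : dist (x : Euc d) θ ≤ u := by
        have := dist_le_geodDist x θ
        rw [Subtype.dist_eq] at this
        exact this.trans hx
      have h3 : dist (r • (x : Euc d)) x = 1 - r := by
        rw [dist_eq_norm,
          show r • (x : Euc d) - x = (r - 1) • (x : Euc d) by rw [sub_smul, one_smul],
          norm_smul, hx1, mul_one, Real.norm_eq_abs, abs_sub_comm, abs_of_pos (by linarith [hr.2])]
      have := dist_triangle (r • (x : Euc d)) x θ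
      rw [Metric.mem_closedBall]
      simp only
      linarith
  have hfin : volume C ≠ ∞ := by
    refine ((measure_mono (?_ : C ⊆ Metric.ball (0 : Euc d) 1)).trans_lt
      Metric.isBounded_ball.measure_lt_top).ne
    rintro _ ⟨r, hr, _, ⟨x, hx, rfl⟩, rfl⟩
    have hx1 : ‖(x : Euc d)‖ = 1 := by simp
    simp [norm_smul, hx1, abs_of_pos hr.1, hr.2]
  have hle : volume C ≤ ENNReal.ofReal ((1 - u) ^ (d + 1)) * volume C +
      ENNReal.ofReal ((2 * u) ^ (d + 1)) * volume (Metric.ball (0 : Euc d) 1) := by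
    refine (measure_mono hsub).trans ((measure_union_le _ _).trans ?_)
    rw [Measure.addHaar_smul_of_nonneg _ (by linarith),
      Measure.addHaar_closedBall _ _ (by positivity)]
    simp
  have hB : volume (Metric.ball (0 : Euc d) 1) ≠ ∞ := (Metric.isBounded_ball.measure_lt_top).ne
  have hkey : volume C ≤ ENNReal.ofReal (u ^ d) * (ENNReal.ofReal (2 ^ (d + 1)) *
      volume (Metric.ball (0 : Euc d) 1)) := by
    have h1 : (volume C).toReal ≤ (1 - u) ^ (d + 1) * (volume C).toReal +
        (2 * u) ^ (d + 1) * (volume (Metric.ball (0 : Euc d) 1)).toReal := by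
      have := ENNReal.toReal_mono (ENNReal.add_ne_top.2 ⟨ENNReal.mul_ne_top (by simp) hfin,
        ENNReal.mul_ne_top (by simp) hB⟩) hle
      rwa [ENNReal.toReal_add (ENNReal.mul_ne_top (by simp) hfin)
        (ENNReal.mul_ne_top (by simp) hB), ENNReal.toReal_mul, ENNReal.toReal_mul,
        ENNReal.toReal_ofReal (by have : 0 ≤ 1 - u := by linarith
                                  positivity), ENNReal.toReal_ofReal (by positivity)] at this
    have h2 : (1 - u) ^ (d + 1) ≤ 1 - u :=
      pow_le_of_le_one (by linarith) (by linarith) (by omega)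
    have hv : 0 ≤ (volume C).toReal := ENNReal.toReal_nonneg
    have h3 : u * (volume C).toReal ≤
        u * (u ^ d * (2 ^ (d + 1) * (volume (Metric.ball (0 : Euc d) 1)).toReal)) := by
      have : u * (u ^ d * (2 ^ (d + 1) * (volume (Metric.ball (0 : Euc d) 1)).toReal))
        = (2 * u) ^ (d + 1) * (volume (Metric.ball (0 : Euc d) 1)).toReal := by rw [mul_pow]; ring
      rw [this]
      nlinarith
    have h4 := le_of_mul_le_mul_left h3 hu
    rw [← ENNReal.ofReal_toReal hfin, ← ENNReal.ofReal_toReal hB,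
      ← ENNReal.ofReal_mul (by positivity), ← ENNReal.ofReal_mul (by positivity)]
    exact ENNReal.ofReal_le_ofReal h4
  unfold surf
  rw [Measure.toSphere_apply' _ (measurableSet_cap θ u)]
  simp only [finrank_euclideanSpace, Fintype.card_fin, Nat.cast_add, Nat.cast_one]
  calc _ ≤ ((d : ℝ≥0∞) + 1) * (ENNReal.ofReal (u ^ d) * (ENNReal.ofReal (2 ^ (d + 1)) *
      volume (Metric.ball (0 : Euc d) 1))) := mul_le_mul_right hkey _
    _ = _ := by ring

/-- The shell of thickness `u` below a small cap contains a ball of radius of order `u`. Comparing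
volumes bounds the measure of a small cap from below. -/
theorem le_surf_cap (θ : Sph d) {u : ℝ} (hu : 0 < u) (hu1 : u < 1) :
    ENNReal.ofReal (u ^ d) * (ENNReal.ofReal ((1 / 16) ^ (d + 1)) *
        volume (Metric.ball (0 : Euc d) 1)) ≤ surf d (cap θ u) := by
  have hθ : ‖(θ : Euc d)‖ = 1 := by simp
  set C : Set (Euc d) := Set.Ioo (0 : ℝ) 1 • (Subtype.val '' cap θ u) with hC
  set t : ℝ := 1 - u / 2
  have ht : 1 / 2 ≤ t := by simp only [t]; linarith
  have hnt : ‖t • (θ : Euc d)‖ = t := by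
    rw [norm_smul, hθ, mul_one, Real.norm_of_nonneg (by linarith)]
  have hball : ∀ y ∈ Metric.ball (t • (θ : Euc d)) (u / 16), y ∈ C ∧ 1 - u ≤ ‖y‖ := by
    intro y hy
    rw [Metric.mem_ball, dist_eq_norm] at hy
    have h1 : |‖y‖ - t| ≤ ‖y - t • (θ : Euc d)‖ := by
      have := abs_norm_sub_norm_le y (t • (θ : Euc d)); rwa [hnt] at this
    have h2 := abs_le.1 (h1.trans hy.le)
    have hlow : 1 - u ≤ ‖y‖ := by simp only [t] at h2; linarith
    have hup : ‖y‖ < 1 := by simp only [t] at h2; linarith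
    have hq : 1 / 4 ≤ ‖y‖ := by linarith
    have hy0 : 0 < ‖y‖ := by linarith
    refine ⟨⟨‖y‖, ⟨hy0, hup⟩, ‖y‖⁻¹ • y, ⟨⟨‖y‖⁻¹ • y, by simp [norm_smul, hy0.ne']⟩, ?_, rfl⟩,
      by simp [smul_smul, hy0.ne']⟩, hlow⟩
    refine (geodDist_le_two_mul_dist _ _).trans ?_
    rw [Subtype.dist_eq]
    have h3 : ‖y - ‖y‖ • (θ : Euc d)‖ ≤ u / 8 := by
      calc ‖y - ‖y‖ • (θ : Euc d)‖ = ‖(y - t • (θ : Euc d)) + (t - ‖y‖) • (θ : Euc d)‖ := by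
            congr 1; rw [sub_smul t]; abel
        _ ≤ ‖y - t • (θ : Euc d)‖ + ‖(t - ‖y‖) • (θ : Euc d)‖ := norm_add_le _ _
        _ ≤ u / 16 + u / 16 := by
            refine add_le_add hy.le ?_
            rw [norm_smul, hθ, mul_one, Real.norm_eq_abs, abs_sub_comm]
            exact h1.trans hy.le
        _ = u / 8 := by ring
    have h4 : dist (‖y‖⁻¹ • y) (θ : Euc d) = ‖y‖⁻¹ * ‖y - ‖y‖ • (θ : Euc d)‖ := by
      rw [dist_eq_norm]
      conv_rhs => rw [← Real.norm_of_nonneg (inv_nonneg.2 hy0.le), ← norm_smul]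
      rw [smul_sub, smul_smul, inv_mul_cancel₀ hy0.ne', one_smul]
    show 2 * dist (‖y‖⁻¹ • y) (θ : Euc d) ≤ u
    rw [h4]
    have h5 : ‖y‖⁻¹ ≤ 4 := by
      rw [inv_le_comm₀ hy0 (by norm_num)]; linarith
    have : ‖y‖⁻¹ * ‖y - ‖y‖ • (θ : Euc d)‖ ≤ 4 * (u / 8) :=
      mul_le_mul h5 h3 (norm_nonneg _) (by norm_num)
    linarith
  have hCsub : (1 - u : ℝ) • C ⊆ C := by
    rintro _ ⟨_, ⟨r, hr, _, ⟨x, hx, rfl⟩, rfl⟩, rfl⟩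
    refine ⟨(1 - u) * r, ⟨mul_pos (by linarith) hr.1, by nlinarith [hr.1, hr.2]⟩,
      _, ⟨x, hx, rfl⟩, by simp [smul_smul]⟩
  have hdisj : Disjoint ((1 - u : ℝ) • C)
      (Metric.ball (t • (θ : Euc d)) (u / 16)) := by
    rw [Set.disjoint_left]
    rintro _ ⟨_, ⟨r, hr, _, ⟨x, hx, rfl⟩, rfl⟩, rfl⟩ hy
    have h := (hball _ hy).2
    have hx1 : ‖(x : Euc d)‖ = 1 := by simp
    simp only [norm_smul, hx1, mul_one, Real.norm_of_nonneg hr.1.le,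
      Real.norm_of_nonneg (show (0 : ℝ) ≤ 1 - u by linarith)] at h
    nlinarith [hr.2]
  have hfin : volume C ≠ ∞ := by
    refine ((measure_mono (?_ : C ⊆ Metric.ball (0 : Euc d) 1)).trans_lt
      Metric.isBounded_ball.measure_lt_top).ne
    rintro _ ⟨r, hr, _, ⟨x, hx, rfl⟩, rfl⟩
    have hx1 : ‖(x : Euc d)‖ = 1 := by simp
    simp [norm_smul, hx1, abs_of_pos hr.1, hr.2]
  have hB : volume (Metric.ball (0 : Euc d) 1) ≠ ∞ :=
    (Metric.isBounded_ball.measure_lt_top).ne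
  have hle : ENNReal.ofReal ((1 - u) ^ (d + 1)) * volume C + ENNReal.ofReal ((u / 16) ^ (d + 1)) *
      volume (Metric.ball (0 : Euc d) 1) ≤ volume C := by
    have h := measure_union hdisj measurableSet_ball (μ := volume)
    rw [Measure.addHaar_smul_of_nonneg _ (by linarith),
      Measure.addHaar_ball _ _ (by positivity)] at h
    simp only [finrank_euclideanSpace, Fintype.card_fin] at h
    rw [← h]
    exact measure_mono (Set.union_subset hCsub fun y hy => (hball y hy).1)
  have hkey : ENNReal.ofReal (u ^ d) * (ENNReal.ofReal ((1 / 16) ^ (d + 1)) *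
      volume (Metric.ball (0 : Euc d) 1)) ≤ (d + 1) * volume C := by
    have h1 := ENNReal.toReal_mono hfin hle
    rw [ENNReal.toReal_add (ENNReal.mul_ne_top (by simp) hfin) (ENNReal.mul_ne_top (by simp) hB),
      ENNReal.toReal_mul, ENNReal.toReal_mul, ENNReal.toReal_ofReal (by
        have : 0 ≤ 1 - u := by linarith
        positivity), ENNReal.toReal_ofReal (by positivity)] at h1
    have h2 : 1 - (d + 1) * u ≤ (1 - u) ^ (d + 1) := by
      have := one_add_mul_le_pow (a := -u) (by linarith) (d + 1)
      push_cast at this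
      rw [← sub_eq_add_neg] at this
      linarith
    have hv : 0 ≤ (volume C).toReal := ENNReal.toReal_nonneg
    have h3 : u * (u ^ d * ((1 / 16) ^ (d + 1) *
        (volume (Metric.ball (0 : Euc d) 1)).toReal)) ≤
        u * ((d + 1) * (volume C).toReal) := by
      have : u * (u ^ d * ((1 / 16) ^ (d + 1) *
          (volume (Metric.ball (0 : Euc d) 1)).toReal))
        = (u / 16) ^ (d + 1) *
          (volume (Metric.ball (0 : Euc d) 1)).toReal := by
        rw [div_eq_mul_one_div, mul_pow]; ring
      rw [this]
      nlinarith
    have h4 := le_of_mul_le_mul_left h3 hu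
    rw [← ENNReal.ofReal_toReal hfin, ← ENNReal.ofReal_toReal hB,
      ← ENNReal.ofReal_mul (by positivity), ← ENNReal.ofReal_mul (by positivity)]
    refine (ENNReal.ofReal_le_ofReal h4).trans_eq ?_
    rw [ENNReal.ofReal_mul (by positivity), ENNReal.ofReal_add (by positivity) (by positivity)]
    simp
  unfold surf
  rw [Measure.toSphere_apply' _ (measurableSet_cap θ u)]
  simpa only [finrank_euclideanSpace, Fintype.card_fin, Nat.cast_add, Nat.cast_one] using hkey

/-- The special orthogonal group acts transitively on the unit sphere: a reflection that exchanges
the two points is corrected by a reflection that fixes the target. -/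
theorem exists_linearIsometryEquiv_det_eq_one {E : Type*} [NormedAddCommGroup E]
    [InnerProductSpace ℝ E] [FiniteDimensional ℝ E] (hE : 2 ≤ Module.finrank ℝ E) {x y : E}
    (hx : ‖x‖ = 1) (hy : ‖y‖ = 1) :
    ∃ g : E ≃ₗᵢ[ℝ] E, LinearMap.det (g.toLinearEquiv : E →ₗ[ℝ] E) = 1 ∧ g x = y := by
  by_cases hxy : x = y
  · exact ⟨LinearIsometryEquiv.refl ℝ _, LinearMap.det_id, hxy⟩
  have hlin (v : E) (hv : v ≠ 0) :
      LinearMap.det ((Submodule.span ℝ {v})ᗮ.reflection.toLinearMap) = -1 := by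
    rw [Submodule.det_reflection, Submodule.orthogonal_orthogonal, finrank_span_singleton hv,
      pow_one]
  have hy0 : y ≠ 0 := fun h => by simp [h] at hy
  obtain ⟨v, hv, hv0⟩ : ∃ v ∈ (Submodule.span ℝ {y})ᗮ, v ≠ 0 := by
    refine Submodule.exists_mem_ne_zero_of_ne_bot fun h => ?_
    have h1 := Submodule.finrank_add_finrank_orthogonal (Submodule.span ℝ {y})
    rw [h, finrank_span_singleton hy0, finrank_bot] at h1
    omega
  refine ⟨(Submodule.span ℝ {x - y})ᗮ.reflection.trans (Submodule.span ℝ {v})ᗮ.reflection, ?_, ?_⟩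
  · change LinearMap.det ((Submodule.span ℝ {v})ᗮ.reflection.toLinearMap ∘ₗ
      (Submodule.span ℝ {x - y})ᗮ.reflection.toLinearMap) = 1
    rw [LinearMap.det_comp, hlin _ hv0, hlin _ (sub_ne_zero.2 hxy)]
    norm_num
  · change (Submodule.span ℝ {v})ᗮ.reflection ((Submodule.span ℝ {x - y})ᗮ.reflection x) = y
    rw [Submodule.reflection_sub (by rw [hx, hy]), Submodule.reflection_eq_self_iff,
      Submodule.mem_orthogonal_singleton_iff_inner_right]
    rw [Submodule.mem_orthogonal_singleton_iff_inner_right] at hv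
    rw [real_inner_comm]; exact hv

theorem exists_rot_eq (hd : 1 ≤ d) (x y : Sph d) :
    ∃ g : Euc d ≃ₗᵢ[ℝ] Euc d,
      LinearMap.det (g.toLinearEquiv : Euc d →ₗ[ℝ] Euc d) = 1 ∧ rot g x = y := by
  obtain ⟨g, hg, h⟩ := exists_linearIsometryEquiv_det_eq_one
    (E := Euc d) (by simpa using hd) (norm_eq_of_mem_sphere x)
    (norm_eq_of_mem_sphere y)
  exact ⟨g, hg, Subtype.ext h⟩

theorem geodDist_rot (g : Euc d ≃ₗᵢ[ℝ] Euc d)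
    (x y : Sph d) : geodDist (rot g x) (rot g y) = geodDist x y := by
  unfold geodDist rot
  exact g.toLinearIsometry.angle_map _ _

end Geometry

/-! ### Integrals, powers and products in `ℝ≥0∞` -/

section Tools

theorem lintegral_prod_comp_of_iIndepFun {Ω ι E : Type*} [MeasurableSpace Ω] [MeasurableSpace E]
    {P : Measure Ω} {X : ι → Ω → E} (hX : iIndepFun X P) (hXm : ∀ i, Measurable (X i))
    {G : ι → E → ℝ≥0∞} (hG : ∀ i, Measurable (G i)) (s : Finset ι) :
    ∫⁻ ω, ∏ i ∈ s, G i (X i ω) ∂P = ∏ i ∈ s, ∫⁻ ω, G i (X i ω) ∂P :=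
  lintegral_prod_eq_prod_lintegral_of_indepFun s (fun i ω => G i (X i ω))
    (hX.comp G hG) fun i => (hG i).comp (hXm i)

theorem lintegral_prod_mul_prod_comp_of_iIndepFun {Ω ι E : Type*} [MeasurableSpace Ω]
    [MeasurableSpace E] {P : Measure Ω} {X : ι → Ω → E} (hX : iIndepFun X P)
    (hXm : ∀ i, Measurable (X i)) {G H : ι → E → ℝ≥0∞} (hG : ∀ i, Measurable (G i))
    (hH : ∀ i, Measurable (H i)) {s t : Finset ι} (hst : Disjoint s t) :
    ∫⁻ ω, (∏ i ∈ s, G i (X i ω)) * ∏ i ∈ t, H i (X i ω) ∂P =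
      (∏ i ∈ s, ∫⁻ ω, G i (X i ω) ∂P) * ∏ i ∈ t, ∫⁻ ω, H i (X i ω) ∂P := by
  classical
  have key (F : (E → ℝ≥0∞) → ι → ℝ≥0∞) : (∏ i ∈ s, F (G i) i) * ∏ i ∈ t, F (H i) i =
      ∏ i ∈ s ∪ t, F (if i ∈ s then G i else H i) i := by
    rw [Finset.prod_union hst]
    congr 1
    · exact Finset.prod_congr rfl fun i hi => by rw [if_pos hi]
    · exact Finset.prod_congr rfl fun i hi => by rw [if_neg (Finset.disjoint_right.1 hst hi)]
  rw [key fun F i => ∫⁻ ω, F (X i ω) ∂P]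
  simp_rw [fun ω => key fun F i => F (X i ω)]
  refine lintegral_prod_comp_of_iIndepFun hX hXm (fun i => ?_) _
  split_ifs
  exacts [hG i, hH i]

theorem prod_lintegral_eq_lintegral_pi {S ι : Type*} [MeasurableSpace S] [Fintype ι]
    (ν : Measure S) [IsProbabilityMeasure ν] {f : ι → S → ℝ≥0∞} (hf : ∀ j, Measurable (f j)) :
    ∏ j, ∫⁻ x, f j x ∂ν = ∫⁻ x : ι → S, ∏ j, f j (x j) ∂(Measure.pi fun _ => ν) := by
  rw [lintegral_prod_eq_prod_lintegral_of_indepFun Finset.univ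
    (fun j (x : ι → S) => f j (x j)) (iIndepFun_pi (fun j => (hf j).aemeasurable))
    (fun j => (hf j).comp (measurable_pi_apply j))]
  refine Finset.prod_congr rfl fun j _ => ?_
  exact ((measurePreserving_eval (fun _ : ι => ν) j).lintegral_comp (hf j)).symm

theorem lintegral_pi_pair {S ι : Type*} [MeasurableSpace S] [Fintype ι]
    (ν : Measure S) [IsProbabilityMeasure ν] {f : S × S → ℝ≥0∞} (hf : Measurable f) {m h : ι}
    (hmh : m ≠ h) :
    ∫⁻ x : ι → S, f (x m, x h) ∂(Measure.pi fun _ => ν) = ∫⁻ x, ∫⁻ y, f (x, y) ∂ν ∂ν := by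
  have hind : IndepFun (fun x : ι → S => x m) (fun x => x h) (Measure.pi fun _ => ν) :=
    (iIndepFun_pi (X := fun _ : ι => (id : S → S)) (μ := fun _ => ν)
      (fun _ => aemeasurable_id)).indepFun hmh
  have hmap := (indepFun_iff_map_prod_eq_prod_map_map (measurable_pi_apply m).aemeasurable
    (measurable_pi_apply h).aemeasurable).1 hind
  have hev (j : ι) : Measure.map (fun x : ι → S => x j) (Measure.pi fun _ => ν) = ν :=
    (measurePreserving_eval (fun _ : ι => ν) j).map_eq
  rw [hev, hev] at hmap
  rw [← lintegral_prod _ hf.aemeasurable, ← hmap, lintegral_map hf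
    ((measurable_pi_apply m).prodMk (measurable_pi_apply h))]

theorem ennreal_rpow_sum {ι : Type*} (x : ℝ≥0∞) {p : ι → ℝ} (s : Finset ι) (hp : ∀ j ∈ s, 0 ≤ p j) :
    x ^ (∑ j ∈ s, p j) = ∏ j ∈ s, x ^ p j := by
  classical
  induction s using Finset.induction_on with
  | empty => simp
  | insert j s hj ih =>
    rw [Finset.sum_insert hj, Finset.prod_insert hj, ENNReal.rpow_add_of_nonneg _ _
      (hp j (Finset.mem_insert_self j s)) (Finset.sum_nonneg fun i hi =>
        hp i (Finset.mem_insert_of_mem hi)), ih fun i hi => hp i (Finset.mem_insert_of_mem hi)]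

theorem ennreal_rpow_le_one_add_rpow (x : ℝ≥0∞) {a c : ℝ} (ha : 0 ≤ a) (hac : a ≤ c) :
    x ^ a ≤ 1 + x ^ c := by
  rcases le_total x 1 with h | h
  · exact (ENNReal.rpow_le_one h ha).trans le_self_add
  · exact (ENNReal.rpow_le_rpow_of_exponent_le h hac).trans le_add_self

theorem ennreal_mul_rpow_le_add (x y : ℝ≥0∞) {a : ℝ} (ha : 1 ≤ a) :
    x * y ^ (a - 1) ≤ x ^ a + y ^ a := by
  have h (z : ℝ≥0∞) : z ^ a = z * z ^ (a - 1) := by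
    conv_lhs => rw [show a = 1 + (a - 1) by ring,
      ENNReal.rpow_add_of_nonneg _ _ zero_le_one (by linarith), ENNReal.rpow_one]
  rcases le_total x y with hxy | hxy
  · refine le_trans ?_ le_add_self
    rw [h y]; gcongr
  · refine le_trans ?_ le_self_add
    rw [h x]; gcongr

/-- Jensen's inequality for a power `a ≥ 1` and a probability measure. -/
theorem lintegral_rpow_le_lintegral_rpow {S : Type*} [MeasurableSpace S] {ν : Measure S}
    [IsProbabilityMeasure ν] {f : S → ℝ≥0∞} (hf : AEMeasurable f ν) {a : ℝ} (ha : 1 ≤ a) :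
    (∫⁻ x, f x ∂ν) ^ a ≤ ∫⁻ x, f x ^ a ∂ν := by
  have ha0 : 0 < a := by linarith
  have h := ENNReal.lintegral_mul_norm_pow_le (μ := ν) (hf.pow_const a) aemeasurable_one
    (p := 1 / a) (q := 1 - 1 / a) (by positivity)
    (by rw [sub_nonneg, div_le_one ha0]; exact ha) (by ring)
  simp only [ENNReal.one_rpow, mul_one, lintegral_const, measure_univ,
    ← ENNReal.rpow_mul, mul_one_div_cancel ha0.ne', ENNReal.rpow_one] at h
  calc _ ≤ ((∫⁻ x, f x ^ a ∂ν) ^ (1 / a)) ^ a := ENNReal.rpow_le_rpow h ha0.le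
    _ = _ := by rw [← ENNReal.rpow_mul, one_div_mul_cancel ha0.ne', ENNReal.rpow_one]

/-- The expectation of a product of two integrals of random fields. -/
theorem lintegral_lintegral_mul_lintegral {S Ω : Type*} [MeasurableSpace S] [MeasurableSpace Ω]
    {P : Measure Ω} [SFinite P] {ν : Measure S} [SFinite ν] {f g : S → Ω → ℝ≥0∞}
    (hf : Measurable (Function.uncurry f)) (hg : Measurable (Function.uncurry g)) :
    ∫⁻ ω, (∫⁻ θ, f θ ω ∂ν) * ∫⁻ θ, g θ ω ∂ν ∂P =
      ∫⁻ θ, ∫⁻ θ', ∫⁻ ω, f θ ω * g θ' ω ∂P ∂ν ∂ν := by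
  have hfω (ω : Ω) : Measurable fun θ => f θ ω := hf.comp measurable_prodMk_right
  have hgω (ω : Ω) : Measurable fun θ => g θ ω := hg.comp measurable_prodMk_right
  have hjoint : Measurable fun x : (S × Ω) × S => f x.1.1 x.1.2 * g x.2 x.1.2 :=
    (hf.comp measurable_fst).mul
      (hg.comp (measurable_snd.prodMk (measurable_snd.comp measurable_fst)))
  have h1 (ω : Ω) : (∫⁻ θ, f θ ω ∂ν) * ∫⁻ θ, g θ ω ∂ν = ∫⁻ θ, ∫⁻ θ', f θ ω * g θ' ω ∂ν ∂ν := by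
    rw [← lintegral_mul_const _ (hfω ω)]
    exact lintegral_congr fun θ => (lintegral_const_mul _ (hgω ω)).symm
  simp_rw [h1]
  rw [lintegral_lintegral_swap]
  · refine lintegral_congr fun θ => lintegral_lintegral_swap ?_
    exact (hjoint.comp ((measurable_const.prodMk measurable_fst).prodMk
      measurable_snd)).aemeasurable
  · exact (hjoint.lintegral_prod_right'.comp measurable_swap).aemeasurable

/-- A lower bound on the expectations of a sequence that is bounded in `Lʳ`, `r > 1`, passes to the
limit: the sequence is uniformly integrable. -/
theorem le_lintegral_of_tendsto_of_lintegral_rpow_le {Ω : Type*} [MeasurableSpace Ω]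
    {P : Measure Ω} [IsProbabilityMeasure P] {Z : ℕ → Ω → ℝ≥0∞} {Y : Ω → ℝ≥0∞}
    (hZ : ∀ n, AEMeasurable (Z n) P)
    (hlim : ∀ᵐ ω ∂P, Tendsto (fun n => Z n ω) atTop (𝓝 (Y ω)))
    {r : ℝ} (hr : 1 < r) {C : ℝ≥0∞} (hC : C ≠ ∞) (hbd : ∀ n, ∫⁻ ω, Z n ω ^ r ∂P ≤ C)
    {a : ℝ≥0∞} (ha : ∀ᶠ n in atTop, a ≤ ∫⁻ ω, Z n ω ∂P) : a ≤ ∫⁻ ω, Y ω ∂P := by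
  have hK : ∀ K : ℕ, 0 < K →
      a ≤ (∫⁻ ω, Y ω ∂P) + C * (K : ℝ≥0∞) ^ (1 - r) := by
    intro K hKpos
    have hK0 : (K : ℝ≥0∞) ≠ 0 := by exact_mod_cast hKpos.ne'
    have hKt : (K : ℝ≥0∞) ≠ ∞ := ENNReal.natCast_ne_top K
    have hpt (z : ℝ≥0∞) : z ≤ min z K + z ^ r * (K : ℝ≥0∞) ^ (1 - r) := by
      rcases le_total z K with h | h
      · rw [min_eq_left h]; exact le_self_add
      · refine le_trans ?_ le_add_self
        rcases eq_or_ne z ∞ with rfl | hz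
        · rw [ENNReal.top_rpow_of_pos (by linarith), ENNReal.top_mul]
          exact (ENNReal.rpow_pos (pos_iff_ne_zero.2 hK0) hKt).ne'
        · have hz0 : z ≠ 0 := fun h0 => hK0 (by simpa [h0] using h)
          calc z = z ^ r * z ^ (1 - r) := by
                rw [← ENNReal.rpow_add _ _ hz0 hz]; simp
            _ ≤ _ := by
                rw [← neg_sub r 1, ENNReal.rpow_neg, ENNReal.rpow_neg]
                gcongr
    have h1 : ∀ᶠ n in atTop, a ≤ (∫⁻ ω, min (Z n ω) K ∂P) + C * (K : ℝ≥0∞) ^ (1 - r) := by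
      filter_upwards [ha] with n hn
      calc a ≤ ∫⁻ ω, Z n ω ∂P := hn
        _ ≤ ∫⁻ ω, min (Z n ω) K + Z n ω ^ r * (K : ℝ≥0∞) ^ (1 - r) ∂P :=
            lintegral_mono fun ω => hpt _
        _ = (∫⁻ ω, min (Z n ω) K ∂P) + (∫⁻ ω, Z n ω ^ r ∂P) * (K : ℝ≥0∞) ^ (1 - r) := by
            rw [lintegral_add_left' ((hZ n).min aemeasurable_const),
              lintegral_mul_const'' _ ((hZ n).pow_const r)]
        _ ≤ _ := by gcongr; exact hbd n
    have h2 : Tendsto (fun n => ∫⁻ ω, min (Z n ω) K ∂P) atTop (𝓝 (∫⁻ ω, min (Y ω) K ∂P)) := by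
      refine tendsto_lintegral_of_dominated_convergence' (fun _ => (K : ℝ≥0∞))
        (fun n => (hZ n).min aemeasurable_const)
        (fun n => Eventually.of_forall fun ω => min_le_right _ _)
        (by simp) ?_
      filter_upwards [hlim] with ω hω
      exact hω.min tendsto_const_nhds
    refine (ge_of_tendsto (h2.add_const _) h1).trans ?_
    gcongr
    exact min_le_left _ _
  have hlim0 : Tendsto (fun K : ℕ => (∫⁻ ω, Y ω ∂P) + C * (K : ℝ≥0∞) ^ (1 - r)) atTop
      (𝓝 ((∫⁻ ω, Y ω ∂P) + C * 0)) := by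
    refine Tendsto.const_add _ (ENNReal.Tendsto.const_mul ?_ (Or.inr hC))
    have : Tendsto (fun K : ℕ => ((K : ℝ≥0∞) ^ (r - 1))⁻¹) atTop (𝓝 (∞⁻¹)) := by
      refine tendsto_inv_iff.2 ?_
      have := ((ENNReal.continuous_rpow_const (y := r - 1)).tendsto ∞).comp
        ENNReal.tendsto_nat_nhds_top
      rwa [ENNReal.top_rpow_of_pos (by linarith)] at this
    rw [ENNReal.inv_top] at this
    refine this.congr fun K => ?_
    rw [← ENNReal.rpow_neg, neg_sub]
  rw [mul_zero, add_zero] at hlim0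
  exact ge_of_tendsto hlim0 (eventually_atTop.2 ⟨1, fun K h => hK K h⟩)

/-- Since `Real.log` of a nonpositive number is a junk value, the bound is for `ENNReal.ofReal`,
which vanishes there. -/
theorem exists_prod_ofReal_le_of_summable_log {a : ℕ → ℝ}
    (ha : Summable fun i => Real.log (a i)) :
    ∃ C : ℝ≥0∞, 1 ≤ C ∧ C ≠ ∞ ∧ ∀ s : Finset ℕ, ∏ i ∈ s, ENNReal.ofReal (a i) ≤ C := by
  refine ⟨ENNReal.ofReal (Real.exp (∑' i, |Real.log (a i)|)), ?_, ENNReal.ofReal_ne_top,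
    fun s => ?_⟩
  · rw [ENNReal.one_le_ofReal]
    exact Real.one_le_exp (tsum_nonneg fun i => abs_nonneg _)
  · calc ∏ i ∈ s, ENNReal.ofReal (a i)
        ≤ ∏ i ∈ s, ENNReal.ofReal (Real.exp |Real.log (a i)|) := by
          refine Finset.prod_le_prod' fun i _ => ENNReal.ofReal_le_ofReal ?_
          rcases le_or_gt (a i) 0 with h | h
          · exact h.trans (Real.exp_pos _).le
          · calc a i = Real.exp (Real.log (a i)) := (Real.exp_log h).symm
              _ ≤ _ := Real.exp_le_exp.2 (le_abs_self _)
      _ = ENNReal.ofReal (Real.exp (∑ i ∈ s, |Real.log (a i)|)) := by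
          rw [Real.exp_sum, ENNReal.ofReal_prod_of_nonneg fun i _ => (Real.exp_pos _).le]
      _ ≤ _ := ENNReal.ofReal_le_ofReal (Real.exp_le_exp.2
          (ha.abs.sum_le_tsum s fun i _ => abs_nonneg _))

end Tools

/-! ### Moments of integrals of products of independent fields -/

section IndependentFields

/-- Independent, jointly measurable random fields on a measurable space, with values in `[0, ∞)` and
with mean one. They are written as `ℝ≥0∞`-valued functions, to be integrated without integrability
conditions; independence refers to the product `σ`-algebra on `S → ℝ≥0∞`. -/
structure IsIndepMeanOne {S Ω : Type*} [MeasurableSpace S] [MeasurableSpace Ω] (P : Measure Ω)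
    (L : ℕ → S → Ω → ℝ≥0∞) : Prop where
  measurable : ∀ i, Measurable (Function.uncurry (L i))
  indep : iIndepFun (fun i ω θ => L i θ ω) P
  mean_one : ∀ i θ, ∫⁻ ω, L i θ ω ∂P = 1
  ne_top : ∀ i θ ω, L i θ ω ≠ ∞

/-- The pointwise product of the fields with indices in a finite set. -/
noncomputable def prodField {S Ω : Type*} (L : ℕ → S → Ω → ℝ≥0∞) (s : Finset ℕ) (θ : S) (ω : Ω) :
    ℝ≥0∞ :=
  ∏ i ∈ s, L i θ ω

/-- The integral over `ω` of the product of the powers `pⱼ` of the field `L i` at the points `θⱼ`,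
multiplied over all `i` in a finite set. -/
noncomputable def mixedProd {S Ω ι : Type*} [MeasurableSpace Ω] [Fintype ι] (P : Measure Ω)
    (L : ℕ → S → Ω → ℝ≥0∞) (p : ι → ℝ) (s : Finset ℕ) (θ : ι → S) : ℝ≥0∞ :=
  ∏ i ∈ s, ∫⁻ ω, ∏ j, L i (θ j) ω ^ p j ∂P

namespace IsIndepMeanOne

variable {S Ω ι : Type*} [MeasurableSpace S] [MeasurableSpace Ω] [Fintype ι] {P : Measure Ω}
  {L : ℕ → S → Ω → ℝ≥0∞}

theorem measurable_field (hL : IsIndepMeanOne P L) (i : ℕ) : Measurable fun ω θ => L i θ ω :=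
  measurable_pi_lambda _ fun _ => (hL.measurable i).comp measurable_prodMk_left

theorem measurable_eval (hL : IsIndepMeanOne P L) (i : ℕ) (θ : S) : Measurable (L i θ) :=
  (hL.measurable i).comp measurable_prodMk_left

theorem measurable_uncurry_prodField (hL : IsIndepMeanOne P L) (s : Finset ℕ) :
    Measurable (Function.uncurry (prodField L s)) := by
  have : Function.uncurry (prodField L s) = fun x => ∏ i ∈ s, Function.uncurry (L i) x := rfl
  rw [this]
  exact Finset.measurable_fun_prod s fun i _ => hL.measurable i

theorem measurable_prodField_comp {γ : Type*} [MeasurableSpace γ] (hL : IsIndepMeanOne P L)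
    (s : Finset ℕ) {f : γ → S} {g : γ → Ω} (hf : Measurable f) (hg : Measurable g) :
    Measurable fun x => prodField L s (f x) (g x) :=
  (hL.measurable_uncurry_prodField s).comp (hf.prodMk hg)

theorem measurable_prodField (hL : IsIndepMeanOne P L) (s : Finset ℕ) (θ : S) :
    Measurable (prodField L s θ) :=
  (hL.measurable_uncurry_prodField s).comp measurable_prodMk_left

theorem measurable_prodField_left (hL : IsIndepMeanOne P L) (s : Finset ℕ) (ω : Ω) :
    Measurable fun θ => prodField L s θ ω :=
  (hL.measurable_uncurry_prodField s).comp measurable_prodMk_right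

theorem measurable_lintegral_prodField (hL : IsIndepMeanOne P L) (s : Finset ℕ) (ν : Measure S)
    [SFinite ν] : Measurable fun ω => ∫⁻ θ, prodField L s θ ω ∂ν :=
  (hL.measurable_uncurry_prodField s).lintegral_prod_left

/-- Only evaluations at finitely many points are used in the functionals of the fields: integrals of
the fields over the index space need not be measurable for the product `σ`-algebra. -/
theorem lintegral_prod (hL : IsIndepMeanOne P L) {G : ℕ → (S → ℝ≥0∞) → ℝ≥0∞}
    (hG : ∀ i, Measurable (G i)) (s : Finset ℕ) :
    ∫⁻ ω, ∏ i ∈ s, G i (fun θ => L i θ ω) ∂P = ∏ i ∈ s, ∫⁻ ω, G i (fun θ => L i θ ω) ∂P :=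
  lintegral_prod_comp_of_iIndepFun hL.indep hL.measurable_field hG s

theorem lintegral_prod_mul_prod (hL : IsIndepMeanOne P L) {G H : (S → ℝ≥0∞) → ℝ≥0∞}
    (hG : Measurable G) (hH : Measurable H) {s t : Finset ℕ} (hst : Disjoint s t) :
    ∫⁻ ω, (∏ i ∈ s, G (fun θ => L i θ ω)) * ∏ i ∈ t, H (fun θ => L i θ ω) ∂P =
      (∏ i ∈ s, ∫⁻ ω, G (fun θ => L i θ ω) ∂P) * ∏ i ∈ t, ∫⁻ ω, H (fun θ => L i θ ω) ∂P :=
  lintegral_prod_mul_prod_comp_of_iIndepFun hL.indep hL.measurable_field (fun _ => hG)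
    (fun _ => hH) hst

theorem lintegral_prodField (hL : IsIndepMeanOne P L) (s : Finset ℕ) (θ : S) :
    ∫⁻ ω, prodField L s θ ω ∂P = 1 := by
  unfold prodField
  rw [hL.lintegral_prod (G := fun _ x => x θ) (fun _ => measurable_pi_apply θ)]
  exact Finset.prod_eq_one fun i _ => hL.mean_one i θ

/-- A product over disjoint sets of indices, with powers of the fields at finitely many points. -/
theorem lintegral_prodField_rpow_mul (hL : IsIndepMeanOne P L) {q : ℝ} (hq : 0 ≤ q) {M : ℝ≥0∞}
    (hM : ∀ i θ, ∫⁻ ω, L i θ ω ^ q ∂P = M) {p : ι → ℝ} (hp : ∀ j, 0 ≤ p j) {s t : Finset ℕ}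
    (hst : Disjoint s t) (θ : S) (η : ι → S) :
    ∫⁻ ω, prodField L s θ ω ^ q * ∏ j, prodField L t (η j) ω ^ p j ∂P =
      M ^ s.card * mixedProd P L p t η := by
  have h1 (ω : Ω) : prodField L s θ ω ^ q * ∏ j, prodField L t (η j) ω ^ p j =
      (∏ i ∈ s, L i θ ω ^ q) * ∏ i ∈ t, ∏ j, L i (η j) ω ^ p j := by
    unfold prodField
    rw [ENNReal.prod_rpow_of_nonneg hq, Finset.prod_comm]
    congr 1
    exact Finset.prod_congr rfl fun j _ => (ENNReal.prod_rpow_of_nonneg (hp j)).symm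
  simp_rw [h1]
  rw [hL.lintegral_prod_mul_prod (G := fun x => x θ ^ q) (H := fun x => ∏ j, x (η j) ^ p j)
    ((measurable_pi_apply θ).pow_const q)
    (Finset.measurable_fun_prod _ fun j _ => (measurable_pi_apply (η j)).pow_const _) hst]
  simp_rw [hM]
  rw [Finset.prod_const]
  rfl

theorem lintegral_prodField_rpow (hL : IsIndepMeanOne P L) {q : ℝ} (hq : 0 ≤ q) {M : ℝ≥0∞}
    (hM : ∀ i θ, ∫⁻ ω, L i θ ω ^ q ∂P = M) (s : Finset ℕ) (θ : S) :
    ∫⁻ ω, prodField L s θ ω ^ q ∂P = M ^ s.card := by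
  have := hL.lintegral_prodField_rpow_mul hq hM (ι := Empty) (p := fun _ => 0) (by simp)
    (Finset.disjoint_empty_right s) θ (fun x => x.elim)
  simpa [mixedProd] using this

theorem measurable_prod_prodField_comp {γ : Type*} [MeasurableSpace γ] (hL : IsIndepMeanOne P L)
    (p : ι → ℝ) (t : Finset ℕ) {f : γ → ι → S} {g : γ → Ω} (hf : Measurable f)
    (hg : Measurable g) : Measurable fun x => ∏ j, prodField L t (f x j) (g x) ^ p j :=
  Finset.measurable_fun_prod _ fun j _ =>
    (hL.measurable_prodField_comp t (hf.eval (a := j)) hg).pow_const _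

theorem lintegral_prod_prodField_rpow (hL : IsIndepMeanOne P L) {p : ι → ℝ} (hp : ∀ j, 0 ≤ p j)
    (t : Finset ℕ) (η : ι → S) :
    ∫⁻ ω, ∏ j, prodField L t (η j) ω ^ p j ∂P = mixedProd P L p t η := by
  have h1 (ω : Ω) : ∏ j, prodField L t (η j) ω ^ p j = ∏ i ∈ t, ∏ j, L i (η j) ω ^ p j := by
    unfold prodField
    rw [Finset.prod_comm]
    exact Finset.prod_congr rfl fun j _ => (ENNReal.prod_rpow_of_nonneg (hp j)).symm
  simp_rw [h1]
  exact hL.lintegral_prod (G := fun _ x => ∏ j, x (η j) ^ p j)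
    (fun _ => Finset.measurable_fun_prod _ fun j _ => (measurable_pi_apply (η j)).pow_const _) t

theorem measurable_mixedProd (hL : IsIndepMeanOne P L) [SFinite P] {p : ι → ℝ} (hp : ∀ j, 0 ≤ p j)
    (t : Finset ℕ) : Measurable fun η : ι → S => mixedProd P L p t η := by
  simp_rw [← hL.lintegral_prod_prodField_rpow hp t]
  exact (hL.measurable_prod_prodField_comp p t (γ := (ι → S) × Ω) measurable_fst
    measurable_snd).lintegral_prod_right'

theorem prod_lintegral_rpow_eq_lintegral_pi (hL : IsIndepMeanOne P L)
    {ν : Measure S} [IsProbabilityMeasure ν] (p : ι → ℝ) (t : Finset ℕ) (ω : Ω) :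
    ∏ j, ∫⁻ θ, prodField L t θ ω ^ p j ∂ν =
      ∫⁻ η : ι → S, ∏ j, prodField L t (η j) ω ^ p j ∂(Measure.pi fun _ => ν) :=
  prod_lintegral_eq_lintegral_pi ν fun _ => (hL.measurable_prodField_left t ω).pow_const _

variable [IsProbabilityMeasure P] {ν : Measure S} [IsProbabilityMeasure ν]

/-- The moment of order `∑ pⱼ` of an integral is bounded by writing it as a product and using
Jensen's inequality in each of the variables. -/
theorem lintegral_rpow_sum_le (hL : IsIndepMeanOne P L) {p : ι → ℝ}
    (hp : ∀ j, 1 ≤ p j) (t : Finset ℕ) :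
    ∫⁻ ω, (∫⁻ θ, prodField L t θ ω ∂ν) ^ (∑ j, p j) ∂P ≤
      ∫⁻ η, mixedProd P L p t η ∂(Measure.pi fun _ => ν) := by
  have hp0 (j : ι) : 0 ≤ p j := by linarith [hp j]
  calc ∫⁻ ω, (∫⁻ θ, prodField L t θ ω ∂ν) ^ (∑ j, p j) ∂P
      ≤ ∫⁻ ω, ∫⁻ η : ι → S, ∏ j, prodField L t (η j) ω ^ p j ∂(Measure.pi fun _ => ν) ∂P := by
        refine lintegral_mono fun ω => ?_
        rw [← hL.prod_lintegral_rpow_eq_lintegral_pi p t ω, ennreal_rpow_sum _ _ fun j _ => hp0 j]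
        exact Finset.prod_le_prod' fun j _ => lintegral_rpow_le_lintegral_rpow
          (hL.measurable_prodField_left t ω).aemeasurable (hp j)
    _ = ∫⁻ η : ι → S, ∫⁻ ω, ∏ j, prodField L t (η j) ω ^ p j ∂P ∂(Measure.pi fun _ => ν) :=
        lintegral_lintegral_swap
          (hL.measurable_prod_prodField_comp p t measurable_snd measurable_fst).aemeasurable
    _ = _ := lintegral_congr fun η => hL.lintegral_prod_prodField_rpow hp0 t η

theorem lintegral_sq_le (hL : IsIndepMeanOne P L) {p : ι → ℝ} (hp : ∀ j, 1 ≤ p j)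
    (hp2 : 2 ≤ ∑ j, p j) (t : Finset ℕ) {C : ℝ≥0∞}
    (hC : ∫⁻ η, mixedProd P L p t η ∂(Measure.pi fun _ => ν) ≤ C) :
    ∫⁻ ω, (∫⁻ θ, prodField L t θ ω ∂ν) ^ (2 : ℝ) ∂P ≤ 1 + C := by
  calc _ ≤ ∫⁻ ω, 1 + (∫⁻ θ, prodField L t θ ω ∂ν) ^ (∑ j, p j) ∂P :=
        lintegral_mono fun ω => ennreal_rpow_le_one_add_rpow _ zero_le_two hp2
    _ = 1 + ∫⁻ ω, (∫⁻ θ, prodField L t θ ω ∂ν) ^ (∑ j, p j) ∂P := by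
        rw [lintegral_add_left measurable_const]; simp
    _ ≤ _ := by gcongr; exact (hL.lintegral_rpow_sum_le hp t).trans hC

theorem lintegral_weighted (hL : IsIndepMeanOne P L) {q : ℝ} (hq : 0 ≤ q) {M : ℝ≥0∞}
    (hM : ∀ i θ, ∫⁻ ω, L i θ ω ^ q ∂P = M) {s t : Finset ℕ} (hst : Disjoint s t) :
    ∫⁻ ω, ∫⁻ θ, prodField L s θ ω ^ q * prodField L t θ ω ∂ν ∂P = M ^ s.card := by
  rw [lintegral_lintegral_swap]
  · have h (θ : S) : ∫⁻ ω, prodField L s θ ω ^ q * prodField L t θ ω ∂P = M ^ s.card := by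
      have := hL.lintegral_prodField_rpow_mul hq hM (ι := Unit) (p := fun _ => 1) (by simp) hst θ
        (fun _ => θ)
      simpa [mixedProd, hL.mean_one] using this
    simp [h]
  · exact ((((hL.measurable_uncurry_prodField s).pow_const q).mul
      (hL.measurable_uncurry_prodField t)).comp measurable_swap).aemeasurable

/-- Upper bound for the moments of order `q ∈ [1, p]` of the integral of a product of two
independent blocks `s`, `t` of fields. With `H` the integral of `(∏ₛ L)^q ∏ₜ L` and `A` that of
`∏ₜ L`, Hölder's inequality gives the bound `H * A ^ (q - 1) ≤ H * (1 + A ^ (p - 1))`, whose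
expectation only involves values of the fields at finitely many points. -/
theorem lintegral_rpow_le_of_one_le (hL : IsIndepMeanOne P L) {p : ι → ℝ} (hp : ∀ j, 1 ≤ p j)
    (j₀ : ι) {q : ℝ} (hq : 1 ≤ q) (hqp : q ≤ ∑ j, p j) {M : ℝ≥0∞}
    (hM : ∀ i θ, ∫⁻ ω, L i θ ω ^ q ∂P = M) {s t : Finset ℕ} (hst : Disjoint s t) {C : ℝ≥0∞}
    (hC : ∫⁻ η, mixedProd P L p t η ∂(Measure.pi fun _ => ν) ≤ C) :
    ∫⁻ ω, (∫⁻ θ, prodField L s θ ω * prodField L t θ ω ∂ν) ^ q ∂P ≤ M ^ s.card * (1 + 2 * C) := by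
  classical
  have hp0 (j : ι) : 0 ≤ p j := by linarith [hp j]
  have hq0 : 0 < q := by linarith
  set A : Ω → ℝ≥0∞ := fun ω => ∫⁻ θ, prodField L t θ ω ∂ν with hA
  set H : Ω → ℝ≥0∞ := fun ω => ∫⁻ θ, prodField L s θ ω ^ q * prodField L t θ ω ∂ν with hH
  have hms (ω : Ω) : Measurable fun θ => prodField L s θ ω := hL.measurable_prodField_left s ω
  have hmt (ω : Ω) : Measurable fun θ => prodField L t θ ω := hL.measurable_prodField_left t ω
  -- Hölder's inequality for the measure with density `∏ₜ L`
  have hHolder (ω : Ω) : (∫⁻ θ, prodField L s θ ω * prodField L t θ ω ∂ν) ^ q ≤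
      H ω * A ω ^ (q - 1) := by
    have h := ENNReal.lintegral_mul_norm_pow_le (μ := ν)
      (((hms ω).pow_const q).mul (hmt ω)).aemeasurable (hmt ω).aemeasurable
      (p := 1 / q) (q := 1 - 1 / q) (by positivity)
      (by rw [sub_nonneg, div_le_one hq0]; exact hq) (by ring)
    have hpt (θ : S) : prodField L s θ ω * prodField L t θ ω =
        (prodField L s θ ω ^ q * prodField L t θ ω) ^ (1 / q) *
          prodField L t θ ω ^ (1 - 1 / q) := by
      rw [ENNReal.mul_rpow_of_nonneg _ _ (by positivity), ← ENNReal.rpow_mul,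
        mul_one_div_cancel hq0.ne', ENNReal.rpow_one, mul_assoc, ← ENNReal.rpow_add_of_nonneg _ _
        (by positivity) (by rw [sub_nonneg, div_le_one hq0]; exact hq)]
      simp
    simp only [Pi.mul_apply, ← hpt] at h
    refine (ENNReal.rpow_le_rpow h hq0.le).trans_eq ?_
    rw [ENNReal.mul_rpow_of_nonneg _ _ hq0.le, ← ENNReal.rpow_mul, ← ENNReal.rpow_mul,
      one_div_mul_cancel hq0.ne', ENNReal.rpow_one, sub_mul, one_div_mul_cancel hq0.ne', one_mul]
  have hsplit (ω : Ω) : H ω * A ω ^ ((∑ j, p j) - 1) ≤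
      (∫⁻ η : ι → S, prodField L s (η j₀) ω ^ q * ∏ j, prodField L t (η j) ω ^ p j
        ∂(Measure.pi fun _ => ν)) +
      ∫⁻ θ, ∫⁻ η : ι → S, prodField L s θ ω ^ q * ∏ j, prodField L t (η j) ω ^ p j
        ∂(Measure.pi fun _ => ν) ∂ν := by
    have hsum : (∑ j, p j) - 1 = (p j₀ - 1) + ∑ j ∈ Finset.univ.erase j₀, p j := by
      rw [← Finset.add_sum_erase _ _ (Finset.mem_univ j₀)]; ring
    have h1 : H ω * A ω ^ (p j₀ - 1) ≤
        (∫⁻ θ, prodField L s θ ω ^ q * prodField L t θ ω ^ p j₀ ∂ν) +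
        (∫⁻ θ, prodField L s θ ω ^ q ∂ν) * ∫⁻ θ, prodField L t θ ω ^ p j₀ ∂ν := by
      calc H ω * A ω ^ (p j₀ - 1)
          = ∫⁻ θ, prodField L s θ ω ^ q * (prodField L t θ ω * A ω ^ (p j₀ - 1)) ∂ν := by
            have hm : Measurable fun θ => prodField L s θ ω ^ q * prodField L t θ ω :=
              ((hms ω).pow_const q).mul (hmt ω)
            change (∫⁻ θ, prodField L s θ ω ^ q * prodField L t θ ω ∂ν) * A ω ^ (p j₀ - 1) = _
            rw [← lintegral_mul_const _ hm]
            simp_rw [mul_assoc]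
        _ ≤ ∫⁻ θ, prodField L s θ ω ^ q * prodField L t θ ω ^ p j₀ +
              prodField L s θ ω ^ q * A ω ^ p j₀ ∂ν := by
            refine lintegral_mono fun θ => ?_
            rw [← mul_add]
            gcongr
            exact ennreal_mul_rpow_le_add _ _ (hp j₀)
        _ = (∫⁻ θ, prodField L s θ ω ^ q * prodField L t θ ω ^ p j₀ ∂ν) +
              (∫⁻ θ, prodField L s θ ω ^ q ∂ν) * A ω ^ p j₀ := by
            have hm : Measurable fun θ => prodField L s θ ω ^ q * prodField L t θ ω ^ p j₀ :=
              ((hms ω).pow_const q).mul ((hmt ω).pow_const _)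
            rw [lintegral_add_left hm,
              lintegral_mul_const _ ((hms ω).pow_const q)]
        _ ≤ _ := by
            gcongr
            exact lintegral_rpow_le_lintegral_rpow (hmt ω).aemeasurable (hp j₀)
    have h2 : A ω ^ (∑ j ∈ Finset.univ.erase j₀, p j) ≤
        ∏ j ∈ Finset.univ.erase j₀, ∫⁻ θ, prodField L t θ ω ^ p j ∂ν := by
      rw [ennreal_rpow_sum _ _ fun j _ => hp0 j]
      exact Finset.prod_le_prod' fun j _ =>
        lintegral_rpow_le_lintegral_rpow (hmt ω).aemeasurable (hp j)
    rw [hsum, ENNReal.rpow_add_of_nonneg _ _ (by linarith [hp j₀])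
      (Finset.sum_nonneg fun j _ => hp0 j), ← mul_assoc]
    refine (mul_le_mul' h1 h2).trans_eq ?_
    rw [add_mul]
    congr 1
    · have h3 := prod_lintegral_eq_lintegral_pi ν (ι := ι) (f := fun j θ =>
        (if j = j₀ then prodField L s θ ω ^ q else 1) * prodField L t θ ω ^ p j) (fun j => by
          split_ifs
          · exact ((hms ω).pow_const q).mul ((hmt ω).pow_const _)
          · exact measurable_const.mul ((hmt ω).pow_const _))
      have h4 (η : ι → S) : ∏ j, (if j = j₀ then prodField L s (η j) ω ^ q else 1) *
          prodField L t (η j) ω ^ p j =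
          prodField L s (η j₀) ω ^ q * ∏ j, prodField L t (η j) ω ^ p j := by
        rw [Finset.prod_mul_distrib, Finset.prod_ite_eq' Finset.univ j₀]
        simp
      simp_rw [h4] at h3
      rw [← h3, ← Finset.mul_prod_erase _ _ (Finset.mem_univ j₀)]
      congr 1
      · simp
      · refine Finset.prod_congr rfl fun j hj => ?_
        simp [Finset.ne_of_mem_erase hj]
    · rw [mul_assoc, Finset.mul_prod_erase Finset.univ
        (fun j => ∫⁻ θ, prodField L t θ ω ^ p j ∂ν) (Finset.mem_univ j₀),
        hL.prod_lintegral_rpow_eq_lintegral_pi p t ω, ← lintegral_mul_const _ ((hms ω).pow_const q)]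
      refine lintegral_congr fun θ => ?_
      rw [lintegral_const_mul]
      exact hL.measurable_prod_prodField_comp p t measurable_id measurable_const
  have hHm : Measurable H :=
    (((hL.measurable_uncurry_prodField s).pow_const q).mul
      (hL.measurable_uncurry_prodField t)).lintegral_prod_left'
  have hmix : ∫⁻ η, M ^ s.card * mixedProd P L p t η ∂(Measure.pi fun _ => ν) ≤ M ^ s.card * C := by
    rw [lintegral_const_mul _ (hL.measurable_mixedProd hp0 t)]
    gcongr
  have hterm1 : ∫⁻ ω, ∫⁻ η : ι → S, prodField L s (η j₀) ω ^ q *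
      ∏ j, prodField L t (η j) ω ^ p j ∂(Measure.pi fun _ => ν) ∂P ≤ M ^ s.card * C := by
    rw [lintegral_lintegral_swap]
    · simp_rw [fun η : ι → S => hL.lintegral_prodField_rpow_mul hq0.le hM hp0 hst (η j₀) η]
      exact hmix
    · refine Measurable.aemeasurable (Measurable.mul ?_ ?_)
      · exact (hL.measurable_prodField_comp s ((measurable_pi_apply j₀).comp measurable_snd)
          measurable_fst).pow_const q
      · exact hL.measurable_prod_prodField_comp p t measurable_snd measurable_fst
  have hjoint : Measurable fun x : (S × Ω) × (ι → S) => prodField L s x.1.1 x.1.2 ^ q *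
      ∏ j, prodField L t (x.2 j) x.1.2 ^ p j := by
    refine Measurable.mul ?_ ?_
    · exact (hL.measurable_prodField_comp s (measurable_fst.comp measurable_fst)
        (measurable_snd.comp measurable_fst)).pow_const q
    · exact hL.measurable_prod_prodField_comp p t measurable_snd
        (measurable_snd.comp measurable_fst)
  have hterm2m : Measurable fun x : S × Ω => ∫⁻ η : ι → S, prodField L s x.1 x.2 ^ q *
      ∏ j, prodField L t (η j) x.2 ^ p j ∂(Measure.pi fun _ => ν) := hjoint.lintegral_prod_right'
  have hterm2 : ∫⁻ ω, ∫⁻ θ, ∫⁻ η : ι → S, prodField L s θ ω ^ q *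
      ∏ j, prodField L t (η j) ω ^ p j ∂(Measure.pi fun _ => ν) ∂ν ∂P ≤ M ^ s.card * C := by
    rw [lintegral_lintegral_swap (f := fun ω θ => ∫⁻ η : ι → S, prodField L s θ ω ^ q *
      ∏ j, prodField L t (η j) ω ^ p j ∂(Measure.pi fun _ => ν))
      (hterm2m.comp measurable_swap).aemeasurable]
    have h (θ : S) : ∫⁻ ω, ∫⁻ η : ι → S, prodField L s θ ω ^ q *
        ∏ j, prodField L t (η j) ω ^ p j ∂(Measure.pi fun _ => ν) ∂P ≤ M ^ s.card * C := by
      rw [lintegral_lintegral_swap]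
      · simp_rw [fun η : ι → S => hL.lintegral_prodField_rpow_mul hq0.le hM hp0 hst θ η]
        exact hmix
      · exact (hjoint.comp ((measurable_const.prodMk measurable_fst).prodMk
          measurable_snd)).aemeasurable
    calc _ ≤ ∫⁻ _ : S, M ^ s.card * C ∂ν := lintegral_mono h
      _ = _ := by simp
  calc ∫⁻ ω, (∫⁻ θ, prodField L s θ ω * prodField L t θ ω ∂ν) ^ q ∂P
      ≤ ∫⁻ ω, H ω + H ω * A ω ^ ((∑ j, p j) - 1) ∂P := by
        refine lintegral_mono fun ω => (hHolder ω).trans ?_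
        calc H ω * A ω ^ (q - 1) ≤ H ω * (1 + A ω ^ ((∑ j, p j) - 1)) := by
              gcongr
              exact ennreal_rpow_le_one_add_rpow _ (by linarith) (by linarith)
          _ = _ := by rw [mul_add, mul_one]
    _ = (∫⁻ ω, H ω ∂P) + ∫⁻ ω, H ω * A ω ^ ((∑ j, p j) - 1) ∂P := lintegral_add_left hHm _
    _ ≤ M ^ s.card + (M ^ s.card * C + M ^ s.card * C) := by
        refine add_le_add (hL.lintegral_weighted hq0.le hM hst).le
          ((lintegral_mono hsplit).trans ?_)
        rw [lintegral_add_right _ (hterm2m.lintegral_prod_left' (μ := ν))]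
        exact add_le_add hterm1 hterm2
    _ = _ := by ring

theorem lintegral_weighted_mul (hL : IsIndepMeanOne P L) {q : ℝ} (hq : 0 ≤ q) {M : ℝ≥0∞}
    (hM : ∀ i θ, ∫⁻ ω, L i θ ω ^ q ∂P = M) {s t : Finset ℕ} (hst : Disjoint s t) :
    ∫⁻ ω, (∫⁻ θ, prodField L s θ ω ^ q * prodField L t θ ω ∂ν) * ∫⁻ θ, prodField L t θ ω ∂ν ∂P =
      M ^ s.card * ∫⁻ ω, (∫⁻ θ, prodField L t θ ω ∂ν) ^ (2 : ℝ) ∂P := by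
  have hA2 : ∫⁻ ω, (∫⁻ θ, prodField L t θ ω ∂ν) ^ (2 : ℝ) ∂P =
      ∫⁻ θ, ∫⁻ θ', ∫⁻ ω, prodField L t θ ω * prodField L t θ' ω ∂P ∂ν ∂ν := by
    have h := lintegral_lintegral_mul_lintegral (P := P) (ν := ν) (f := prodField L t)
      (g := prodField L t) (hL.measurable_uncurry_prodField t) (hL.measurable_uncurry_prodField t)
    simp only [ENNReal.rpow_two, sq, h]
  have hpair (θ θ' : S) : ∫⁻ ω, prodField L t θ ω * prodField L t θ' ω ∂P =
      mixedProd P L (fun _ => (1 : ℝ)) t ![θ, θ'] := by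
    rw [← hL.lintegral_prod_prodField_rpow (fun _ => zero_le_one)]
    simp
  have hpair' (θ θ' : S) :
      ∫⁻ ω, (prodField L s θ ω ^ q * prodField L t θ ω) * prodField L t θ' ω ∂P =
      M ^ s.card * mixedProd P L (fun _ => (1 : ℝ)) t ![θ, θ'] := by
    rw [← hL.lintegral_prodField_rpow_mul hq hM (fun _ => zero_le_one) hst θ]
    simp [mul_assoc]
  have hmeas : Measurable fun x : S × S => mixedProd P L (fun _ => (1 : ℝ)) t ![x.1, x.2] := by
    have h2 : Measurable fun x : S × S => ![x.1, x.2] := by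
      rw [measurable_pi_iff, Fin.forall_fin_two]
      exact ⟨measurable_fst, measurable_snd⟩
    have h3 : Measurable fun η : Fin 2 → S => mixedProd P L (fun _ => (1 : ℝ)) t η :=
      hL.measurable_mixedProd (fun _ => zero_le_one) t
    exact h3.comp h2
  have hw : Measurable fun x : S × Ω => prodField L s x.1 x.2 ^ q * prodField L t x.1 x.2 :=
    ((hL.measurable_prodField_comp s measurable_fst measurable_snd).pow_const q).mul
      (hL.measurable_prodField_comp t measurable_fst measurable_snd)
  have hm1 (θ : S) : Measurable fun θ' => mixedProd P L (fun _ => (1 : ℝ)) t ![θ, θ'] :=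
    Measurable.comp (g := fun x : S × S => mixedProd P L (fun _ => (1 : ℝ)) t ![x.1, x.2])
      (f := fun θ' => (θ, θ')) hmeas measurable_prodMk_left
  have hm2 : Measurable fun θ => ∫⁻ θ', mixedProd P L (fun _ => (1 : ℝ)) t ![θ, θ'] ∂ν :=
    hmeas.lintegral_prod_right'
  rw [lintegral_lintegral_mul_lintegral (f := fun θ ω => prodField L s θ ω ^ q * prodField L t θ ω)
    hw (hL.measurable_uncurry_prodField t), hA2]
  simp only [hpair, hpair']
  rw [← lintegral_const_mul _ hm2]
  exact lintegral_congr fun θ => lintegral_const_mul _ (hm1 θ)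

/-- Lower bound for the moments of order `q ∈ (0, 1)` of the integral of a product of two
independent blocks `s`, `t` of fields. With `H` the integral of `(∏ₛ L)^q ∏ₜ L` and `A` that of
`∏ₜ L`, Hölder's inequality bounds `H` by a product of powers of the `q`-th power of that integral
and of `H * A`. -/
theorem le_lintegral_rpow_of_lt_one (hL : IsIndepMeanOne P L) {q : ℝ} (hq0 : 0 < q) (hq : q < 1)
    {M : ℝ≥0∞} (hM0 : M ≠ 0) (hMt : M ≠ ∞)
    (hM : ∀ i θ, ∫⁻ ω, L i θ ω ^ q ∂P = M) {s t : Finset ℕ} (hst : Disjoint s t) {C : ℝ≥0∞}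
    (hC : ∫⁻ ω, (∫⁻ θ, prodField L t θ ω ∂ν) ^ (2 : ℝ) ∂P ≤ C) :
    M ^ s.card ≤ C ^ (1 - q) *
      ∫⁻ ω, (∫⁻ θ, prodField L s θ ω * prodField L t θ ω ∂ν) ^ q ∂P := by
  set A : Ω → ℝ≥0∞ := fun ω => ∫⁻ θ, prodField L t θ ω ∂ν with hA
  set H : Ω → ℝ≥0∞ := fun ω => ∫⁻ θ, prodField L s θ ω ^ q * prodField L t θ ω ∂ν with hH
  set Y : Ω → ℝ≥0∞ := fun ω => ∫⁻ θ, prodField L s θ ω * prodField L t θ ω ∂ν with hY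
  have hms (ω : Ω) : Measurable fun θ => prodField L s θ ω := hL.measurable_prodField_left s ω
  have hmt (ω : Ω) : Measurable fun θ => prodField L t θ ω := hL.measurable_prodField_left t ω
  have hAm : Measurable A := hL.measurable_lintegral_prodField t ν
  have hYm : Measurable Y := ((hL.measurable_uncurry_prodField s).mul
    (hL.measurable_uncurry_prodField t)).lintegral_prod_left'
  have hHm : Measurable H := (((hL.measurable_uncurry_prodField s).pow_const q).mul
    (hL.measurable_uncurry_prodField t)).lintegral_prod_left'
  have hHolder (ω : Ω) : H ω ≤ Y ω ^ q * A ω ^ (1 - q) := by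
    have h := ENNReal.lintegral_mul_norm_pow_le (μ := ν) ((hms ω).mul (hmt ω)).aemeasurable
      (hmt ω).aemeasurable (p := q) (q := 1 - q) hq0.le (by linarith) (by ring)
    refine le_of_eq_of_le (lintegral_congr fun θ => ?_) h
    rw [Pi.mul_apply, ENNReal.mul_rpow_of_nonneg _ _ hq0.le, mul_assoc,
      ← ENNReal.rpow_add_of_nonneg _ _ hq0.le (by linarith)]
    simp
  -- the exponent `σ` solves `σ * (1 - q) = 1 - σ`
  set σ : ℝ := 1 / (2 - q) with hσ
  have h2q : 0 < 2 - q := by linarith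
  have hσ0 : 0 < σ := by positivity
  have hσ1 : 0 ≤ 1 - σ := by rw [hσ, sub_nonneg, div_le_one h2q]; linarith
  have hσq : (1 - q) * σ = 1 - σ := by rw [hσ]; field_simp; ring
  have hpt (ω : Ω) : H ω ≤ (Y ω ^ q) ^ σ * (H ω * A ω) ^ (1 - σ) := by
    calc H ω = H ω ^ σ * H ω ^ (1 - σ) := by
          rw [← ENNReal.rpow_add_of_nonneg _ _ hσ0.le hσ1]; simp
      _ ≤ (Y ω ^ q * A ω ^ (1 - q)) ^ σ * H ω ^ (1 - σ) := by gcongr; exact hHolder ω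
      _ = _ := by
          rw [ENNReal.mul_rpow_of_nonneg _ _ hσ0.le, ENNReal.mul_rpow_of_nonneg _ _ hσ1,
            ← ENNReal.rpow_mul (A ω), hσq]
          ring
  have hHA : ∫⁻ ω, H ω * A ω ∂P ≤ M ^ s.card * C :=
    (hL.lintegral_weighted_mul hq0.le hM hst).trans_le (mul_le_mul_right hC _)
  have h := (lintegral_mono hpt).trans (ENNReal.lintegral_mul_norm_pow_le (μ := P)
    (hYm.pow_const q).aemeasurable (hHm.mul hAm).aemeasurable hσ0.le hσ1 (by ring))
  rw [hL.lintegral_weighted hq0.le hM hst] at h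
  have hM1 : M ^ s.card ≠ 0 := pow_ne_zero _ hM0
  have hM2 : M ^ s.card ≠ ∞ := ENNReal.pow_ne_top hMt
  have h1 : (M ^ s.card) ^ σ * (M ^ s.card) ^ (1 - σ) ≤
      ((∫⁻ ω, Y ω ^ q ∂P) ^ σ * C ^ (1 - σ)) * (M ^ s.card) ^ (1 - σ) := by
    calc _ = M ^ s.card := by rw [← ENNReal.rpow_add_of_nonneg _ _ hσ0.le hσ1]; simp
      _ ≤ _ := h
      _ ≤ (∫⁻ ω, Y ω ^ q ∂P) ^ σ * (M ^ s.card * C) ^ (1 - σ) := by gcongr; exact hHA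
      _ = _ := by rw [ENNReal.mul_rpow_of_nonneg _ _ hσ1]; ring
  rw [ENNReal.mul_le_mul_iff_left (by simp [hM1, hM2])
    (ENNReal.rpow_ne_top_of_nonneg hσ1 hM2)] at h1
  rw [← hσq, ENNReal.rpow_mul, ← ENNReal.mul_rpow_of_nonneg _ _ hσ0.le,
    ENNReal.rpow_le_rpow_iff hσ0, mul_comm] at h1
  exact h1

end IsIndepMeanOne

end IndependentFields

/-! ### Moment bounds with the weight of the fields at one point -/

section IndependentFields

/-- Hölder's inequality turns a lower bound for `E (X^(q/m) Y^(q(m-1)/m))` into one for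
`E (X Y^(q-1))`, when `X` and `Y` have the same moment of order `q`. -/
theorem exists_exponent_le_lintegral_mul_rpow {Ω : Type*} [MeasurableSpace Ω] {P : Measure Ω}
    {q : ℝ} (hq : 1 ≤ q) {m : ℕ} (hm : 2 ≤ m) :
    ∃ s : ℝ, 0 < s ∧ s ≤ 1 ∧ ∀ X Y : Ω → ℝ≥0∞, Measurable X → Measurable Y →
      ∀ M : ℝ≥0∞, ∫⁻ ω, X ω ^ q ∂P = M → ∫⁻ ω, Y ω ^ q ∂P = M →
        ∫⁻ ω, X ω ^ (q / m) * Y ω ^ (q * (m - 1) / m) ∂P ≤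
          (∫⁻ ω, X ω * Y ω ^ (q - 1) ∂P) ^ s * M ^ (1 - s) := by
  have hq0 : 0 < q := by linarith
  have hm2 : (2 : ℝ) ≤ m := by exact_mod_cast hm
  have hm0 : (0 : ℝ) < m := by linarith
  rcases le_or_gt q m with h | h
  · refine ⟨q / m, by positivity, (div_le_one hm0).2 h, fun X Y hX hY M hXM hYM => ?_⟩
    have hs1 : 0 ≤ 1 - q / m := by rw [sub_nonneg, div_le_one hm0]; exact h
    have hs0 : 0 ≤ q / m := by positivity
    refine le_of_eq_of_le (lintegral_congr fun ω => ?_) ((ENNReal.lintegral_mul_norm_pow_le (μ := P)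
      (hX.mul (hY.pow_const (q - 1))).aemeasurable (hY.pow_const q).aemeasurable
      hs0 hs1 (by ring)).trans_eq ?_)
    · rw [Pi.mul_apply, ENNReal.mul_rpow_of_nonneg _ _ hs0, mul_assoc, ← ENNReal.rpow_mul,
        ← ENNReal.rpow_mul, ← ENNReal.rpow_add_of_nonneg _ _ (mul_nonneg (by linarith) hs0)
          (mul_nonneg hq0.le hs1)]
      congr 2
      field_simp
      ring
    · rw [hYM]; rfl
  · have hq1 : 0 < q - 1 := by linarith
    have hle : q * (m - 1) / (m * (q - 1)) ≤ 1 := by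
      rw [div_le_one (by positivity)]; nlinarith
    have hs0 : 0 < q * (m - 1) / (m * (q - 1)) := by
      have : (0 : ℝ) < m - 1 := by linarith
      positivity
    refine ⟨q * (m - 1) / (m * (q - 1)), hs0, hle, fun X Y hX hY M hXM hYM => ?_⟩
    have hs1 : 0 ≤ 1 - q * (m - 1) / (m * (q - 1)) := by linarith
    refine le_of_eq_of_le (lintegral_congr fun ω => ?_) ((ENNReal.lintegral_mul_norm_pow_le (μ := P)
      (hX.mul (hY.pow_const (q - 1))).aemeasurable (hX.pow_const q).aemeasurable
      hs0.le hs1 (by ring)).trans_eq ?_)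
    · rw [Pi.mul_apply, ENNReal.mul_rpow_of_nonneg _ _ hs0.le, mul_right_comm, ← ENNReal.rpow_mul,
        ← ENNReal.rpow_mul, ← ENNReal.rpow_add_of_nonneg _ _ hs0.le (mul_nonneg hq0.le hs1)]
      congr 2
      · field_simp
        ring
      · field_simp
    · rw [hXM]; rfl

namespace IsIndepMeanOne

variable {S Ω : Type*} [MeasurableSpace S] [MeasurableSpace Ω] {P : Measure Ω}
  {L : ℕ → S → Ω → ℝ≥0∞} [IsProbabilityMeasure P] {ν : Measure S} [IsProbabilityMeasure ν]

/-- The fields with indices outside `s` have mean one and do not contribute. -/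
theorem lintegral_mul_prod_eq (hL : IsIndepMeanOne P L) {w : ℝ≥0∞ → ℝ≥0∞} (hw : Measurable w)
    {s t : Finset ℕ} (hst : s ⊆ t) (θ₀ : S) :
    ∫⁻ ω, (∫⁻ θ, prodField L t θ ω ∂ν) * ∏ i ∈ s, w (L i θ₀ ω) ∂P =
      ∫⁻ θ, ∏ i ∈ s, ∫⁻ ω, L i θ ω * w (L i θ₀ ω) ∂P ∂ν := by
  classical
  have hW : Measurable fun ω => ∏ i ∈ s, w (L i θ₀ ω) :=
    Finset.measurable_fun_prod _ fun i _ => hw.comp (hL.measurable_eval i θ₀)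
  have hW2 : Measurable fun x : Ω × S => prodField L t x.2 x.1 * ∏ i ∈ s, w (L i θ₀ x.1) :=
    (hL.measurable_prodField_comp t measurable_snd measurable_fst).mul (hW.comp measurable_fst)
  simp_rw [fun ω => (lintegral_mul_const (∏ i ∈ s, w (L i θ₀ ω))
    (hL.measurable_prodField_left t ω) (μ := ν)).symm]
  rw [lintegral_lintegral_swap hW2.aemeasurable]
  refine lintegral_congr fun θ => ?_
  have h1 (ω : Ω) : prodField L t θ ω * ∏ i ∈ s, w (L i θ₀ ω) =
      (∏ i ∈ s, L i θ ω * w (L i θ₀ ω)) * ∏ i ∈ t \ s, L i θ ω := by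
    unfold prodField
    rw [← Finset.prod_sdiff hst, Finset.prod_mul_distrib]
    ring
  simp_rw [h1]
  rw [hL.lintegral_prod_mul_prod (G := fun x => x θ * w (x θ₀)) (H := fun x => x θ)
    ((measurable_pi_apply θ).mul (hw.comp (measurable_pi_apply θ₀))) (measurable_pi_apply θ)
    Finset.disjoint_sdiff]
  simp [hL.mean_one]

/-- Upper bound for the moments of order `q ∈ (0, 1)`, by Hölder's inequality with the weight
`∏ₛ (L i θ₀)^(q - 1)`. -/
theorem lintegral_rpow_le_of_lt_one (hL : IsIndepMeanOne P L) {q : ℝ} (hq0 : 0 < q) (hq : q < 1)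
    {M : ℝ≥0∞} (hMt : M ≠ ∞) (hM : ∀ i θ, ∫⁻ ω, L i θ ω ^ q ∂P = M) {s t : Finset ℕ}
    (hst : s ⊆ t) (θ₀ : S) {K : ℝ≥0∞} (hK : K ≠ ∞)
    (hbd : ∀ᵐ θ ∂ν, ∏ i ∈ s, ∫⁻ ω, L i θ ω * L i θ₀ ω ^ (q - 1) ∂P ≤ K * M ^ s.card) :
    ∫⁻ ω, (∫⁻ θ, prodField L t θ ω ∂ν) ^ q ∂P ≤ K ^ q * M ^ s.card := by
  set A : Ω → ℝ≥0∞ := fun ω => ∫⁻ θ, prodField L t θ ω ∂ν with hA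
  have hAm : Measurable A := hL.measurable_lintegral_prodField t ν
  have hWeq (ω : Ω) : ∏ i ∈ s, L i θ₀ ω ^ (q - 1) = prodField L s θ₀ ω ^ (q - 1) :=
    ENNReal.prod_rpow_of_ne_top (fun i _ => hL.ne_top i θ₀ ω) _
  have hVm : Measurable (prodField L s θ₀) := hL.measurable_prodField s θ₀
  have hE : ∫⁻ ω, A ω * prodField L s θ₀ ω ^ (q - 1) ∂P ≤ K * M ^ s.card := by
    have h := hL.lintegral_mul_prod_eq (ν := ν) (w := fun x => x ^ (q - 1))
      (measurable_id.pow_const _) hst θ₀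
    simp only [hWeq] at h
    rw [h]
    calc _ ≤ ∫⁻ _ : S, K * M ^ s.card ∂ν := lintegral_mono_ae hbd
      _ = _ := by simp
  have hAW : Measurable fun ω => A ω * prodField L s θ₀ ω ^ (q - 1) := hAm.mul (hVm.pow_const _)
  have hfin : ∀ᵐ ω ∂P, A ω * prodField L s θ₀ ω ^ (q - 1) < ∞ :=
    ae_lt_top hAW (hE.trans_lt
      (ENNReal.mul_lt_top hK.lt_top (ENNReal.pow_lt_top hMt.lt_top))).ne
  have hVtop (ω : Ω) : prodField L s θ₀ ω ≠ ∞ :=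
    ENNReal.prod_ne_top fun i _ => hL.ne_top i θ₀ ω
  -- where the weight is infinite, `A` vanishes almost surely
  have hpt : ∀ᵐ ω ∂P, A ω ^ q ≤
      (A ω * prodField L s θ₀ ω ^ (q - 1)) ^ q * (prodField L s θ₀ ω ^ q) ^ (1 - q) := by
    filter_upwards [hfin] with ω hω
    by_cases h0 : prodField L s θ₀ ω = 0
    · have hA0 : A ω = 0 := by
        by_contra hne
        rw [h0, ENNReal.zero_rpow_of_neg (by linarith), ENNReal.mul_top hne] at hω
        exact lt_irrefl _ hω
      rw [hA0, ENNReal.zero_rpow_of_pos hq0]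
      exact zero_le
    · rw [ENNReal.mul_rpow_of_nonneg _ _ hq0.le, mul_assoc, ← ENNReal.rpow_mul, ← ENNReal.rpow_mul,
        ← ENNReal.rpow_add _ _ h0 (hVtop ω)]
      rw [show (q - 1) * q + q * (1 - q) = 0 by ring, ENNReal.rpow_zero, mul_one]
  have hV : ∫⁻ ω, prodField L s θ₀ ω ^ q ∂P = M ^ s.card :=
    hL.lintegral_prodField_rpow hq0.le hM s θ₀
  calc ∫⁻ ω, A ω ^ q ∂P
      ≤ (∫⁻ ω, A ω * prodField L s θ₀ ω ^ (q - 1) ∂P) ^ q *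
          (∫⁻ ω, prodField L s θ₀ ω ^ q ∂P) ^ (1 - q) :=
        (lintegral_mono_ae hpt).trans (ENNReal.lintegral_mul_norm_pow_le hAW.aemeasurable
          (hVm.pow_const q).aemeasurable hq0.le (by linarith) (by ring))
    _ ≤ (K * M ^ s.card) ^ q * (M ^ s.card) ^ (1 - q) := by rw [hV]; gcongr
    _ = K ^ q * M ^ s.card := by
        rw [ENNReal.mul_rpow_of_nonneg _ _ hq0.le, mul_assoc,
          ← ENNReal.rpow_add_of_nonneg _ _ hq0.le (by linarith)]
        simp

/-- Lower bound for the moments of order `q ≥ 1` of the limit, by Hölder's inequality with the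
weight `∏ (L i θ₀)^(q - 1)`. This weight is truncated to pass to the limit under the expectation. -/
theorem le_lintegral_rpow_of_one_le (hL : IsIndepMeanOne P L) {q : ℝ} (hq : 1 ≤ q)
    {M : ℝ≥0∞} (hM0 : M ≠ 0) (hMt : M ≠ ∞) (hM : ∀ i θ, ∫⁻ ω, L i θ ω ^ q ∂P = M)
    {Y : Ω → ℝ≥0∞} (hY : AEMeasurable Y P)
    (hlim : ∀ᵐ ω ∂P, Tendsto (fun N => ∫⁻ θ, prodField L (Finset.range N) θ ω ∂ν) atTop (𝓝 (Y ω)))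
    {p : ℝ} (hp : 1 < p) {C : ℝ≥0∞} (hC : C ≠ ∞)
    (hbd : ∀ N, ∫⁻ ω, (∫⁻ θ, prodField L (Finset.range N) θ ω ∂ν) ^ p ∂P ≤ C)
    (n : ℕ) (θ₀ : S) {c : ℝ≥0∞}
    (hlow : ∀ᵐ θ ∂ν, c * M ^ n ≤ ∏ i ∈ Finset.range n, ∫⁻ ω, L i θ ω * L i θ₀ ω ^ (q - 1) ∂P) :
    c ^ q * M ^ n ≤ ∫⁻ ω, Y ω ^ q ∂P := by
  have hq0 : 0 < q := by linarith
  have hq1 : 0 ≤ q - 1 := by linarith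
  set A : ℕ → Ω → ℝ≥0∞ := fun N ω => ∫⁻ θ, prodField L (Finset.range N) θ ω ∂ν with hA
  have hAm (N : ℕ) : Measurable (A N) := hL.measurable_lintegral_prodField _ ν
  set W : Ω → ℝ≥0∞ := fun ω => ∏ i ∈ Finset.range n, L i θ₀ ω ^ (q - 1) with hW
  set V : ℕ → Ω → ℝ≥0∞ := fun K ω => ∏ i ∈ Finset.range n, (min (L i θ₀ ω) K) ^ (q - 1) with hV
  have hwm (K : ℕ) : Measurable fun x : ℝ≥0∞ => (min x K) ^ (q - 1) :=
    (measurable_id.min measurable_const).pow_const _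
  have hVm (K : ℕ) : Measurable (V K) :=
    Finset.measurable_fun_prod _ fun i _ => (hwm K).comp (hL.measurable_eval i θ₀)
  have hWm : Measurable W :=
    Finset.measurable_fun_prod _ fun i _ => (hL.measurable_eval i θ₀).pow_const _
  have hVW (K : ℕ) (ω : Ω) : V K ω ≤ W ω := Finset.prod_le_prod' fun i _ => by
    gcongr; exact min_le_left _ _
  have hVmono (ω : Ω) : Monotone fun K => V K ω := fun K K' h => Finset.prod_le_prod' fun i _ => by
    gcongr
  have hVlim (ω : Ω) : ∀ᶠ K in atTop, V K ω = W ω := by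
    have h : ∀ i ∈ Finset.range n, ∀ᶠ K : ℕ in atTop, L i θ₀ ω ≤ K := fun i _ => by
      obtain ⟨K, hK⟩ := ENNReal.exists_nat_gt (hL.ne_top i θ₀ ω)
      exact eventually_atTop.2 ⟨K, fun K' h' => hK.le.trans (by exact_mod_cast h')⟩
    filter_upwards [(Finset.eventually_all (Finset.range n)).2 h] with K hK
    exact Finset.prod_congr rfl fun i hi => by rw [min_eq_left (hK i hi)]
  have hVbd (K : ℕ) (ω : Ω) : V K ω ≤ ((K : ℝ≥0∞) ^ (q - 1)) ^ n := by
    calc V K ω ≤ ∏ _i ∈ Finset.range n, (K : ℝ≥0∞) ^ (q - 1) := Finset.prod_le_prod' fun i _ => by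
          gcongr; exact min_le_right _ _
      _ = _ := by simp
  have hKtop (K : ℕ) : ((K : ℝ≥0∞) ^ (q - 1)) ^ n ≠ ∞ :=
    ENNReal.pow_ne_top (ENNReal.rpow_ne_top_of_nonneg hq1 (ENNReal.natCast_ne_top K))
  have hstep (K : ℕ) : ∫⁻ ω, A n ω * V K ω ∂P ≤ ∫⁻ ω, Y ω * W ω ∂P := by
    have h1 : ∫⁻ ω, A n ω * V K ω ∂P ≤ ∫⁻ ω, Y ω * V K ω ∂P := by
      refine le_lintegral_of_tendsto_of_lintegral_rpow_le (Z := fun N ω => A N ω * V K ω)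
        (fun N => ((hAm N).mul (hVm K)).aemeasurable) ?_ hp
        (C := C * (((K : ℝ≥0∞) ^ (q - 1)) ^ n) ^ p)
        (ENNReal.mul_ne_top hC (ENNReal.rpow_ne_top_of_nonneg (by linarith) (hKtop K))) ?_ ?_
      · filter_upwards [hlim] with ω hω
        exact ENNReal.Tendsto.mul_const hω
          (Or.inr (ne_top_of_le_ne_top (hKtop K) (hVbd K ω)))
      · intro N
        calc ∫⁻ ω, (A N ω * V K ω) ^ p ∂P
            ≤ ∫⁻ ω, A N ω ^ p * (((K : ℝ≥0∞) ^ (q - 1)) ^ n) ^ p ∂P := by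
              refine lintegral_mono fun ω => ?_
              rw [ENNReal.mul_rpow_of_nonneg _ _ (by linarith)]
              gcongr
              exact hVbd K ω
          _ = (∫⁻ ω, A N ω ^ p ∂P) * (((K : ℝ≥0∞) ^ (q - 1)) ^ n) ^ p :=
              lintegral_mul_const _ ((hAm N).pow_const p)
          _ ≤ _ := by gcongr; exact hbd N
      · filter_upwards [eventually_ge_atTop n] with N hN
        have e1 := hL.lintegral_mul_prod_eq (ν := ν) (hwm K)
          (Finset.range_subset_range.2 hN) θ₀
        have e2 := hL.lintegral_mul_prod_eq (ν := ν) (hwm K)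
          (Finset.Subset.refl (Finset.range n)) θ₀
        exact (e2.trans e1.symm).le
    exact h1.trans (lintegral_mono fun ω => mul_le_mul_right (hVW K ω) _)
  have hE : c * M ^ n ≤ ∫⁻ ω, Y ω * W ω ∂P := by
    have h1 : Tendsto (fun K => ∫⁻ ω, A n ω * V K ω ∂P) atTop (𝓝 (∫⁻ ω, A n ω * W ω ∂P)) := by
      refine lintegral_tendsto_of_tendsto_of_monotone (fun K => ((hAm n).mul (hVm K)).aemeasurable)
        (Eventually.of_forall fun ω K K' h => mul_le_mul_right (hVmono ω h) _)
        (Eventually.of_forall fun ω => ?_)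
      refine tendsto_const_nhds.congr' ?_
      filter_upwards [hVlim ω] with K hK
      rw [hK]
    refine le_trans ?_ (le_of_tendsto' h1 hstep)
    have e := hL.lintegral_mul_prod_eq (ν := ν) (w := fun x => x ^ (q - 1))
      (measurable_id.pow_const _) (Finset.Subset.refl (Finset.range n)) θ₀
    refine le_of_le_of_eq ?_ e.symm
    calc c * M ^ n = ∫⁻ _ : S, c * M ^ n ∂ν := by simp
      _ ≤ _ := lintegral_mono_ae hlow
  have hq2 : 0 ≤ 1 - 1 / q := by rw [sub_nonneg, div_le_one hq0]; exact hq
  have hHolder : ∫⁻ ω, Y ω * W ω ∂P ≤ (∫⁻ ω, Y ω ^ q ∂P) ^ (1 / q) * (M ^ n) ^ (1 - 1 / q) := by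
    have hVn : ∫⁻ ω, prodField L (Finset.range n) θ₀ ω ^ q ∂P = M ^ n := by
      rw [hL.lintegral_prodField_rpow hq0.le hM, Finset.card_range]
    rw [← hVn]
    refine le_of_eq_of_le (lintegral_congr fun ω => ?_) (ENNReal.lintegral_mul_norm_pow_le (μ := P)
      (hY.pow_const q) ((hL.measurable_prodField _ θ₀).pow_const q).aemeasurable
      (by positivity) hq2 (by ring))
    rw [← ENNReal.rpow_mul, mul_one_div_cancel hq0.ne', ENNReal.rpow_one, ← ENNReal.rpow_mul,
      mul_sub, mul_one_div_cancel hq0.ne', mul_one]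
    congr 1
    exact ENNReal.prod_rpow_of_nonneg hq1
  have hMn0 : M ^ n ≠ 0 := pow_ne_zero _ hM0
  have hMnt : M ^ n ≠ ∞ := ENNReal.pow_ne_top hMt
  have h := hE.trans hHolder
  have h2 : (c * (M ^ n) ^ (1 / q)) * (M ^ n) ^ (1 - 1 / q) ≤
      (∫⁻ ω, Y ω ^ q ∂P) ^ (1 / q) * (M ^ n) ^ (1 - 1 / q) := by
    rw [mul_assoc, ← ENNReal.rpow_add_of_nonneg _ _ (by positivity) hq2]
    simpa using h
  rw [ENNReal.mul_le_mul_iff_left (by simp [hMn0, hMnt])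
    (ENNReal.rpow_ne_top_of_nonneg hq2 hMnt)] at h2
  have h3 := ENNReal.rpow_le_rpow h2 hq0.le
  rwa [ENNReal.mul_rpow_of_nonneg _ _ hq0.le, ← ENNReal.rpow_mul, ← ENNReal.rpow_mul,
    one_div_mul_cancel hq0.ne', ENNReal.rpow_one, ENNReal.rpow_one] at h3

end IsIndepMeanOne

end IndependentFields

/-! ### Random measures as setwise limits -/

section RandomMeasure

/-- A sequence of random measures whose value on each fixed measurable set converges almost surely,
to a random variable `X B` with expectation `σ B`. -/
structure ConvergesSetwise {S Ω : Type*} [MeasurableSpace S] [MeasurableSpace Ω] (P : Measure Ω)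
    (m : ℕ → Ω → Measure S) (σ : Measure S) (X : Set S → Ω → ℝ≥0∞) : Prop where
  measurable : ∀ B, MeasurableSet B → Measurable (X B)
  tendsto : ∀ B, MeasurableSet B → ∀ᵐ ω ∂P, Tendsto (fun n => m n ω B) atTop (𝓝 (X B ω))
  lintegral_eq : ∀ B, MeasurableSet B → ∫⁻ ω, X B ω ∂P = σ B

namespace ConvergesSetwise

variable {S Ω : Type*} [MeasurableSpace S] [MeasurableSpace Ω] {P : Measure Ω}
  {m : ℕ → Ω → Measure S} {σ : Measure S} {X : Set S → Ω → ℝ≥0∞}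

theorem ae_lt_top [IsFiniteMeasure σ] (h : ConvergesSetwise P m σ X) {B : Set S}
    (hB : MeasurableSet B) : ∀ᵐ ω ∂P, X B ω < ∞ :=
  MeasureTheory.ae_lt_top (h.measurable B hB)
    (by rw [h.lintegral_eq B hB]; exact measure_ne_top σ B)

theorem ae_mono (h : ConvergesSetwise P m σ X) {B D : Set S} (hB : MeasurableSet B)
    (hD : MeasurableSet D) (hBD : B ⊆ D) : ∀ᵐ ω ∂P, X B ω ≤ X D ω := by
  filter_upwards [h.tendsto B hB, h.tendsto D hD] with ω h1 h2
  exact le_of_tendsto_of_tendsto' h1 h2 fun n => measure_mono hBD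

/-- The supremum of the `X (D k)` is almost surely at most `X` of the union, and both have the same
expectation. -/
theorem ae_tendsto_of_monotone [IsFiniteMeasure σ] (h : ConvergesSetwise P m σ X) {D : ℕ → Set S}
    (hD : ∀ k, MeasurableSet (D k)) (hmono : Monotone D) :
    ∀ᵐ ω ∂P, Tendsto (fun k => X (D k) ω) atTop (𝓝 (X (⋃ k, D k) ω)) := by
  have hU : MeasurableSet (⋃ k, D k) := MeasurableSet.iUnion hD
  have hm : ∀ᵐ ω ∂P, Monotone fun k => X (D k) ω := by
    have : ∀ᵐ ω ∂P, ∀ k, X (D k) ω ≤ X (D (k + 1)) ω :=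
      ae_all_iff.2 fun k => h.ae_mono (hD k) (hD (k + 1)) (hmono k.le_succ)
    filter_upwards [this] with ω hω using monotone_nat_of_le_succ hω
  have hle : (fun ω => ⨆ k, X (D k) ω) ≤ᵐ[P] X (⋃ k, D k) := by
    have : ∀ᵐ ω ∂P, ∀ k, X (D k) ω ≤ X (⋃ k, D k) ω :=
      ae_all_iff.2 fun k => h.ae_mono (hD k) hU (Set.subset_iUnion D k)
    filter_upwards [this] with ω hω using iSup_le hω
  have hint : ∫⁻ ω, ⨆ k, X (D k) ω ∂P = σ (⋃ k, D k) := by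
    rw [lintegral_iSup' (fun k => (h.measurable _ (hD k)).aemeasurable) hm]
    simp_rw [fun k => h.lintegral_eq _ (hD k)]
    exact (hmono.measure_iUnion).symm
  have heq := ae_eq_of_ae_le_of_lintegral_le hle (by rw [hint]; exact measure_ne_top σ _)
    (h.measurable _ hU).aemeasurable (by rw [hint, h.lintegral_eq _ hU])
  filter_upwards [hm, heq] with ω h1 h2
  rw [← h2]
  exact tendsto_atTop_iSup h1

theorem ae_compl (h : ConvergesSetwise P m σ X) {B : Set S} (hB : MeasurableSet B) :
    ∀ᵐ ω ∂P, X B ω + X Bᶜ ω = X Set.univ ω := by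
  filter_upwards [h.tendsto B hB, h.tendsto _ hB.compl, h.tendsto _ MeasurableSet.univ]
    with ω h1 h2 h3
  refine tendsto_nhds_unique (h1.add h2) (h3.congr fun n => ?_)
  exact (measure_add_measure_compl hB).symm

theorem ae_tendsto_of_antitone [IsFiniteMeasure σ] (h : ConvergesSetwise P m σ X) {D : ℕ → Set S}
    (hD : ∀ k, MeasurableSet (D k)) (hanti : Antitone D) :
    ∀ᵐ ω ∂P, Tendsto (fun k => X (D k) ω) atTop (𝓝 (X (⋂ k, D k) ω)) := by
  have hI : MeasurableSet (⋂ k, D k) := MeasurableSet.iInter hD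
  have hc := h.ae_tendsto_of_monotone (fun k => (hD k).compl)
    (fun i j hij => Set.compl_subset_compl.2 (hanti hij))
  rw [← Set.compl_iInter] at hc
  filter_upwards [hc, ae_all_iff.2 fun k => h.ae_compl (hD k), h.ae_compl hI,
    h.ae_lt_top MeasurableSet.univ] with ω h1 h2 h3 h4
  have hfin {a c : ℝ≥0∞} (hac : a + c = X Set.univ ω) : a = X Set.univ ω - c := by
    rw [← hac, ENNReal.add_sub_cancel_right]
    exact ne_top_of_le_ne_top h4.ne (hac ▸ le_add_self)
  rw [hfin h3]
  simp_rw [fun k => hfin (h2 k)]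
  exact ENNReal.Tendsto.sub tendsto_const_nhds h1 (Or.inl h4.ne)

theorem ae_iUnion [IsFiniteMeasure σ] (h : ConvergesSetwise P m σ X) {D : ℕ → Set S}
    (hD : ∀ k, MeasurableSet (D k)) (hdisj : Pairwise (Function.onFun Disjoint D)) :
    ∀ᵐ ω ∂P, X (⋃ k, D k) ω = ∑' k, X (D k) ω := by
  have hmeas (n : ℕ) : MeasurableSet (⋃ k ∈ Finset.range n, D k) :=
    Finset.measurableSet_biUnion _ fun k _ => hD k
  have hmono : Monotone fun n => ⋃ k ∈ Finset.range n, D k := fun i j hij =>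
    Set.biUnion_subset_biUnion_left fun k hk => Finset.range_subset_range.2 hij hk
  have hU : ⋃ n, ⋃ k ∈ Finset.range n, D k = ⋃ k, D k := by
    ext x
    simp only [Set.mem_iUnion, Finset.mem_range]
    exact ⟨fun ⟨_, k, _, hx⟩ => ⟨k, hx⟩, fun ⟨k, hx⟩ => ⟨k + 1, k, k.lt_succ_self, hx⟩⟩
  have hfin : ∀ᵐ ω ∂P, ∀ n, X (⋃ k ∈ Finset.range n, D k) ω = ∑ k ∈ Finset.range n, X (D k) ω := by
    refine ae_all_iff.2 fun n => ?_
    filter_upwards [h.tendsto _ (hmeas n), ae_all_iff.2 fun k => h.tendsto _ (hD k)] with ω h1 h2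
    refine tendsto_nhds_unique h1 ((tendsto_finsetSum (Finset.range n) fun k _ => h2 k).congr
      fun N => ?_)
    exact (measure_biUnion_finset (fun i _ j _ hij => hdisj hij) fun k _ => hD k).symm
  have hlim := h.ae_tendsto_of_monotone hmeas hmono
  rw [hU] at hlim
  filter_upwards [hlim, hfin] with ω h1 h2
  simp_rw [h2] at h1
  exact tendsto_nhds_unique h1 ENNReal.summable.tendsto_sum_tsum_nat

/-- On the real line, the limits on the half-lines with rational end points are, after
normalization, the values of a distribution function. -/
theorem isRatStieltjesPoint {m : ℕ → Ω → Measure ℝ} {σ : Measure ℝ} [IsFiniteMeasure σ]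
    {X : Set ℝ → Ω → ℝ≥0∞} (h : ConvergesSetwise P m σ X) :
    ∀ᵐ ω ∂P, X Set.univ ω ≠ 0 → IsRatStieltjesPoint
      (fun ω (r : ℚ) => (X (Set.Iic (r : ℝ)) ω / X Set.univ ω).toReal) ω := by
  have hmono : ∀ᵐ ω ∂P, ∀ r r' : ℚ, r ≤ r' → X (Set.Iic (r : ℝ)) ω ≤ X (Set.Iic (r' : ℝ)) ω := by
    refine ae_all_iff.2 fun r => ae_all_iff.2 fun r' => ?_
    by_cases hr : r ≤ r'
    · filter_upwards [h.ae_mono measurableSet_Iic measurableSet_Iic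
        (Set.Iic_subset_Iic.2 (show (r : ℝ) ≤ r' by exact_mod_cast hr))] with ω hω _ using hω
    · exact Eventually.of_forall fun ω h' => absurd h' hr
  have hle : ∀ᵐ ω ∂P, ∀ r : ℚ, X (Set.Iic (r : ℝ)) ω ≤ X Set.univ ω :=
    ae_all_iff.2 fun r => h.ae_mono measurableSet_Iic MeasurableSet.univ (Set.subset_univ _)
  have htop := h.ae_tendsto_of_monotone (D := fun k : ℕ => Set.Iic (((k : ℚ) : ℝ)))
    (fun k => measurableSet_Iic) (fun i j hij => Set.Iic_subset_Iic.2 (by exact_mod_cast hij))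
  have htopU : ⋃ k : ℕ, Set.Iic (((k : ℚ) : ℝ)) = Set.univ := by
    refine Set.eq_univ_of_forall fun x => ?_
    obtain ⟨k, hk⟩ := exists_nat_ge x
    exact Set.mem_iUnion.2 ⟨k, by simpa using hk⟩
  have hbot := h.ae_tendsto_of_antitone (D := fun k : ℕ => Set.Iic (((-k : ℚ) : ℝ)))
    (fun k => measurableSet_Iic) (fun i j hij => Set.Iic_subset_Iic.2 (by
      push_cast; exact neg_le_neg (by exact_mod_cast hij)))
  have hbotI : ⋂ k : ℕ, Set.Iic (((-k : ℚ) : ℝ)) = ∅ := by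
    refine Set.eq_empty_of_forall_notMem fun x hx => ?_
    obtain ⟨k, hk⟩ := exists_nat_gt (-x)
    have := Set.mem_iInter.1 hx k
    simp only [Set.mem_Iic] at this
    push_cast at this
    linarith
  have hright : ∀ᵐ ω ∂P, ∀ t : ℚ, Tendsto
      (fun k : ℕ => X (Set.Iic (((t + 1 / (k + 1 : ℚ) : ℚ) : ℝ))) ω) atTop
      (𝓝 (X (Set.Iic (t : ℝ)) ω)) := by
    refine ae_all_iff.2 fun t => ?_
    have hI : ⋂ k : ℕ, Set.Iic (((t + 1 / (k + 1 : ℚ) : ℚ) : ℝ)) = Set.Iic (t : ℝ) := by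
      ext x
      simp only [Set.mem_iInter, Set.mem_Iic]
      push_cast
      constructor
      · intro hx
        refine le_of_forall_pos_le_add fun ε hε => ?_
        obtain ⟨k, hk⟩ := exists_nat_one_div_lt hε
        exact (hx k).trans (by linarith)
      · intro hx k
        have : (0 : ℝ) ≤ 1 / ((k : ℝ) + 1) := by positivity
        linarith
    have := h.ae_tendsto_of_antitone (D := fun k : ℕ => Set.Iic (((t + 1 / (k + 1 : ℚ) : ℚ) : ℝ)))
      (fun k => measurableSet_Iic) (fun i j hij => Set.Iic_subset_Iic.2 (by
        push_cast
        gcongr))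
    rwa [hI] at this
  rw [htopU] at htop
  rw [hbotI] at hbot
  have hempty : ∀ᵐ ω ∂P, X ∅ ω = 0 := by
    refine (lintegral_eq_zero_iff (h.measurable _ MeasurableSet.empty)).1 ?_
    rw [h.lintegral_eq _ MeasurableSet.empty, measure_empty]
  filter_upwards [hmono, hle, htop, hbot, hright, hempty, h.ae_lt_top MeasurableSet.univ]
    with ω hmono hle htop hbot hright hempty hfin hne
  set U := X Set.univ ω
  have hdiv (r : ℚ) : X (Set.Iic (r : ℝ)) ω / U ≤ 1 :=
    ENNReal.div_le_of_le_mul (by simpa using hle r)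
  have hdivt (r : ℚ) : X (Set.Iic (r : ℝ)) ω / U ≠ ∞ :=
    ne_top_of_le_ne_top ENNReal.one_ne_top (hdiv r)
  have hf : Monotone fun r : ℚ => (X (Set.Iic (r : ℝ)) ω / U).toReal := fun r r' hr =>
    ENNReal.toReal_mono (hdivt r') (ENNReal.div_le_div_right (hmono r r' hr) _)
  have hconv {g : ℕ → ℚ} {c : ℝ≥0∞} (hc : c ≠ ∞)
      (hg : Tendsto (fun k => X (Set.Iic (g k : ℝ)) ω) atTop (𝓝 c)) :
      Tendsto (fun k => (X (Set.Iic (g k : ℝ)) ω / U).toReal) atTop (𝓝 (c / U).toReal) :=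
    (ENNReal.tendsto_toReal (ENNReal.div_ne_top hc hne)).comp
      (ENNReal.Tendsto.div_const hg (Or.inr hne))
  refine ⟨hf, ?_, ?_, ?_⟩
  · refine tendsto_atTop_isLUB hf ⟨?_, fun c hc => ?_⟩
    · rintro _ ⟨r, rfl⟩
      simpa using ENNReal.toReal_mono ENNReal.one_ne_top (hdiv r)
    · have h1 := hconv hfin.ne htop
      rw [ENNReal.div_self hne hfin.ne, ENNReal.toReal_one] at h1
      exact le_of_tendsto' h1 fun k => hc ⟨_, rfl⟩
  · refine tendsto_atBot_isGLB hf ⟨?_, fun c hc => ?_⟩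
    · rintro _ ⟨r, rfl⟩
      exact ENNReal.toReal_nonneg
    · rw [hempty] at hbot
      have h1 := hconv ENNReal.zero_ne_top hbot
      rw [ENNReal.zero_div, ENNReal.toReal_zero] at h1
      exact ge_of_tendsto' h1 fun k => hc ⟨_, rfl⟩
  · intro t
    have hbdd : BddBelow (Set.range fun r : Set.Ioi t =>
        (X (Set.Iic ((r : ℚ) : ℝ)) ω / U).toReal) :=
      ⟨0, by rintro _ ⟨r, rfl⟩; exact ENNReal.toReal_nonneg⟩
    have : Nonempty (Set.Ioi t) := ⟨⟨t + 1, by simp⟩⟩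
    refine le_antisymm ?_ (le_ciInf fun r => hf r.2.le)
    refine ge_of_tendsto' (hconv (ne_top_of_le_ne_top hfin.ne (hle t)) (hright t)) fun k => ?_
    exact ciInf_le hbdd (⟨t + 1 / (k + 1 : ℚ), by
      have : (0 : ℚ) < 1 / ((k : ℚ) + 1) := by positivity
      simpa using this⟩ : Set.Ioi t)

theorem exists_measure_real {m : ℕ → Ω → Measure ℝ} {σ : Measure ℝ} [IsFiniteMeasure σ]
    {X : Set ℝ → Ω → ℝ≥0∞} (h : ConvergesSetwise P m σ X) :
    ∃ κ : Ω → Measure ℝ, Measurable κ ∧ ∀ B, MeasurableSet B → ∀ᵐ ω ∂P, κ ω B = X B ω := by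
  set f : Ω → ℚ → ℝ := fun ω r => (X (Set.Iic (r : ℝ)) ω / X Set.univ ω).toReal with hf
  have hfm : Measurable f := measurable_pi_lambda _ fun r =>
    ((h.measurable _ measurableSet_Iic).div (h.measurable _ MeasurableSet.univ)).ennreal_toReal
  set G : Ω → Measure ℝ := fun ω => (stieltjesOfMeasurableRat f hfm ω).measure with hG
  have hGm : Measurable G := measurable_measure_stieltjesOfMeasurableRat hfm
  refine ⟨fun ω => X Set.univ ω • G ω, ?_, ?_⟩
  · refine Measure.measurable_of_measurable_coe _ fun B hB => ?_
    simp only [Measure.smul_apply, smul_eq_mul]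
    exact (h.measurable _ MeasurableSet.univ).mul ((Measure.measurable_coe hB).comp hGm)
  have huniv (ω : Ω) : (X Set.univ ω • G ω) Set.univ = X Set.univ ω := by
    simp [hG]
  intro B hB
  have hempty : ∀ᵐ ω ∂P, X ∅ ω = 0 := by
    refine (lintegral_eq_zero_iff (h.measurable _ MeasurableSet.empty)).1 ?_
    rw [h.lintegral_eq _ MeasurableSet.empty, measure_empty]
  refine MeasurableSpace.induction_on_inter
    (C := fun B _ => ∀ᵐ ω ∂P, (X Set.univ ω • G ω) B = X B ω)
    ((inferInstance : BorelSpace ℝ).measurable_eq.trans Real.borel_eq_generateFrom_Iic_rat)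
    Real.isPiSystem_Iic_rat ?_ ?_ ?_ ?_ B hB
  · filter_upwards [hempty] with ω hω
    simp [hω]
  · intro t ht
    obtain ⟨r, rfl⟩ := Set.mem_iUnion.1 ht
    filter_upwards [h.isRatStieltjesPoint, h.ae_lt_top MeasurableSet.univ,
      h.ae_mono (measurableSet_Iic (a := (r : ℝ))) MeasurableSet.univ (Set.subset_univ _)]
      with ω h1 h2 h3
    rw [Measure.smul_apply, smul_eq_mul]
    by_cases h0 : X Set.univ ω = 0
    · rw [h0] at h3 ⊢
      rw [zero_mul, nonpos_iff_eq_zero.1 h3]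
    · simp only [hG]
      rw [measure_stieltjesOfMeasurableRat_Iic, stieltjesOfMeasurableRat_eq,
        toRatCDF_of_isRatStieltjesPoint (h1 h0), ENNReal.ofReal_toReal
          (ENNReal.div_ne_top (ne_top_of_le_ne_top h2.ne h3) h0), ENNReal.mul_div_cancel h0 h2.ne]
  · intro t ht ih
    filter_upwards [ih, h.ae_compl ht, h.ae_lt_top MeasurableSet.univ] with ω h1 h2 h3
    have h4 := measure_add_measure_compl (μ := X Set.univ ω • G ω) ht
    rw [huniv, h1] at h4
    refine (ENNReal.add_right_inj ?_).1 (h4.trans h2.symm)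
    exact ne_top_of_le_ne_top h3.ne (h2 ▸ le_self_add)
  · intro D hdisj hD ih
    filter_upwards [ae_all_iff.2 ih, h.ae_iUnion hD hdisj] with ω h1 h2
    rw [measure_iUnion hdisj hD, h2]
    exact tsum_congr h1

/-- Random measures on a standard Borel space that converge setwise have a random measure as their
limit. The space is embedded into the real line, where a measure is given by a distribution
function. -/
theorem exists_measure [IsFiniteMeasure σ] [StandardBorelSpace S] (h : ConvergesSetwise P m σ X) :
    ∃ κ : Ω → Measure S, Measurable κ ∧
      ∀ B, MeasurableSet B → ∀ᵐ ω ∂P, Tendsto (fun n => m n ω B) atTop (𝓝 (κ ω B)) := by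
  have he := measurableEmbedding_embeddingReal S
  set e := embeddingReal S
  have h' : ConvergesSetwise P (fun n ω => (m n ω).map e) (σ.map e) (fun D => X (e ⁻¹' D)) := by
    refine ⟨fun D hD => h.measurable _ (he.measurable hD), fun D hD => ?_, fun D hD => ?_⟩
    · simp_rw [Measure.map_apply he.measurable hD]
      exact h.tendsto _ (he.measurable hD)
    · rw [Measure.map_apply he.measurable hD, h.lintegral_eq _ (he.measurable hD)]
  obtain ⟨κ, hκ, hκX⟩ := h'.exists_measure_real
  refine ⟨fun ω => (κ ω).comap e, ?_, fun B hB => ?_⟩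
  · refine Measure.measurable_of_measurable_coe _ fun B hB => ?_
    simp_rw [he.comap_apply]
    exact (Measure.measurable_coe (he.measurableSet_image.2 hB)).comp hκ
  · filter_upwards [hκX _ (he.measurableSet_image.2 hB), h.tendsto B hB] with ω h1 h2
    rw [he.comap_apply, h1, Set.preimage_image_eq _ he.injective]
    exact h2

end ConvergesSetwise

end RandomMeasure

/-! ### The martingale of the masses -/

section Martingale

/-- A conditional expectation in `ℝ≥0∞`: the density of the trimmed measures. -/
theorem exists_measurable_lintegral_mul_eq {Ω : Type*} {𝒢 mΩ : MeasurableSpace Ω} (h𝒢 : 𝒢 ≤ mΩ)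
    {P : Measure Ω} [IsFiniteMeasure P] {W : Ω → ℝ≥0∞} (hW : Measurable W)
    (hfin : ∫⁻ ω, W ω ∂P ≠ ∞) :
    ∃ V : Ω → ℝ≥0∞, Measurable[𝒢] V ∧ ∀ f : Ω → ℝ≥0∞, Measurable[𝒢] f →
      ∫⁻ ω, W ω * f ω ∂P = ∫⁻ ω, V ω * f ω ∂P := by
  have : IsFiniteMeasure (P.withDensity W) := isFiniteMeasure_withDensity hfin
  have hac : (P.withDensity W).trim h𝒢 ≪ P.trim h𝒢 :=
    (withDensity_absolutelyContinuous P W).trim h𝒢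
  refine ⟨((P.withDensity W).trim h𝒢).rnDeriv (P.trim h𝒢), Measure.measurable_rnDeriv _ _,
    fun f hf => ?_⟩
  have hVm := Measure.measurable_rnDeriv ((P.withDensity W).trim h𝒢) (P.trim h𝒢)
  calc ∫⁻ ω, W ω * f ω ∂P = ∫⁻ ω, f ω ∂(P.withDensity W) :=
        (lintegral_withDensity_eq_lintegral_mul P hW (hf.mono h𝒢 le_rfl)).symm
    _ = ∫⁻ ω, f ω ∂((P.withDensity W).trim h𝒢) := (lintegral_trim h𝒢 hf).symm
    _ = ∫⁻ ω, f ω ∂((P.trim h𝒢).withDensity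
          (((P.withDensity W).trim h𝒢).rnDeriv (P.trim h𝒢))) := by
        rw [Measure.withDensity_rnDeriv_eq _ _ hac]
    _ = ∫⁻ ω, (((P.withDensity W).trim h𝒢).rnDeriv (P.trim h𝒢)) ω * f ω ∂(P.trim h𝒢) :=
        lintegral_withDensity_eq_lintegral_mul _ hVm hf
    _ = _ := lintegral_trim h𝒢 (hVm.mul hf)

/-- The integral over the index space of a jointly measurable field is almost surely equal to a
variable that is measurable for any `σ`-algebra for which the single values of the field are: by
Fubini's theorem, the integral and its conditional expectation have the same integral over every
event. -/
theorem exists_measurable_ae_eq_lintegral {S Ω : Type*} [MeasurableSpace S]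
    {𝒢 mΩ : MeasurableSpace Ω} (h𝒢 : 𝒢 ≤ mΩ) {P : Measure Ω} [IsFiniteMeasure P] {ν : Measure S}
    [SFinite ν] {T : S → Ω → ℝ≥0∞} (hT : Measurable (Function.uncurry T))
    (hT𝒢 : ∀ θ, Measurable[𝒢] (T θ)) (hfin : ∫⁻ ω, ∫⁻ θ, T θ ω ∂ν ∂P ≠ ∞) :
    ∃ V : Ω → ℝ≥0∞, Measurable[𝒢] V ∧ (fun ω => ∫⁻ θ, T θ ω ∂ν) =ᵐ[P] V := by
  have hW : Measurable fun ω => ∫⁻ θ, T θ ω ∂ν := hT.lintegral_prod_left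
  obtain ⟨V, hV, hVeq⟩ := exists_measurable_lintegral_mul_eq h𝒢 hW hfin
  refine ⟨V, hV, ae_eq_of_forall_setLIntegral_eq_of_sigmaFinite hW (hV.mono h𝒢 le_rfl)
    fun A hA _ => ?_⟩
  obtain ⟨g, hg, hgeq⟩ := exists_measurable_lintegral_mul_eq h𝒢 (P := P)
    (W := A.indicator fun _ => 1) (measurable_const.indicator hA)
    (by rw [lintegral_indicator_const hA]; exact ENNReal.mul_ne_top ENNReal.one_ne_top
          (measure_ne_top P A))
  have hind (f : Ω → ℝ≥0∞) : ∫⁻ ω in A, f ω ∂P = ∫⁻ ω, A.indicator (fun _ => 1) ω * f ω ∂P := by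
    rw [← lintegral_indicator hA]
    refine lintegral_congr fun ω => ?_
    by_cases h : ω ∈ A <;> simp [h]
  have hswap (f : Ω → ℝ≥0∞) (hf : Measurable f) :
      ∫⁻ ω, f ω * ∫⁻ θ, T θ ω ∂ν ∂P = ∫⁻ θ, ∫⁻ ω, f ω * T θ ω ∂P ∂ν := by
    have hm : Measurable fun x : Ω × S => f x.1 * T x.2 x.1 :=
      (hf.comp measurable_fst).mul (hT.comp measurable_swap)
    rw [← lintegral_lintegral_swap hm.aemeasurable]
    exact lintegral_congr fun ω =>
      (lintegral_const_mul _ (hT.comp measurable_prodMk_right)).symm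
  calc ∫⁻ ω in A, ∫⁻ θ, T θ ω ∂ν ∂P
      = ∫⁻ θ, ∫⁻ ω, A.indicator (fun _ => 1) ω * T θ ω ∂P ∂ν := by
        rw [hind, hswap _ (measurable_const.indicator hA)]
    _ = ∫⁻ θ, ∫⁻ ω, g ω * T θ ω ∂P ∂ν := lintegral_congr fun θ => hgeq _ (hT𝒢 θ)
    _ = ∫⁻ ω, (∫⁻ θ, T θ ω ∂ν) * g ω ∂P := by
        rw [← hswap _ (hg.mono h𝒢 le_rfl)]
        simp_rw [mul_comm]
    _ = ∫⁻ ω, V ω * g ω ∂P := hVeq g hg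
    _ = ∫⁻ ω, A.indicator (fun _ => 1) ω * V ω ∂P := by
        rw [hgeq V hV]; simp_rw [mul_comm]
    _ = ∫⁻ ω in A, V ω ∂P := (hind V).symm

namespace IsIndepMeanOne

variable {S Ω : Type*} [MeasurableSpace S] [mΩ : MeasurableSpace Ω] {P : Measure Ω}
  {L : ℕ → S → Ω → ℝ≥0∞}

/-- The filtration generated by the values of the first `n` fields. -/
def filtration (hL : IsIndepMeanOne P L) : Filtration ℕ mΩ where
  seq n := ⨆ i ∈ Set.Iio n, MeasurableSpace.comap (fun ω θ => L i θ ω) inferInstance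
  mono' _ _ h := biSup_mono fun _ hi => lt_of_lt_of_le hi h
  le' _ := iSup₂_le fun i _ => (hL.measurable_field i).comap_le

theorem measurable_filtration_prodField (hL : IsIndepMeanOne P L) (n : ℕ) (θ : S) :
    Measurable[hL.filtration n] (prodField L (Finset.range n) θ) := by
  refine Finset.measurable_fun_prod _ fun i hi => ?_
  have h1 : Measurable[MeasurableSpace.comap (fun ω θ => L i θ ω) inferInstance] (L i θ) :=
    (measurable_pi_apply θ).comp (comap_measurable fun ω θ => L i θ ω)
  exact h1.mono (le_iSup₂_of_le i (Finset.mem_range.1 hi) le_rfl) le_rfl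

theorem indep_filtration (hL : IsIndepMeanOne P L) (n : ℕ) :
    Indep (hL.filtration n) (MeasurableSpace.comap (fun ω θ => L n θ ω) inferInstance) P := by
  have h := indep_iSup_of_disjoint (fun i => (hL.measurable_field i).comap_le) hL.indep
    (S := Set.Iio n) (T := {n}) (by simp)
  rw [iSup_singleton] at h
  exact h

theorem setLIntegral_prodField_succ (hL : IsIndepMeanOne P L) (n : ℕ) (θ : S) {A : Set Ω}
    (hA : MeasurableSet[hL.filtration n] A) :
    ∫⁻ ω in A, prodField L (Finset.range (n + 1)) θ ω ∂P =
      ∫⁻ ω in A, prodField L (Finset.range n) θ ω ∂P := by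
  have hA' : MeasurableSet A := hL.filtration.le n _ hA
  have h1 : Measurable[MeasurableSpace.comap (fun ω θ => L n θ ω) inferInstance] (L n θ) :=
    (measurable_pi_apply θ).comp (comap_measurable fun ω θ => L n θ ω)
  have h2 : Measurable[hL.filtration n] (A.indicator (prodField L (Finset.range n) θ)) :=
    (hL.measurable_filtration_prodField n θ).indicator hA
  have h := lintegral_mul_eq_lintegral_mul_lintegral_of_independent_measurableSpace
    (hL.filtration.le n) (hL.measurable_field n).comap_le (hL.indep_filtration n) h2 h1
  rw [hL.mean_one, mul_one, lintegral_indicator hA'] at h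
  rw [← h, ← lintegral_indicator hA']
  refine lintegral_congr fun ω => ?_
  by_cases hω : ω ∈ A <;> simp [hω, prodField, Finset.prod_range_succ]

variable [IsProbabilityMeasure P]

theorem setLIntegral_lintegral_prodField (hL : IsIndepMeanOne P L) {ν : Measure S} [SFinite ν]
    (s : Finset ℕ) {A : Set Ω} :
    ∫⁻ ω in A, ∫⁻ θ, prodField L s θ ω ∂ν ∂P = ∫⁻ θ, ∫⁻ ω in A, prodField L s θ ω ∂P ∂ν :=
  lintegral_lintegral_swap
    (hL.measurable_prodField_comp s measurable_snd measurable_fst).aemeasurable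

theorem lintegral_lintegral_prodField (hL : IsIndepMeanOne P L) {ν : Measure S} [SFinite ν]
    (s : Finset ℕ) : ∫⁻ ω, ∫⁻ θ, prodField L s θ ω ∂ν ∂P = ν Set.univ := by
  have := hL.setLIntegral_lintegral_prodField (ν := ν) s (A := Set.univ)
  simpa [hL.lintegral_prodField] using this

/-- The integrals of the products of the first `n` fields form a nonnegative martingale, up to a
modification that makes them adapted. -/
theorem ae_exists_tendsto (hL : IsIndepMeanOne P L) (ν : Measure S) [IsFiniteMeasure ν] :
    ∀ᵐ ω ∂P, ∃ c : ℝ≥0∞, Tendsto (fun n => ∫⁻ θ, prodField L (Finset.range n) θ ω ∂ν) atTop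
      (𝓝 c) := by
  have hfin (n : ℕ) : ∫⁻ ω, ∫⁻ θ, prodField L (Finset.range n) θ ω ∂ν ∂P ≠ ∞ := by
    rw [hL.lintegral_lintegral_prodField]; exact measure_ne_top ν _
  have hex (n : ℕ) := exists_measurable_ae_eq_lintegral (hL.filtration.le n) (P := P) (ν := ν)
    (hL.measurable_uncurry_prodField (Finset.range n)) (hL.measurable_filtration_prodField n)
    (hfin n)
  choose V hV hVeq using hex
  have hVm (n : ℕ) : Measurable (V n) := (hV n).mono (hL.filtration.le n) le_rfl
  have hVfin (n : ℕ) : ∫⁻ ω, V n ω ∂P = ν Set.univ := by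
    rw [← lintegral_congr_ae (hVeq n), hL.lintegral_lintegral_prodField]
  have hVtop (n : ℕ) : ∀ᵐ ω ∂P, V n ω < ∞ :=
    ae_lt_top (hVm n) (by rw [hVfin]; exact measure_ne_top ν _)
  have hmart : Martingale (fun n ω => (V n ω).toReal) hL.filtration P := by
    refine martingale_of_setIntegral_eq_succ (fun n => ?_) (fun n => ?_) fun n A hA => ?_
    · exact (hV n).ennreal_toReal.stronglyMeasurable
    · exact integrable_toReal_of_lintegral_ne_top (hVm n).aemeasurable
        (by rw [hVfin]; exact measure_ne_top ν _)
    · rw [integral_toReal (hVm n).aemeasurable (ae_restrict_of_ae (hVtop n)),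
        integral_toReal (hVm (n + 1)).aemeasurable (ae_restrict_of_ae (hVtop (n + 1))),
        ← lintegral_congr_ae (ae_restrict_of_ae (hVeq n)),
        ← lintegral_congr_ae (ae_restrict_of_ae (hVeq (n + 1))),
        hL.setLIntegral_lintegral_prodField, hL.setLIntegral_lintegral_prodField]
      congr 1
      exact lintegral_congr fun θ => (hL.setLIntegral_prodField_succ n θ hA).symm
  have hbdd (n : ℕ) : eLpNorm (fun ω => (V n ω).toReal) 1 P ≤ (ν Set.univ).toNNReal := by
    rw [eLpNorm_one_eq_lintegral_enorm, ENNReal.coe_toNNReal (measure_ne_top ν _), ← hVfin n]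
    refine lintegral_mono fun ω => ?_
    rw [Real.enorm_of_nonneg ENNReal.toReal_nonneg]
    exact ENNReal.ofReal_toReal_le
  filter_upwards [hmart.submartingale.ae_tendsto_limitProcess hbdd, ae_all_iff.2 hVeq,
    ae_all_iff.2 hVtop] with ω h1 h2 h3
  refine ⟨_, (ENNReal.tendsto_ofReal h1).congr fun n => ?_⟩
  rw [ENNReal.ofReal_toReal (h3 n).ne]
  exact (h2 n).symm

/-- If the total masses are bounded in `Lᵖ` for some `p > 1`, the random measures with densities
`∏_{i < n} L i` have a random measure as their setwise limit. -/
theorem convergesSetwise (hL : IsIndepMeanOne P L) (σ : Measure S) [IsFiniteMeasure σ]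
    {p : ℝ} (hp : 1 < p) {C : ℝ≥0∞} (hC : C ≠ ∞)
    (hbd : ∀ n, ∫⁻ ω, (∫⁻ θ, prodField L (Finset.range n) θ ω ∂σ) ^ p ∂P ≤ C) :
    ConvergesSetwise P (fun n ω => σ.withDensity fun θ => prodField L (Finset.range n) θ ω) σ
      (fun B ω => limsup (fun n => ∫⁻ θ in B, prodField L (Finset.range n) θ ω ∂σ) atTop) := by
  have hmeas (B : Set S) (n : ℕ) :
      Measurable fun ω => ∫⁻ θ in B, prodField L (Finset.range n) θ ω ∂σ :=
    hL.measurable_lintegral_prodField _ _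
  have hlim (B : Set S) : ∀ᵐ ω ∂P, Tendsto
      (fun n => ∫⁻ θ in B, prodField L (Finset.range n) θ ω ∂σ) atTop
      (𝓝 (limsup (fun n => ∫⁻ θ in B, prodField L (Finset.range n) θ ω ∂σ) atTop)) := by
    filter_upwards [hL.ae_exists_tendsto (σ.restrict B)] with ω ⟨c, hc⟩
    rwa [hc.limsup_eq]
  refine ⟨fun B _ => Measurable.limsup (hmeas B), fun B hB => ?_, fun B hB => ?_⟩
  · filter_upwards [hlim B] with ω hω
    refine hω.congr fun n => ?_
    rw [withDensity_apply _ hB]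
  · have hE (n : ℕ) : ∫⁻ ω, ∫⁻ θ in B, prodField L (Finset.range n) θ ω ∂σ ∂P = σ B := by
      rw [hL.lintegral_lintegral_prodField, Measure.restrict_apply_univ]
    refine le_antisymm ?_ ?_
    · calc _ = ∫⁻ ω, liminf (fun n => ∫⁻ θ in B, prodField L (Finset.range n) θ ω ∂σ) atTop ∂P :=
            lintegral_congr_ae ((hlim B).mono fun ω hω => hω.liminf_eq.symm)
        _ ≤ liminf (fun n => ∫⁻ ω, ∫⁻ θ in B, prodField L (Finset.range n) θ ω ∂σ ∂P) atTop :=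
            lintegral_liminf_le (hmeas B)
        _ = σ B := by simp [hE]
    · refine le_lintegral_of_tendsto_of_lintegral_rpow_le (fun n => (hmeas B n).aemeasurable)
        (hlim B) hp hC (fun n => ?_) (Eventually.of_forall fun n => (hE n).ge)
      refine (lintegral_mono fun ω => ?_).trans (hbd n)
      exact ENNReal.rpow_le_rpow (setLIntegral_le_lintegral _ _) (by linarith)

end IsIndepMeanOne

end Martingale

/-! ### The mixing inequality -/

section Mixing

/-- As long as `bⁱ t < 1` the factor `ρ (bⁱ t)` is bounded by `ρ 0`; from then on the factors are
dominated by `ρ 1, ρ b, ρ b², …`. -/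
theorem prod_ofReal_le_of_antitoneOn {ρ : ℝ → ℝ} (hρ : AntitoneOn ρ (Set.Ici 0)) {b : ℝ}
    (hb : 1 < b) {K : ℝ≥0∞} (hK1 : 1 ≤ K)
    (hK : ∀ s : Finset ℕ, ∏ i ∈ s, ENNReal.ofReal (ρ (b ^ i)) ≤ K) (n N : ℕ) {t : ℝ}
    (ht : 0 ≤ t) :
    ∏ i ∈ Finset.Ico n N, ENNReal.ofReal (ρ (b ^ i * t)) ≤
      K * (1 + ∑' l : ℕ, ENNReal.ofReal (ρ 0) ^ (l + 1) *
        Set.indicator {x : ℝ | b ^ (n + l) * x < 1} 1 t) := by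
  classical
  have hb0 : 0 < b := by linarith
  have hle1 : K ≤ K * (1 + ∑' l : ℕ, ENNReal.ofReal (ρ 0) ^ (l + 1) *
      Set.indicator {x : ℝ | b ^ (n + l) * x < 1} 1 t) := le_mul_of_one_le_right' le_self_add
  rcases le_or_gt N n with hNn | hnN
  · rw [Finset.Ico_eq_empty (by omega), Finset.prod_empty]
    exact hK1.trans hle1
  have hex : ∃ j : ℕ, N ≤ n + j ∨ 1 ≤ b ^ (n + j) * t := ⟨N - n, Or.inl (by omega)⟩
  -- `j` is the number of factors that are bounded by `ρ 0`
  set j := Nat.find hex with hj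
  have hjN : n + j ≤ N := by
    have : j ≤ N - n := Nat.find_min' hex (Or.inl (by omega))
    omega
  have h1 : ∏ i ∈ Finset.Ico n (n + j), ENNReal.ofReal (ρ (b ^ i * t)) ≤
      ENNReal.ofReal (ρ 0) ^ j := by
    calc _ ≤ ∏ _i ∈ Finset.Ico n (n + j), ENNReal.ofReal (ρ 0) :=
          Finset.prod_le_prod' fun i _ => ENNReal.ofReal_le_ofReal
            (hρ Set.self_mem_Ici (Set.mem_Ici.2 (by positivity)) (by positivity))
      _ = _ := by simp
  have h2 : ∏ i ∈ Finset.Ico (n + j) N, ENNReal.ofReal (ρ (b ^ i * t)) ≤ K := by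
    rcases Nat.find_spec hex with h | h
    · rw [Finset.Ico_eq_empty (by omega), Finset.prod_empty]
      exact hK1
    · rw [Finset.prod_Ico_eq_prod_range]
      refine le_trans (Finset.prod_le_prod' fun i _ => ENNReal.ofReal_le_ofReal ?_)
        (hK (Finset.range (N - (n + j))))
      have hle : b ^ i ≤ b ^ (n + j + i) * t := by
        calc b ^ i = b ^ i * 1 := (mul_one _).symm
          _ ≤ b ^ i * (b ^ (n + j) * t) := by gcongr
          _ = _ := by rw [pow_add b (n + j) i]; ring
      exact hρ (Set.mem_Ici.2 (by positivity)) (Set.mem_Ici.2 (by positivity)) hle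
  rw [← Finset.prod_Ico_consecutive _ (Nat.le_add_right n j) hjN]
  refine (mul_le_mul' h1 h2).trans ?_
  rcases Nat.eq_zero_or_pos j with h0 | hpos
  · rw [h0, pow_zero, one_mul]
    exact hle1
  · rw [mul_comm]
    gcongr
    refine le_trans ?_ le_add_self
    refine le_trans ?_ (ENNReal.le_tsum (j - 1))
    have hlt : b ^ (n + (j - 1)) * t < 1 := by
      have := Nat.find_min hex (m := j - 1) (by omega)
      push Not at this
      exact this.2
    rw [Set.indicator_of_mem (by exact hlt), Pi.one_apply, mul_one, Nat.sub_add_cancel hpos]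

variable {d k : ℕ}

theorem exists_minSep_eq (hk : 2 ≤ k) (η : Fin k → Sph d) :
    ∃ x ∈ (Finset.univ : Finset (Fin k)).offDiag, minSep η = geodDist (η x.1) (η x.2) := by
  have : Nonempty {mh : Fin k × Fin k // mh.1 ≠ mh.2} :=
    ⟨⟨(⟨0, by omega⟩, ⟨1, by omega⟩), by simp⟩⟩
  obtain ⟨x, hx⟩ := exists_eq_ciInf_of_finite
    (f := fun mh : {mh : Fin k × Fin k // mh.1 ≠ mh.2} => geodDist (η mh.1.1) (η mh.1.2))
  exact ⟨x.1, by simpa using x.2, hx.symm⟩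

theorem minSep_pair (η : Fin 2 → Sph d) : minSep η = geodDist (η 0) (η 1) := by
  obtain ⟨x, hx, h⟩ := exists_minSep_eq le_rfl η
  rw [h]
  obtain ⟨i, j⟩ := x
  fin_cases i <;> fin_cases j
  · simp at hx
  · rfl
  · exact geodDist_comm _ _
  · simp at hx

variable {Ω : Type*} [MeasurableSpace Ω] {P : Measure Ω} {Λ : ℕ → Sph d → Ω → ℝ} {b : ℝ}
  {p : Fin k → ℝ} {ρ : ℝ → ℝ}

/-- The fields as `ℝ≥0∞`-valued functions; negative values, which do not occur almost surely, are
replaced by `0`. -/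
def toENN (Λ : ℕ → Sph d → Ω → ℝ) (i : ℕ) (θ : Sph d) (ω : Ω) : ℝ≥0∞ := ENNReal.ofReal (Λ i θ ω)

theorem ConvergenceConditions.isIndepMeanOne [IsProbabilityMeasure P]
    (h : ConvergenceConditions P Λ b p ρ) : IsIndepMeanOne P (toENN Λ) where
  measurable i := (h.field i).measurable.ennreal_ofReal
  indep := h.indep.comp (fun _ x θ => ENNReal.ofReal (x θ)) fun _ =>
    measurable_pi_lambda _ fun θ => (measurable_pi_apply θ).ennreal_ofReal
  mean_one i θ := by
    have hint : Integrable (Λ i θ) P := ((h.field i).memLp_two θ).integrable one_le_two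
    have h1 := ofReal_integral_eq_lintegral_ofReal hint
      ((h.field i).nonneg.mono fun ω hω => hω θ)
    rw [(h.field i).mean_one, ENNReal.ofReal_one] at h1
    exact h1.symm
  ne_top i θ ω := ENNReal.ofReal_ne_top

theorem ConvergenceConditions.ae_cumMeasure_eq (h : ConvergenceConditions P Λ b p ρ) :
    ∀ᵐ ω ∂P, ∀ n, cumMeasure Λ n ω =
      (surf d).withDensity fun θ => prodField (toENN Λ) (Finset.range (n + 1)) θ ω := by
  filter_upwards [ae_all_iff.2 fun i => (h.field i).nonneg] with ω hω n
  unfold cumMeasure prodField toENN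
  congr 1
  funext θ
  exact ENNReal.ofReal_prod_of_nonneg fun i _ => hω i θ

theorem ConvergenceConditions.ofReal_mul_lt_one (hd : 1 ≤ d)
    (h : ConvergenceConditions P Λ b p ρ) :
    ENNReal.ofReal (ρ 0) * ENNReal.ofReal ((b ^ d)⁻¹) < 1 := by
  have hb : 0 < b := by linarith [h.one_lt_scale]
  rcases le_or_gt (ρ 0) 0 with h0 | h0
  · rw [ENNReal.ofReal_of_nonpos h0, zero_mul]; exact one_pos
  · rw [← ENNReal.ofReal_mul h0.le, ENNReal.ofReal_lt_one]
    have h1 : ρ 0 < b ^ d := by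
      calc ρ 0 = (ρ 0 ^ (1 / (d : ℝ))) ^ d := by
            rw [← Real.rpow_natCast, ← Real.rpow_mul h0.le, one_div_mul_cancel (by
              have : d ≠ 0 := by omega
              exact_mod_cast this), Real.rpow_one]
        _ < b ^ d := pow_lt_pow_left₀ h.scale (by positivity) (by omega)
    rw [← div_eq_mul_inv, div_lt_one (by positivity)]
    exact h1

/-- If `g` takes values near `0` with small probability only, a function of `g` that is unbounded
near `0`, written as a series of indicator functions, has a bounded integral. -/
theorem lintegral_one_add_tsum_indicator_le {α : Type*} [MeasurableSpace α] (ν : Measure α)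
    [IsProbabilityMeasure ν] {g : α → ℝ} (hg : Measurable g) (K r K₀ β : ℝ≥0∞) (c : ℕ → ℝ)
    (hν : ∀ l, ν {y | c l * g y < 1} ≤ K₀ * β ^ l) :
    ∫⁻ y, K * (1 + ∑' l : ℕ, r ^ (l + 1) *
      Set.indicator {x : ℝ | c l * x < 1} (1 : ℝ → ℝ≥0∞) (g y)) ∂ν ≤
      K * (1 + r * K₀ * (1 - r * β)⁻¹) := by
  have hset (l : ℕ) : MeasurableSet {x : ℝ | c l * x < 1} :=
    measurableSet_lt (measurable_const.mul measurable_id) measurable_const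
  have hind (l : ℕ) : Measurable fun y =>
      Set.indicator {x : ℝ | c l * x < 1} (1 : ℝ → ℝ≥0∞) (g y) :=
    Measurable.comp (g := Set.indicator {x : ℝ | c l * x < 1} (1 : ℝ → ℝ≥0∞)) (f := g)
      (measurable_one.indicator (hset l)) hg
  have hm (l : ℕ) : Measurable fun y => r ^ (l + 1) *
      Set.indicator {x : ℝ | c l * x < 1} (1 : ℝ → ℝ≥0∞) (g y) :=
    (hind l).const_mul (r ^ (l + 1))
  have hsum : Measurable fun y => 1 + ∑' l : ℕ, r ^ (l + 1) *
      Set.indicator {x : ℝ | c l * x < 1} (1 : ℝ → ℝ≥0∞) (g y) :=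
    (Measurable.tsum hm).const_add 1
  rw [lintegral_const_mul K hsum, lintegral_add_left measurable_const,
    lintegral_tsum fun l => (hm l).aemeasurable]
  simp only [lintegral_const, measure_univ, mul_one]
  gcongr
  calc ∑' l, ∫⁻ y, r ^ (l + 1) *
        Set.indicator {x : ℝ | c l * x < 1} (1 : ℝ → ℝ≥0∞) (g y) ∂ν
      ≤ ∑' l, r * K₀ * (r * β) ^ l := by
        refine ENNReal.tsum_le_tsum fun l => ?_
        have hval : ∫⁻ y, Set.indicator {x : ℝ | c l * x < 1} (1 : ℝ → ℝ≥0∞) (g y) ∂ν =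
            ν {y | c l * g y < 1} :=
          lintegral_indicator_one (s := {y | c l * g y < 1}) (hg (hset l))
        rw [lintegral_const_mul _ (hind l), hval]
        calc _ ≤ r ^ (l + 1) * (K₀ * β ^ l) := by gcongr; exact hν l
          _ = _ := by rw [mul_pow]; ring
    _ = _ := by rw [ENNReal.tsum_mul_left, ENNReal.tsum_geometric]

/-- If a function of `k` points is bounded by a function of the distance of the closest pair, its
integral over independent points is bounded through the integrals over one point. -/
theorem lintegral_pi_le_of_le_minSep (ν : Measure (Sph d)) [IsProbabilityMeasure ν] (hk : 2 ≤ k)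
    {G : (Fin k → Sph d) → ℝ≥0∞} {F : ℝ → ℝ≥0∞} (hF : Measurable F)
    (hG : ∀ η, G η ≤ F (minSep η)) {C : ℝ≥0∞} (hC : ∀ x, ∫⁻ y, F (geodDist x y) ∂ν ≤ C) :
    ∫⁻ η, G η ∂(Measure.pi fun _ => ν) ≤ (Finset.univ : Finset (Fin k)).offDiag.card * C := by
  have hFg : Measurable fun x : Sph d × Sph d => F (geodDist x.1 x.2) :=
    Measurable.comp (g := F) (f := fun x : Sph d × Sph d => geodDist x.1 x.2) hF
      measurable_geodDist
  have hpair (x : Fin k × Fin k) :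
      Measurable fun η : Fin k → Sph d => F (geodDist (η x.1) (η x.2)) :=
    Measurable.comp (g := fun x : Sph d × Sph d => F (geodDist x.1 x.2))
      (f := fun η : Fin k → Sph d => (η x.1, η x.2)) hFg
      ((measurable_pi_apply x.1).prodMk (measurable_pi_apply x.2))
  have hpt (η : Fin k → Sph d) : G η ≤
      ∑ x ∈ (Finset.univ : Finset (Fin k)).offDiag, F (geodDist (η x.1) (η x.2)) := by
    obtain ⟨x, hx, hmin⟩ := exists_minSep_eq hk η
    refine (hG η).trans ?_
    rw [hmin]
    exact Finset.single_le_sum (f := fun x : Fin k × Fin k => F (geodDist (η x.1) (η x.2)))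
      (fun _ _ => zero_le) hx
  calc ∫⁻ η, G η ∂(Measure.pi fun _ => ν)
      ≤ ∫⁻ η : Fin k → Sph d, ∑ x ∈ (Finset.univ : Finset (Fin k)).offDiag,
          F (geodDist (η x.1) (η x.2)) ∂(Measure.pi fun _ => ν) := lintegral_mono hpt
    _ = ∑ x ∈ (Finset.univ : Finset (Fin k)).offDiag,
          ∫⁻ η : Fin k → Sph d, F (geodDist (η x.1) (η x.2)) ∂(Measure.pi fun _ => ν) :=
        lintegral_finsetSum _ fun x _ => hpair x
    _ ≤ ∑ x ∈ (Finset.univ : Finset (Fin k)).offDiag, C := by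
        refine Finset.sum_le_sum fun x hx => ?_
        rw [lintegral_pi_pair ν hFg (by simpa using hx)]
        calc _ ≤ ∫⁻ _ : Sph d, C ∂ν := lintegral_mono hC
          _ = C := by simp
    _ = _ := by simp

/-- The uniform bound on the mixed moments of the tail products, integrated over `k` independent
points whose common law `ν` has at most the order of growth of the surface measure from the scale
`b⁻ⁿ` on. The series converges as `ρ 0 < b ^ d`. -/
theorem ConvergenceConditions.exists_lintegral_mixedProd_le (hd : 1 ≤ d)
    (h : ConvergenceConditions P Λ b p ρ) {K₀ : ℝ≥0∞} (hK₀ : K₀ ≠ ∞) :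
    ∃ C : ℝ≥0∞, C ≠ ∞ ∧ ∀ (n N : ℕ) (ν : Measure (Sph d)) [IsProbabilityMeasure ν],
      (∀ (l : ℕ) (x : Sph d), ν {y | b ^ (n + l) * geodDist x y < 1} ≤
        K₀ * ENNReal.ofReal ((b ^ d)⁻¹) ^ l) →
      ∫⁻ η, mixedProd P (toENN Λ) p (Finset.Ico n N) η ∂(Measure.pi fun _ => ν) ≤ C := by
  obtain ⟨K, hK1, hKt, hK⟩ := exists_prod_ofReal_le_of_summable_log h.summable
  set C₁ : ℝ≥0∞ := K * (1 + ENNReal.ofReal (ρ 0) * K₀ *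
    (1 - ENNReal.ofReal (ρ 0) * ENNReal.ofReal ((b ^ d)⁻¹))⁻¹) with hC₁
  have hC₁t : C₁ ≠ ∞ := by
    refine ENNReal.mul_ne_top hKt (ENNReal.add_ne_top.2 ⟨ENNReal.one_ne_top,
      ENNReal.mul_ne_top (ENNReal.mul_ne_top ENNReal.ofReal_ne_top hK₀) ?_⟩)
    exact ENNReal.inv_ne_top.2 (tsub_pos_of_lt (h.ofReal_mul_lt_one hd)).ne'
  refine ⟨(Finset.univ : Finset (Fin k)).offDiag.card * C₁,
    ENNReal.mul_ne_top (ENNReal.natCast_ne_top _) hC₁t, fun n N ν _ hν => ?_⟩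
  have hgx (x : Sph d) : Measurable fun y => geodDist x y :=
    Measurable.comp (g := fun x : Sph d × Sph d => geodDist x.1 x.2) (f := fun y => (x, y))
      measurable_geodDist measurable_prodMk_left
  have hset (l : ℕ) : MeasurableSet {x : ℝ | b ^ (n + l) * x < 1} :=
    measurableSet_lt (measurable_const.mul measurable_id) measurable_const
  have hterm (l : ℕ) : Measurable fun t : ℝ => ENNReal.ofReal (ρ 0) ^ (l + 1) *
      Set.indicator {x : ℝ | b ^ (n + l) * x < 1} (1 : ℝ → ℝ≥0∞) t :=
    Measurable.const_mul (measurable_one.indicator (hset l)) _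
  refine lintegral_pi_le_of_le_minSep ν h.two_le
    (F := fun t => K * (1 + ∑' l : ℕ, ENNReal.ofReal (ρ 0) ^ (l + 1) *
      Set.indicator {x : ℝ | b ^ (n + l) * x < 1} 1 t))
    (Measurable.const_mul (Measurable.const_add (Measurable.tsum hterm) 1) K) (fun η => ?_)
    fun x => lintegral_one_add_tsum_indicator_le ν (hgx x) K _ K₀ _ (fun l => b ^ (n + l))
      fun l => hν l x
  refine (Finset.prod_le_prod' fun i _ => h.mixing i η).trans
    (prod_ofReal_le_of_antitoneOn h.antitone h.one_lt_scale hK1 hK n N ?_)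
  obtain ⟨x, -, hmin⟩ := exists_minSep_eq h.two_le η
  rw [hmin]
  exact geodDist_nonneg _ _

end Mixing

/-! ### Moments, caps and the limiting measure -/

section Moments

variable {d k : ℕ} {Ω : Type*} [MeasurableSpace Ω] {P : Measure Ω} {Λ : ℕ → Sph d → Ω → ℝ} {b : ℝ}
  {p : Fin k → ℝ} {ρ : ℝ → ℝ}

/-- The mixing inequality at coinciding points bounds the moments of the single fields. -/
theorem ConvergenceConditions.moment_ne_top [IsProbabilityMeasure P]
    (h : ConvergenceConditions P Λ b p ρ) {q : ℝ} (hq0 : 0 ≤ q) (hq : q ≤ ∑ j, p j) (i : ℕ)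
    (θ : Sph d) : moment P (Λ i θ) q ≠ ∞ := by
  have hp : ∀ j, 0 ≤ p j := fun j => zero_le_one.trans (h.one_le_exponent j)
  have h1 : ∫⁻ ω, toENN Λ i θ ω ^ (∑ j, p j) ∂P ≤
      ENNReal.ofReal (ρ (b ^ i * minSep fun _ : Fin k => θ)) := by
    refine le_trans (le_of_eq ?_) (h.mixing i fun _ => θ)
    exact lintegral_congr fun ω => ennreal_rpow_sum _ _ fun j _ => hp j
  refine ne_top_of_le_ne_top (ENNReal.add_ne_top.2 ⟨ENNReal.one_ne_top,
    ne_top_of_le_ne_top ENNReal.ofReal_ne_top h1⟩) ?_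
  calc moment P (Λ i θ) q ≤ ∫⁻ ω, 1 + toENN Λ i θ ω ^ (∑ j, p j) ∂P :=
        lintegral_mono fun ω => ennreal_rpow_le_one_add_rpow _ hq0 hq
    _ = 1 + ∫⁻ ω, toENN Λ i θ ω ^ (∑ j, p j) ∂P := by
        rw [lintegral_add_left measurable_const]
        simp

theorem IsIndepMeanOne.lintegral_rpow_ne_zero {S : Type*} [MeasurableSpace S]
    {L : ℕ → S → Ω → ℝ≥0∞} (hL : IsIndepMeanOne P L) {q : ℝ} (hq : 0 < q) (i : ℕ) (θ : S) :
    ∫⁻ ω, L i θ ω ^ q ∂P ≠ 0 := by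
  intro h0
  rw [lintegral_eq_zero_iff ((hL.measurable_eval i θ).pow_const q)] at h0
  have h1 : ∫⁻ ω, L i θ ω ∂P = 0 := by
    rw [lintegral_eq_zero_iff (hL.measurable_eval i θ)]
    filter_upwards [h0] with ω hω
    exact (ENNReal.rpow_eq_zero_iff_of_pos hq).1 hω
  rw [hL.mean_one] at h1
  exact one_ne_zero h1

/-- Strong isotropy in the form in which it is used: mixed moments are invariant under rotations of
the points. -/
theorem StronglyIsotropic.mixedMoment_rot {T : Sph d → Ω → ℝ} (h : StronglyIsotropic P T)
    (p : Fin k → ℝ) (θ : Fin k → Sph d)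
    {g : Euc d ≃ₗᵢ[ℝ] Euc d}
    (hg : LinearMap.det (g.toLinearEquiv :
      Euc d →ₗ[ℝ] Euc d) = 1) :
    mixedMoment P T p (fun j => rot g (θ j)) = mixedMoment P T p θ := by
  have hu : Measurable fun x : Fin k → ℝ => ∏ j, ENNReal.ofReal (x j) ^ p j :=
    Finset.measurable_prod _ fun j _ => (measurable_pi_apply j).ennreal_ofReal.pow_const _
  exact ((h k θ g hg).comp hu).lintegral_eq.symm

end Moments

section Caps

variable {d : ℕ} {b : ℝ}

theorem exists_surf_cap_bounds (d : ℕ) : ∃ c C : ℝ≥0∞, c ≠ 0 ∧ c ≠ ∞ ∧ C ≠ ∞ ∧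
    (∀ (θ : Sph d) (u : ℝ), 0 < u → u ≤ 1 → surf d (cap θ u) ≤ ENNReal.ofReal (u ^ d) * C) ∧
    ∀ (θ : Sph d) (u : ℝ), 0 < u → u < 1 → ENNReal.ofReal (u ^ d) * c ≤ surf d (cap θ u) := by
  have hv0 : volume (Metric.ball (0 : Euc d) 1) ≠ 0 :=
    (Metric.measure_ball_pos volume _ one_pos).ne'
  have hvt : volume (Metric.ball (0 : Euc d) 1) ≠ ∞ :=
    measure_ball_lt_top.ne
  refine ⟨_, _, mul_ne_zero ?_ hv0, ENNReal.mul_ne_top ENNReal.ofReal_ne_top hvt,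
    ENNReal.mul_ne_top ?_ (ENNReal.mul_ne_top ENNReal.ofReal_ne_top hvt),
    fun θ u hu hu1 => surf_cap_le θ hu hu1, fun θ u hu hu1 => le_surf_cap θ hu hu1⟩
  · rw [Ne, ENNReal.ofReal_eq_zero, not_le]
    positivity
  · exact ENNReal.add_ne_top.2 ⟨ENNReal.natCast_ne_top d, ENNReal.one_ne_top⟩

theorem surf_univ_ne_zero (d : ℕ) : surf d Set.univ ≠ 0 := by
  obtain ⟨c, C, hc0, -, -, -, hc⟩ := exists_surf_cap_bounds d
  intro h0
  have h1 := (hc (northPole d) (1 / 2) (by norm_num) (by norm_num)).trans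
    (measure_mono (Set.subset_univ _))
  rw [h0, nonpos_iff_eq_zero, mul_eq_zero, ENNReal.ofReal_eq_zero] at h1
  rcases h1 with h1 | h1
  · exact absurd h1 (not_le.2 (by positivity))
  · exact hc0 h1

theorem setLIntegral_eq_mul_lintegral_cond {S : Type*} [MeasurableSpace S] {σ : Measure S}
    {B : Set S} (h0 : σ B ≠ 0) (ht : σ B ≠ ∞) (f : S → ℝ≥0∞) :
    ∫⁻ θ in B, f θ ∂σ = σ B * ∫⁻ θ, f θ ∂(σ[|B]) := by
  rw [ProbabilityTheory.cond, lintegral_smul_measure, smul_eq_mul, ← mul_assoc,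
    ENNReal.mul_inv_cancel h0 ht, one_mul]

/-- The normalised surface measure on a set with at least the order of measure of a cap of radius
`b⁻ⁿ` has at most the order of growth of the surface measure from the scale `b⁻ⁿ` on. -/
theorem cond_surf_le (hb : 1 < b) {C : ℝ≥0∞}
    (hC : ∀ (θ : Sph d) (u : ℝ), 0 < u → u ≤ 1 → surf d (cap θ u) ≤ ENNReal.ofReal (u ^ d) * C)
    {c : ℝ≥0∞} (hc0 : c ≠ 0) {n : ℕ} {B : Set (Sph d)}
    (hB : ENNReal.ofReal (((b ^ n)⁻¹) ^ d) * c ≤ surf d B) (l : ℕ) (x : Sph d) :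
    (surf d)[|B] {y | b ^ (n + l) * geodDist x y < 1} ≤
      C / c * ENNReal.ofReal ((b ^ d)⁻¹) ^ l := by
  have hb0 : 0 < b := by linarith
  have hsub : {y | b ^ (n + l) * geodDist x y < 1} ⊆ cap x (b ^ (n + l))⁻¹ := by
    intro y hy
    have hy' : b ^ (n + l) * geodDist x y < 1 := hy
    change geodDist y x ≤ _
    rw [geodDist_comm, ← one_div, le_div_iff₀' (by positivity)]
    exact hy'.le
  have hreal : ((b ^ (n + l))⁻¹) ^ d = ((b ^ n)⁻¹) ^ d * ((b ^ d)⁻¹) ^ l := by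
    rw [pow_add, mul_inv, mul_pow]
    congr 1
    rw [inv_pow, inv_pow, ← pow_mul, ← pow_mul, mul_comm]
  set a := ENNReal.ofReal (((b ^ n)⁻¹) ^ d) with ha
  have ha0 : a ≠ 0 := by
    rw [ha, Ne, ENNReal.ofReal_eq_zero, not_le]
    positivity
  calc (surf d)[|B] {y | b ^ (n + l) * geodDist x y < 1}
      ≤ (surf d)[|B] (cap x (b ^ (n + l))⁻¹) := measure_mono hsub
    _ ≤ (surf d B)⁻¹ * surf d (cap x (b ^ (n + l))⁻¹) := by
        rw [ProbabilityTheory.cond, Measure.smul_apply, smul_eq_mul]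
        gcongr
        exact Measure.restrict_le_self
    _ ≤ (a * c)⁻¹ * (ENNReal.ofReal (((b ^ (n + l))⁻¹) ^ d) * C) := by
        gcongr
        exact hC x _ (by positivity) (inv_le_one_of_one_le₀ (one_le_pow₀ hb.le))
    _ = (a * c)⁻¹ * (a * ENNReal.ofReal ((b ^ d)⁻¹) ^ l * C) := by
        rw [hreal, ENNReal.ofReal_mul (by positivity), ← ha,
          ENNReal.ofReal_pow (inv_nonneg.2 (pow_nonneg hb0.le d))]
    _ = (a⁻¹ * a) * (C / c * ENNReal.ofReal ((b ^ d)⁻¹) ^ l) := by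
        rw [ENNReal.mul_inv (Or.inl ha0) (Or.inr hc0), ENNReal.div_eq_inv_mul]
        ring
    _ = _ := by rw [ENNReal.inv_mul_cancel ha0 ENNReal.ofReal_ne_top, one_mul]

end Caps

section LimitingMeasure

variable {d k : ℕ} {Ω : Type*} [MeasurableSpace Ω] {P : Measure Ω} {Λ : ℕ → Sph d → Ω → ℝ} {b : ℝ}
  {p : Fin k → ℝ} {ρ : ℝ → ℝ}

/-- Fatou's lemma for powers. -/
theorem lintegral_rpow_le_of_tendsto {Z : ℕ → Ω → ℝ≥0∞} {Y : Ω → ℝ≥0∞}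
    (hZ : ∀ n, Measurable (Z n))
    (hlim : ∀ᵐ ω ∂P, Tendsto (fun n => Z n ω) atTop (𝓝 (Y ω))) {q : ℝ} {C : ℝ≥0∞}
    (hC : ∀ᶠ n in atTop, ∫⁻ ω, Z n ω ^ q ∂P ≤ C) : ∫⁻ ω, Y ω ^ q ∂P ≤ C := by
  calc ∫⁻ ω, Y ω ^ q ∂P = ∫⁻ ω, liminf (fun n => Z n ω ^ q) atTop ∂P := by
        refine lintegral_congr_ae ?_
        filter_upwards [hlim] with ω hω
        exact (((ENNReal.continuous_rpow_const (y := q)).tendsto _).comp hω).liminf_eq.symm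
    _ ≤ liminf (fun n => ∫⁻ ω, Z n ω ^ q ∂P) atTop :=
        lintegral_liminf_le fun n => (hZ n).pow_const q
    _ ≤ liminf (fun _ : ℕ => C) atTop := liminf_le_liminf hC
    _ = C := liminf_const C

/-- The `p`-th moments of the normalised approximating masses of a fixed set are bounded. -/
theorem ConvergenceConditions.exists_lintegral_cond_rpow_le (hd : 1 ≤ d) [IsProbabilityMeasure P]
    (h : ConvergenceConditions P Λ b p ρ) {B : Set (Sph d)} (hB : surf d B ≠ 0) :
    ∃ C : ℝ≥0∞, C ≠ ∞ ∧ ∀ N, ∫⁻ ω, (∫⁻ θ, prodField (toENN Λ) (Finset.range N) θ ω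
      ∂((surf d)[|B])) ^ (∑ j, p j) ∂P ≤ C := by
  obtain ⟨-, Cg, -, -, hCgt, hCg, -⟩ := exists_surf_cap_bounds d
  have : IsProbabilityMeasure ((surf d)[|B]) := cond_isProbabilityMeasure hB
  obtain ⟨C, hCt, hC⟩ := h.exists_lintegral_mixedProd_le hd (K₀ := Cg / surf d B)
    (ENNReal.div_ne_top hCgt hB)
  refine ⟨C, hCt, fun N => ?_⟩
  refine (h.isIndepMeanOne.lintegral_rpow_sum_le h.one_le_exponent _).trans ?_
  rw [Finset.range_eq_Ico]
  refine hC 0 N _ fun l x => cond_surf_le h.one_lt_scale hCg hB ?_ l x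
  simp

theorem ConvergenceConditions.exists_isLimitingMeasure (hd : 1 ≤ d) [IsProbabilityMeasure P]
    (h : ConvergenceConditions P Λ b p ρ) :
    ∃ μ : Ω → Measure (Sph d), IsLimitingMeasure P Λ μ := by
  obtain ⟨C, hCt, hC⟩ := h.exists_lintegral_cond_rpow_le hd (surf_univ_ne_zero d)
  have hp : 0 ≤ ∑ j, p j := by linarith [h.two_le_sum]
  have hbd (n : ℕ) : ∫⁻ ω, (∫⁻ θ, prodField (toENN Λ) (Finset.range n) θ ω ∂(surf d)) ^ (∑ j, p j)
      ∂P ≤ surf d Set.univ ^ (∑ j, p j) * C := by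
    have heq (ω : Ω) : (∫⁻ θ, prodField (toENN Λ) (Finset.range n) θ ω ∂(surf d)) ^ (∑ j, p j) =
        surf d Set.univ ^ (∑ j, p j) * (∫⁻ θ, prodField (toENN Λ) (Finset.range n) θ ω
          ∂((surf d)[|Set.univ])) ^ (∑ j, p j) := by
      rw [← ENNReal.mul_rpow_of_nonneg _ _ hp, ← setLIntegral_eq_mul_lintegral_cond
        (surf_univ_ne_zero d) (measure_ne_top _ _), setLIntegral_univ]
    simp_rw [heq]
    rw [lintegral_const_mul' _ _ (ENNReal.rpow_ne_top_of_nonneg hp (measure_ne_top _ _))]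
    gcongr
    exact hC n
  have hconv := h.isIndepMeanOne.convergesSetwise (surf d)
    (p := ∑ j, p j) (by linarith [h.two_le_sum])
    (ENNReal.mul_ne_top (ENNReal.rpow_ne_top_of_nonneg hp (measure_ne_top _ _)) hCt) hbd
  obtain ⟨κ, hκ, hlim⟩ := hconv.exists_measure
  refine ⟨κ, hκ, fun B hB => ?_⟩
  filter_upwards [hlim B hB, h.ae_cumMeasure_eq] with ω hω heq
  simp_rw [heq]
  exact hω.comp (tendsto_add_atTop_nat 1)

theorem IsLimitingMeasure.ae_tendsto_lintegral_cond (h : ConvergenceConditions P Λ b p ρ)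
    {μ : Ω → Measure (Sph d)} (hμ : IsLimitingMeasure P Λ μ) {B : Set (Sph d)}
    (hBm : MeasurableSet B) (hB : surf d B ≠ 0) :
    ∀ᵐ ω ∂P, Tendsto (fun N => ∫⁻ θ, prodField (toENN Λ) (Finset.range N) θ ω ∂((surf d)[|B]))
      atTop (𝓝 ((surf d B)⁻¹ * μ ω B)) := by
  filter_upwards [hμ.tendsto B hBm, h.ae_cumMeasure_eq] with ω hω heq
  simp_rw [heq] at hω
  rw [← tendsto_add_atTop_iff_nat 1]
  have hBt : surf d B ≠ ∞ := measure_ne_top _ _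
  refine (ENNReal.Tendsto.const_mul hω (Or.inr (ENNReal.inv_ne_top.2 hB))).congr fun n => ?_
  rw [withDensity_apply _ hBm, setLIntegral_eq_mul_lintegral_cond hB hBt, ← mul_assoc,
    ENNReal.inv_mul_cancel hB hBt, one_mul]

theorem IsLimitingMeasure.measurable_apply {μ : Ω → Measure (Sph d)}
    (hμ : IsLimitingMeasure P Λ μ) {B : Set (Sph d)} (hB : MeasurableSet B) :
    Measurable fun ω => μ ω B := (Measure.measurable_coe hB).comp hμ.measurable

theorem IsLimitingMeasure.lintegral_rpow_eq {μ : Ω → Measure (Sph d)} {B : Set (Sph d)}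
    (hB : surf d B ≠ 0) {q : ℝ} (hq : 0 ≤ q) :
    ∫⁻ ω, μ ω B ^ q ∂P = surf d B ^ q * ∫⁻ ω, ((surf d B)⁻¹ * μ ω B) ^ q ∂P := by
  have hBt : surf d B ≠ ∞ := measure_ne_top _ _
  rw [← lintegral_const_mul' _ _ (ENNReal.rpow_ne_top_of_nonneg hq hBt)]
  refine lintegral_congr fun ω => ?_
  rw [← ENNReal.mul_rpow_of_nonneg _ _ hq, ← mul_assoc, ENNReal.mul_inv_cancel hB hBt, one_mul]

theorem IsLimitingMeasure.lintegral_rpow_sum_lt_top (hd : 1 ≤ d) [IsProbabilityMeasure P]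
    (h : ConvergenceConditions P Λ b p ρ) {μ : Ω → Measure (Sph d)}
    (hμ : IsLimitingMeasure P Λ μ) (B : Set (Sph d)) :
    ∫⁻ ω, μ ω B ^ (∑ j, p j) ∂P < ∞ := by
  have hp : 0 ≤ ∑ j, p j := by linarith [h.two_le_sum]
  obtain ⟨C, hCt, hC⟩ := h.exists_lintegral_cond_rpow_le hd (surf_univ_ne_zero d)
  have : IsProbabilityMeasure ((surf d)[|Set.univ]) :=
    cond_isProbabilityMeasure (surf_univ_ne_zero d)
  calc ∫⁻ ω, μ ω B ^ (∑ j, p j) ∂P ≤ ∫⁻ ω, μ ω Set.univ ^ (∑ j, p j) ∂P :=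
        lintegral_mono fun ω => ENNReal.rpow_le_rpow (measure_mono (Set.subset_univ _)) hp
    _ ≤ surf d Set.univ ^ (∑ j, p j) * C := by
        rw [lintegral_rpow_eq (surf_univ_ne_zero d) hp]
        gcongr
        exact lintegral_rpow_le_of_tendsto
          (fun N => h.isIndepMeanOne.measurable_lintegral_prodField _ _)
          (hμ.ae_tendsto_lintegral_cond h MeasurableSet.univ (surf_univ_ne_zero d))
          (Eventually.of_forall hC)
    _ < ∞ := ENNReal.mul_lt_top (ENNReal.rpow_lt_top_of_nonneg hp (measure_ne_top _ _))
        hCt.lt_top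

end LimitingMeasure

/-! ### Moment bounds for caps -/

section CapMoments

variable {d k : ℕ} {Ω : Type*} [MeasurableSpace Ω] {P : Measure Ω} {Λ : ℕ → Sph d → Ω → ℝ} {b : ℝ}
  {p : Fin k → ℝ} {ρ : ℝ → ℝ}

theorem surf_cap_ne_zero (θ : Sph d) {u : ℝ} (hu : 0 < u) (hu1 : u < 1) :
    surf d (cap θ u) ≠ 0 := by
  obtain ⟨c, -, hc0, -, -, -, hc⟩ := exists_surf_cap_bounds d
  refine (lt_of_lt_of_le (ENNReal.mul_pos ?_ hc0) (hc θ u hu hu1)).ne'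
  rw [Ne, ENNReal.ofReal_eq_zero, not_le]
  positivity

/-- Seen at the scale `b⁻ⁿ`, the normalised surface measures on caps of radius about `b⁻ⁿ` are
alike, so that the bound on the mixed moments of the fields from the `n`-th on is uniform in `n`. -/
theorem ConvergenceConditions.exists_lintegral_mixedProd_cap_le (hd : 1 ≤ d)
    [IsProbabilityMeasure P] (h : ConvergenceConditions P Λ b p ρ) :
    ∃ C : ℝ≥0∞, C ≠ ∞ ∧ ∀ (n N : ℕ) (θ : Sph d) (u : ℝ), 0 < u → u < 1 → (b ^ (n + 1))⁻¹ ≤ u →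
      ∫⁻ η, mixedProd P (toENN Λ) p (Finset.Ico n N) η ∂(Measure.pi fun _ => (surf d)[|cap θ u]) ≤
        C := by
  have hb : 0 < b := by linarith [h.one_lt_scale]
  obtain ⟨c, Cg, hc0, hct, hCgt, hCg, hc⟩ := exists_surf_cap_bounds d
  have hb0 : ENNReal.ofReal (b⁻¹ ^ d) ≠ 0 := by
    rw [Ne, ENNReal.ofReal_eq_zero, not_le]
    positivity
  obtain ⟨C, hCt, hC⟩ := h.exists_lintegral_mixedProd_le hd
    (K₀ := Cg / (ENNReal.ofReal (b⁻¹ ^ d) * c)) (ENNReal.div_ne_top hCgt (mul_ne_zero hb0 hc0))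
  refine ⟨C, hCt, fun n N θ u hu hu1 hnu => ?_⟩
  have : IsProbabilityMeasure ((surf d)[|cap θ u]) :=
    cond_isProbabilityMeasure (surf_cap_ne_zero θ hu hu1)
  refine hC n N _ fun l x => cond_surf_le h.one_lt_scale hCg (mul_ne_zero hb0 hc0) ?_ l x
  refine le_trans ?_ (hc θ u hu hu1)
  rw [← mul_assoc, ← ENNReal.ofReal_mul (by positivity), ← mul_pow, ← mul_inv, ← pow_succ]
  gcongr

theorem prodField_range_eq {S Ω : Type*} (L : ℕ → S → Ω → ℝ≥0∞) {n N : ℕ} (hnN : n ≤ N) (θ : S)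
    (ω : Ω) : prodField L (Finset.range N) θ ω =
      prodField L (Finset.range n) θ ω * prodField L (Finset.Ico n N) θ ω :=
  (Finset.prod_range_mul_prod_Ico _ hnN).symm

theorem disjoint_range_Ico (n N : ℕ) : Disjoint (Finset.range n) (Finset.Ico n N) := by
  rw [Finset.range_eq_Ico]
  exact Finset.Ico_disjoint_Ico_consecutive 0 n N

theorem prod_range_sub_le {f : ℕ → ℝ≥0∞} {K : ℝ≥0∞} (hK : ∀ s : Finset ℕ, ∏ i ∈ s, f i ≤ K)
    (n : ℕ) : ∏ i ∈ Finset.range n, f (n - i) ≤ K := by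
  have hinj : Set.InjOn (fun i => n - i) (Finset.range n : Set ℕ) := by
    intro i hi j hj hij
    simp only [Finset.coe_range, Set.mem_Iio] at hi hj hij
    omega
  rw [← Finset.prod_image (f := f) hinj]
  exact hK _

theorem SmallExponentCondition.lintegral_mul_rpow_le {q : ℝ} {ρq : ℝ → ℝ}
    (h : SmallExponentCondition P Λ b q ρq) (i : ℕ) (θ θ₀ : Sph d) :
    ∫⁻ ω, toENN Λ i θ ω * toENN Λ i θ₀ ω ^ (q - 1) ∂P ≤
      ENNReal.ofReal (ρq (b ^ i * geodDist θ₀ θ)) := by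
  have h1 := h.mixing i ![θ₀, θ]
  rw [minSep_pair] at h1
  refine le_trans (le_of_eq (lintegral_congr fun ω => ?_)) h1
  rw [Fin.prod_univ_two]
  simp [toENN, mul_comm]

/-- The non-degeneracy condition at one point yields, by isotropy, a bound on two-point moments
around every point: only configurations with `m - 1` of the `m` points at the centre are used. -/
theorem NondegeneracyCondition.ofReal_le_lintegral (hd : 1 ≤ d) {q : ℝ} {θ₁ : Sph d} {m : ℕ}
    {υ : ℝ → ℝ} (h : NondegeneracyCondition P Λ b q θ₁ m υ)
    (hiso : ∀ i, StronglyIsotropic P (Λ i)) (i : ℕ) {x : ℝ} (hx : x ∈ Set.Icc 0 Real.pi)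
    {θ θ₀ : Sph d} (hθ : θ ∈ cap θ₀ x) :
    ENNReal.ofReal (υ (b ^ i * x)) ≤
      ∫⁻ ω, toENN Λ i θ ω ^ (q / m) * toENN Λ i θ₀ ω ^ (q * (m - 1) / m) ∂P := by
  obtain ⟨g, hg, hgθ⟩ := exists_rot_eq hd θ₀ θ₁
  obtain ⟨m, rfl⟩ : ∃ m', m = m' + 1 := ⟨m - 1, by have := h.two_le; omega⟩
  set η : Fin (m + 1) → Sph d := Fin.cons θ fun _ => θ₀ with hη
  have h1 := h.bound i x hx (fun j => rot g (η j)) fun j => by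
    change geodDist _ _ ≤ x
    rw [← hgθ, geodDist_rot]
    refine Fin.cases ?_ (fun j => ?_) j
    · exact hθ
    · rw [hη, Fin.cons_succ, geodDist_self]
      exact hx.1
  rw [(hiso i).mixedMoment_rot _ _ hg] at h1
  refine h1.trans (le_of_eq (lintegral_congr fun ω => ?_))
  rw [Fin.prod_univ_succ]
  simp only [hη, Fin.cons_zero, Fin.cons_succ, Finset.prod_const, Finset.card_univ,
    Fintype.card_fin]
  rw [← ENNReal.rpow_mul_natCast]
  unfold toENN
  congr 2
  push_cast
  ring

variable [IsProbabilityMeasure P]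

/-- Upper bound for `q ≥ 1`: the first `n` fields contribute the factor `Mⁿ`, the others a bounded
one. -/
theorem ConvergenceConditions.exists_lintegral_rpow_le_of_one_le (hd : 1 ≤ d)
    (h : ConvergenceConditions P Λ b p ρ) {q : ℝ} (hq : 1 ≤ q) (hqp : q ≤ ∑ j, p j) {M : ℝ≥0∞}
    (hM : ∀ i θ, moment P (Λ i θ) q = M) :
    ∃ C : ℝ≥0∞, C ≠ ∞ ∧ ∀ μ, IsLimitingMeasure P Λ μ → ∀ (n : ℕ) (θ : Sph d) (u : ℝ), 0 < u →
      u < 1 → (b ^ (n + 1))⁻¹ ≤ u →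
      ∫⁻ ω, ((surf d (cap θ u))⁻¹ * μ ω (cap θ u)) ^ q ∂P ≤ C * M ^ n := by
  have hL := h.isIndepMeanOne
  obtain ⟨C, hCt, hC⟩ := h.exists_lintegral_mixedProd_cap_le hd
  refine ⟨1 + 2 * C, ENNReal.add_ne_top.2 ⟨ENNReal.one_ne_top,
    ENNReal.mul_ne_top ENNReal.ofNat_ne_top hCt⟩, fun μ hμ n θ u hu hu1 hnu => ?_⟩
  have hB := surf_cap_ne_zero θ hu hu1
  have : IsProbabilityMeasure ((surf d)[|cap θ u]) := cond_isProbabilityMeasure hB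
  refine lintegral_rpow_le_of_tendsto (fun N => hL.measurable_lintegral_prodField _ _)
    (hμ.ae_tendsto_lintegral_cond h (measurableSet_cap θ u) hB) ?_
  filter_upwards [eventually_ge_atTop n] with N hN
  have h1 := hL.lintegral_rpow_le_of_one_le (ν := (surf d)[|cap θ u]) h.one_le_exponent
    ⟨0, by linarith [h.two_le]⟩ hq hqp hM (disjoint_range_Ico n N) (hC n N θ u hu hu1 hnu)
  simp_rw [prodField_range_eq _ hN]
  refine h1.trans (le_of_eq ?_)
  rw [Finset.card_range, mul_comm]

/-- Lower bound for `q < 1`. The approximating masses have mean one, so that their powers of order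
`q` are bounded in `L^(1/q)` and the bound passes to the limit. -/
theorem ConvergenceConditions.exists_le_lintegral_rpow_of_lt_one (hd : 1 ≤ d)
    (h : ConvergenceConditions P Λ b p ρ) {q : ℝ} (hq0 : 0 < q) (hq : q < 1) {M : ℝ≥0∞}
    (hM0 : M ≠ 0) (hMt : M ≠ ∞) (hM : ∀ i θ, moment P (Λ i θ) q = M) :
    ∃ c : ℝ≥0∞, c ≠ 0 ∧ c ≠ ∞ ∧ ∀ μ, IsLimitingMeasure P Λ μ → ∀ (n : ℕ) (θ : Sph d) (u : ℝ),
      0 < u → u < 1 → (b ^ (n + 1))⁻¹ ≤ u →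
      c * M ^ n ≤ ∫⁻ ω, ((surf d (cap θ u))⁻¹ * μ ω (cap θ u)) ^ q ∂P := by
  have hL := h.isIndepMeanOne
  obtain ⟨C, hCt, hC⟩ := h.exists_lintegral_mixedProd_cap_le hd
  have hCt' : (1 + C) ^ (1 - q) ≠ ∞ := ENNReal.rpow_ne_top_of_nonneg (by linarith)
    (ENNReal.add_ne_top.2 ⟨ENNReal.one_ne_top, hCt⟩)
  have hC0' : (1 + C) ^ (1 - q) ≠ 0 := by
    refine (ENNReal.rpow_pos ?_ ?_).ne'
    · exact lt_of_lt_of_le one_pos le_self_add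
    · exact ENNReal.add_ne_top.2 ⟨ENNReal.one_ne_top, hCt⟩
  refine ⟨((1 + C) ^ (1 - q))⁻¹, ENNReal.inv_ne_zero.2 hCt', ENNReal.inv_ne_top.2 hC0',
    fun μ hμ n θ u hu hu1 hnu => ?_⟩
  have hB := surf_cap_ne_zero θ hu hu1
  have : IsProbabilityMeasure ((surf d)[|cap θ u]) := cond_isProbabilityMeasure hB
  have hlim := hμ.ae_tendsto_lintegral_cond h (measurableSet_cap θ u) hB
  refine le_lintegral_of_tendsto_of_lintegral_rpow_le (r := q⁻¹) (C := 1)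
    (Z := fun N ω => (∫⁻ η, prodField (toENN Λ) (Finset.range N) η ω ∂((surf d)[|cap θ u])) ^ q)
    (fun N => ((hL.measurable_lintegral_prodField _ _).pow_const q).aemeasurable)
    ?_ (one_lt_inv₀ hq0 |>.2 hq) ENNReal.one_ne_top (fun N => ?_) ?_
  · filter_upwards [hlim] with ω hω
    exact ((ENNReal.continuous_rpow_const (y := q)).tendsto _).comp hω
  · refine le_of_eq ?_
    calc _ = ∫⁻ ω, ∫⁻ η, prodField (toENN Λ) (Finset.range N) η ω ∂((surf d)[|cap θ u]) ∂P :=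
          lintegral_congr fun ω => by
            rw [← ENNReal.rpow_mul, mul_inv_cancel₀ hq0.ne', ENNReal.rpow_one]
      _ = 1 := by rw [hL.lintegral_lintegral_prodField, measure_univ]
  · filter_upwards [eventually_ge_atTop n] with N hN
    have h1 := hL.le_lintegral_rpow_of_lt_one (ν := (surf d)[|cap θ u]) hq0 hq hM0 hMt hM
      (disjoint_range_Ico n N) (hL.lintegral_sq_le h.one_le_exponent h.two_le_sum _
        (hC n N θ u hu hu1 hnu))
    simp_rw [prodField_range_eq _ hN]
    rw [Finset.card_range] at h1
    rw [mul_comm, ← div_eq_mul_inv]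
    exact ENNReal.div_le_of_le_mul' h1

/-- Upper bound for `q < 1`. The fields with index `i < n` vary little over a cap of radius `b⁻ⁿ`,
at the rate that `ρq` prescribes at `b⁻⁽ⁿ⁻ⁱ⁾`. -/
theorem SmallExponentCondition.exists_lintegral_rpow_le
    (h : ConvergenceConditions P Λ b p ρ) {q : ℝ} (hq0 : 0 < q) (hq : q < 1) {ρq : ℝ → ℝ}
    (hs : SmallExponentCondition P Λ b q ρq) {M : ℝ≥0∞} (hM0 : M ≠ 0) (hMt : M ≠ ∞)
    (hM : ∀ i θ, moment P (Λ i θ) q = M) :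
    ∃ C : ℝ≥0∞, C ≠ ∞ ∧ ∀ μ, IsLimitingMeasure P Λ μ → ∀ (n : ℕ) (θ : Sph d) (u : ℝ), 0 < u →
      u < 1 → u ≤ (b ^ n)⁻¹ →
      ∫⁻ ω, ((surf d (cap θ u))⁻¹ * μ ω (cap θ u)) ^ q ∂P ≤ C * M ^ n := by
  have hL := h.isIndepMeanOne
  have hb : 0 < b := by linarith [h.one_lt_scale]
  obtain ⟨K, -, hKt, hK⟩ := exists_prod_ofReal_le_of_summable_log hs.summable
  simp only [hM] at hK
  refine ⟨K ^ q, ENNReal.rpow_ne_top_of_nonneg hq0.le hKt, fun μ hμ n θ u hu hu1 hnu => ?_⟩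
  have hB := surf_cap_ne_zero θ hu hu1
  have : IsProbabilityMeasure ((surf d)[|cap θ u]) := cond_isProbabilityMeasure hB
  refine lintegral_rpow_le_of_tendsto (fun N => hL.measurable_lintegral_prodField _ _)
    (hμ.ae_tendsto_lintegral_cond h (measurableSet_cap θ u) hB) ?_
  filter_upwards [eventually_ge_atTop n] with N hN
  have h1 := hL.lintegral_rpow_le_of_lt_one (ν := (surf d)[|cap θ u]) hq0 hq hMt hM
    (Finset.range_subset_range.2 hN) θ hKt ?_
  · rwa [Finset.card_range] at h1
  filter_upwards [ae_cond_mem (measurableSet_cap θ u)] with η hη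
  have hMr : 0 < M.toReal := ENNReal.toReal_pos hM0 hMt
  calc ∏ i ∈ Finset.range n, ∫⁻ ω, toENN Λ i η ω * toENN Λ i θ ω ^ (q - 1) ∂P
      ≤ ∏ i ∈ Finset.range n, ENNReal.ofReal (ρq (b ^ (-((n - i : ℕ) : ℤ))) / M.toReal) * M := by
        refine Finset.prod_le_prod' fun i hi => (hs.lintegral_mul_rpow_le i η θ).trans ?_
        have hin : i < n := Finset.mem_range.1 hi
        calc ENNReal.ofReal (ρq (b ^ i * geodDist θ η))
            ≤ ENNReal.ofReal (ρq (b ^ (-((n - i : ℕ) : ℤ)))) := by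
              refine ENNReal.ofReal_le_ofReal (hs.monotone
                (Set.mem_Ici.2 (mul_nonneg (by positivity) (geodDist_nonneg _ _)))
                (Set.mem_Ici.2 (by positivity)) ?_)
              rw [geodDist_comm]
              calc b ^ i * geodDist η θ ≤ b ^ i * (b ^ n)⁻¹ := by
                    gcongr
                    exact le_trans hη hnu
                _ = _ := by
                    rw [zpow_neg, zpow_natCast, pow_sub₀ b hb.ne' hin.le, mul_inv, inv_inv,
                      mul_comm]
          _ = ENNReal.ofReal (ρq (b ^ (-((n - i : ℕ) : ℤ))) / M.toReal * M.toReal) := by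
              rw [div_mul_cancel₀ _ hMr.ne']
          _ = _ := by rw [ENNReal.ofReal_mul' hMr.le, ENNReal.ofReal_toReal hMt]
    _ ≤ K * M ^ (Finset.range n).card := by
        rw [Finset.prod_mul_distrib, Finset.prod_const]
        gcongr
        exact prod_range_sub_le hK n

/-- Lower bound for `q ≥ 1`. The fields with index `i < n` are correlated over a cap of radius
`b⁻ⁿ`, at least to the extent that `υ` prescribes at `b⁻⁽ⁿ⁻ⁱ⁾`. -/
theorem NondegeneracyCondition.exists_le_lintegral_rpow (hd : 1 ≤ d)
    (h : ConvergenceConditions P Λ b p ρ) {q : ℝ} (hq : 1 ≤ q)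
    {θ₁ : Sph d} {m : ℕ} {υ : ℝ → ℝ} (hn : NondegeneracyCondition P Λ b q θ₁ m υ)
    (hiso : ∀ i, StronglyIsotropic P (Λ i)) {M : ℝ≥0∞} (hM0 : M ≠ 0) (hMt : M ≠ ∞)
    (hM : ∀ i θ, moment P (Λ i θ) q = M) :
    ∃ c : ℝ≥0∞, c ≠ 0 ∧ c ≠ ∞ ∧ ∀ μ, IsLimitingMeasure P Λ μ → ∀ (n : ℕ) (θ : Sph d) (u : ℝ),
      0 < u → u < 1 → u ≤ (b ^ n)⁻¹ →
      c * M ^ n ≤ ∫⁻ ω, ((surf d (cap θ u))⁻¹ * μ ω (cap θ u)) ^ q ∂P := by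
  have hL := h.isIndepMeanOne
  have hb : 0 < b := by linarith [h.one_lt_scale]
  have hMr : 0 < M.toReal := ENNReal.toReal_pos hM0 hMt
  obtain ⟨K, hK1, hKt, hK⟩ := exists_prod_ofReal_le_of_summable_log hn.summable
  simp only [hM] at hK
  obtain ⟨s, hs0, hs1, hs⟩ := exists_exponent_le_lintegral_mul_rpow (P := P) hq hn.two_le
  have hK0 : K ≠ 0 := (lt_of_lt_of_le one_pos hK1).ne'
  set c : ℝ≥0∞ := (K ^ s⁻¹)⁻¹ with hc
  have hKs0 : K ^ s⁻¹ ≠ 0 := (ENNReal.rpow_pos (pos_iff_ne_zero.2 hK0) hKt).ne'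
  have hKst : K ^ s⁻¹ ≠ ∞ := ENNReal.rpow_ne_top_of_nonneg (by positivity) hKt
  have hc0 : c ≠ 0 := ENNReal.inv_ne_zero.2 hKst
  have hct : c ≠ ∞ := ENNReal.inv_ne_top.2 hKs0
  have hq0 : 0 ≤ q := by linarith
  refine ⟨c ^ q, (ENNReal.rpow_pos (pos_iff_ne_zero.2 hc0) hct).ne',
    ENNReal.rpow_ne_top_of_nonneg hq0 hct, fun μ hμ n θ u hu hu1 hnu => ?_⟩
  have hB := surf_cap_ne_zero θ hu hu1
  have : IsProbabilityMeasure ((surf d)[|cap θ u]) := cond_isProbabilityMeasure hB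
  obtain ⟨C, hCt, hC⟩ := h.exists_lintegral_cond_rpow_le hd hB
  refine hL.le_lintegral_rpow_of_one_le hq hM0 hMt hM
    ((hμ.measurable_apply (measurableSet_cap θ u)).const_mul _).aemeasurable
    (hμ.ae_tendsto_lintegral_cond h (measurableSet_cap θ u) hB)
    (by linarith [h.two_le_sum]) hCt hC n θ ?_
  filter_upwards [ae_cond_mem (measurableSet_cap θ u)] with η hη
  set e : ℕ → ℝ≥0∞ := fun i => ∫⁻ ω, toENN Λ i η ω * toENN Λ i θ ω ^ (q - 1) ∂P with he
  have hupi : u ∈ Set.Icc 0 Real.pi := ⟨hu.le, by linarith [Real.pi_gt_three]⟩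
  have hυ (i : ℕ) (hi : i ∈ Finset.range n) :
      ENNReal.ofReal (υ (b ^ (-((n - i : ℕ) : ℤ)))) ≤ e i ^ s * M ^ (1 - s) := by
    have hin : i < n := Finset.mem_range.1 hi
    calc ENNReal.ofReal (υ (b ^ (-((n - i : ℕ) : ℤ)))) ≤ ENNReal.ofReal (υ (b ^ i * u)) := by
          refine ENNReal.ofReal_le_ofReal (hn.antitone (Set.mem_Ici.2 (by positivity))
            (Set.mem_Ici.2 (by positivity)) ?_)
          calc b ^ i * u ≤ b ^ i * (b ^ n)⁻¹ := by gcongr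
            _ = _ := by
              rw [zpow_neg, zpow_natCast, pow_sub₀ b hb.ne' hin.le, mul_inv, inv_inv, mul_comm]
      _ ≤ _ := hn.ofReal_le_lintegral hd hiso i hupi hη
      _ ≤ _ := hs _ _ (hL.measurable_eval i η) (hL.measurable_eval i θ) M (hM i η) (hM i θ)
  have hprod : M ^ n ≤ K * ((∏ i ∈ Finset.range n, e i) ^ s * (M ^ n) ^ (1 - s)) := by
    calc M ^ n = ∏ i ∈ Finset.range n,
          (ENNReal.ofReal (M.toReal / υ (b ^ (-((n - i : ℕ) : ℤ)))) *
            ENNReal.ofReal (υ (b ^ (-((n - i : ℕ) : ℤ))))) := by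
          rw [Finset.prod_congr rfl (g := fun _ => M), Finset.prod_const, Finset.card_range]
          intro i _
          have hpos : 0 < υ (b ^ (-((n - i : ℕ) : ℤ))) := hn.pos _ (by positivity)
          rw [← ENNReal.ofReal_mul' hpos.le, div_mul_cancel₀ _ hpos.ne',
            ENNReal.ofReal_toReal hMt]
      _ ≤ K * ∏ i ∈ Finset.range n, (e i ^ s * M ^ (1 - s)) := by
          rw [Finset.prod_mul_distrib]
          exact mul_le_mul' (prod_range_sub_le
            (f := fun j => ENNReal.ofReal (M.toReal / υ (b ^ (-(j : ℤ))))) hK n)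
            (Finset.prod_le_prod' hυ)
      _ = _ := by
          rw [Finset.prod_mul_distrib, ENNReal.prod_rpow_of_nonneg hs0.le, Finset.prod_const,
            Finset.card_range, ← ENNReal.rpow_natCast, ← ENNReal.rpow_natCast,
            ← ENNReal.rpow_mul, ← ENNReal.rpow_mul, mul_comm (n : ℝ)]
  have hMn0 : M ^ n ≠ 0 := pow_ne_zero n hM0
  have hMnt : M ^ n ≠ ∞ := ENNReal.pow_ne_top hMt
  have hpow : (M ^ n) ^ s ≤ K * (∏ i ∈ Finset.range n, e i) ^ s := by
    have hsplit : M ^ n = (M ^ n) ^ s * (M ^ n) ^ (1 - s) := by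
      rw [← ENNReal.rpow_add _ _ hMn0 hMnt, add_sub_cancel, ENNReal.rpow_one]
    have h0 : (M ^ n) ^ (1 - s) ≠ 0 := (ENNReal.rpow_pos (pos_iff_ne_zero.2 hMn0) hMnt).ne'
    have ht : (M ^ n) ^ (1 - s) ≠ ∞ := ENNReal.rpow_ne_top_of_nonneg (by linarith) hMnt
    rw [← mul_assoc] at hprod
    nth_rewrite 1 [hsplit] at hprod
    exact (ENNReal.mul_le_mul_iff_left h0 ht).1 hprod
  have hroot : M ^ n ≤ K ^ s⁻¹ * ∏ i ∈ Finset.range n, e i := by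
    have h2 := ENNReal.rpow_le_rpow hpow (inv_nonneg.2 hs0.le)
    rwa [ENNReal.mul_rpow_of_nonneg _ _ (inv_nonneg.2 hs0.le), ← ENNReal.rpow_mul,
      ← ENNReal.rpow_mul, mul_inv_cancel₀ hs0.ne', ENNReal.rpow_one, ENNReal.rpow_one] at h2
  rw [hc, mul_comm, ← div_eq_mul_inv]
  exact ENNReal.div_le_of_le_mul' hroot

end CapMoments

/-! ### The power law -/

section Scaling

/-- Between the scales `b⁻⁽ⁿ⁺¹⁾` and `b⁻ⁿ` the power `u ^ (-log_b t)` is comparable to `t ^ n`. -/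
theorem pow_and_rpow_neg_logb_le {b t u : ℝ} (hb : 1 < b) (ht : 0 < t) (hu : 0 < u) {n : ℕ}
    (h1 : (b ^ (n + 1))⁻¹ < u) (h2 : u ≤ (b ^ n)⁻¹) :
    t ^ n ≤ max t t⁻¹ * u ^ (-Real.logb b t) ∧ u ^ (-Real.logb b t) ≤ max t t⁻¹ * t ^ n := by
  have hb0 : 0 < b := by linarith
  obtain ⟨x, hx⟩ : ∃ x : ℝ, u = b ^ (-x) :=
    ⟨-Real.logb b u, by rw [neg_neg, Real.rpow_logb hb0 hb.ne' hu]⟩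
  have hxn : (n : ℝ) ≤ x := by
    rw [hx, ← Real.rpow_natCast, ← Real.rpow_neg hb0.le, Real.rpow_le_rpow_left_iff hb] at h2
    linarith
  have hxn' : x ≤ n + 1 := by
    rw [hx, ← Real.rpow_natCast, ← Real.rpow_neg hb0.le, Real.rpow_lt_rpow_left_iff hb] at h1
    push_cast at h1
    linarith
  have hpow : u ^ (-Real.logb b t) = t ^ x := by
    rw [hx, ← Real.rpow_mul hb0.le, neg_mul_neg, mul_comm, Real.rpow_mul hb0.le,
      Real.rpow_logb hb0 hb.ne' ht]
  rw [hpow, ← Real.rpow_natCast]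
  -- both exponents differ by a number in `[0, 1]`
  have hD1 : 1 ≤ max t t⁻¹ := by
    rcases le_total 1 t with h | h
    · exact h.trans (le_max_left _ _)
    · exact ((one_le_inv₀ ht).2 h).trans (le_max_right _ _)
  have hbd {y : ℝ} (hy : |y| ≤ 1) : t ^ y ≤ max t t⁻¹ := by
    have hle := abs_le.1 hy
    rcases le_total 1 t with h | h
    · calc t ^ y ≤ t ^ (1 : ℝ) := Real.rpow_le_rpow_of_exponent_le h hle.2
        _ = t := Real.rpow_one t
        _ ≤ _ := le_max_left _ _
    · calc t ^ y ≤ t ^ (-1 : ℝ) := Real.rpow_le_rpow_of_exponent_ge ht h hle.1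
        _ = t⁻¹ := Real.rpow_neg_one t
        _ ≤ _ := le_max_right _ _
  constructor
  · calc t ^ (n : ℝ) = t ^ ((n : ℝ) - x) * t ^ x := by rw [← Real.rpow_add ht, sub_add_cancel]
      _ ≤ _ := by
        gcongr
        exact hbd (abs_le.2 ⟨by linarith, by linarith⟩)
  · calc t ^ x = t ^ (x - n) * t ^ (n : ℝ) := by rw [← Real.rpow_add ht, sub_add_cancel]
      _ ≤ _ := by
        gcongr
        exact hbd (abs_le.2 ⟨by linarith, by linarith⟩)

theorem exists_inv_pow_lt_le {b u : ℝ} (hb : 1 < b) (hu : 0 < u) (hu1 : u ≤ 1) :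
    ∃ n : ℕ, (b ^ (n + 1))⁻¹ < u ∧ u ≤ (b ^ n)⁻¹ := by
  obtain ⟨n, hn⟩ := exists_nat_pow_near_of_lt_one hu hu1 (inv_pos.2 (by linarith : 0 < b))
    (inv_lt_one_of_one_lt₀ hb)
  exact ⟨n, by simpa only [inv_pow] using hn⟩

variable {d : ℕ} {Ω : Type*} [MeasurableSpace Ω] {P : Measure Ω} {b : ℝ}

/-- Bounds in terms of the number of generations that are visible from a cap turn into the
power law. -/
theorem exists_rpow_bounds_of_pow_bounds (hb : 1 < b) {μ : Ω → Measure (Sph d)} {q : ℝ}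
    (hq : 0 < q) {M : ℝ≥0∞} (hM0 : M ≠ 0) (hMt : M ≠ ∞)
    (hupper : ∃ C : ℝ≥0∞, C ≠ ∞ ∧ ∀ (n : ℕ) (θ : Sph d) (u : ℝ), 0 < u → u < 1 →
      (b ^ (n + 1))⁻¹ ≤ u → u ≤ (b ^ n)⁻¹ →
      ∫⁻ ω, ((surf d (cap θ u))⁻¹ * μ ω (cap θ u)) ^ q ∂P ≤ C * M ^ n)
    (hlower : ∃ c : ℝ≥0∞, c ≠ 0 ∧ c ≠ ∞ ∧ ∀ (n : ℕ) (θ : Sph d) (u : ℝ), 0 < u → u < 1 →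
      (b ^ (n + 1))⁻¹ ≤ u → u ≤ (b ^ n)⁻¹ →
      c * M ^ n ≤ ∫⁻ ω, ((surf d (cap θ u))⁻¹ * μ ω (cap θ u)) ^ q ∂P) :
    ∃ C₁ C₂ : ℝ, 0 < C₁ ∧ 0 < C₂ ∧ ∀ᶠ u in 𝓝[>] (0 : ℝ), ∀ θ : Sph d,
      ENNReal.ofReal (C₁ * u ^ ((d : ℝ) * q - Real.logb b M.toReal)) ≤
        ∫⁻ ω, μ ω (cap θ u) ^ q ∂P ∧
      ∫⁻ ω, μ ω (cap θ u) ^ q ∂P ≤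
        ENNReal.ofReal (C₂ * u ^ ((d : ℝ) * q - Real.logb b M.toReal)) := by
  obtain ⟨C, hCt, hC⟩ := hupper
  obtain ⟨c, hc0, hct, hc⟩ := hlower
  obtain ⟨cg, Cg, hcg0, hcgt, hCgt, hCg, hcg⟩ := exists_surf_cap_bounds d
  have ht : 0 < M.toReal := ENNReal.toReal_pos hM0 hMt
  set t := M.toReal with htdef
  set D := max t t⁻¹ with hD
  have hDpos : 0 < D := lt_of_lt_of_le ht (le_max_left _ _)
  have hD0 : ENNReal.ofReal D ≠ 0 := by
    rw [Ne, ENNReal.ofReal_eq_zero, not_le]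
    exact hDpos
  have hcg0' : cg ^ q ≠ 0 := (ENNReal.rpow_pos (pos_iff_ne_zero.2 hcg0) hcgt).ne'
  have hcgt' : cg ^ q ≠ ∞ := ENNReal.rpow_ne_top_of_nonneg hq.le hcgt
  have hCgt' : Cg ^ q ≠ ∞ := ENNReal.rpow_ne_top_of_nonneg hq.le hCgt
  set A : ℝ≥0∞ := cg ^ q * c / ENNReal.ofReal D with hA
  set A' : ℝ≥0∞ := Cg ^ q * C * ENNReal.ofReal D with hA'
  have hAt : A ≠ ∞ := ENNReal.div_ne_top (ENNReal.mul_ne_top hcgt' hct) hD0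
  have hA0 : A ≠ 0 := ENNReal.div_ne_zero.2 ⟨mul_ne_zero hcg0' hc0, ENNReal.ofReal_ne_top⟩
  have hAt' : A' ≠ ∞ := ENNReal.mul_ne_top (ENNReal.mul_ne_top hCgt' hCt) ENNReal.ofReal_ne_top
  refine ⟨A.toReal, A'.toReal + 1, ENNReal.toReal_pos hA0 hAt, by positivity, ?_⟩
  filter_upwards [Ioo_mem_nhdsGT (zero_lt_one' ℝ)] with u hu θ
  obtain ⟨hu0, hu1⟩ := hu
  obtain ⟨n, hn1, hn2⟩ := exists_inv_pow_lt_le hb hu0 hu1.le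
  obtain ⟨hpow1, hpow2⟩ := pow_and_rpow_neg_logb_le hb ht hu0 hn1 hn2
  have hMn : M ^ n = ENNReal.ofReal (t ^ n) := by
    rw [ENNReal.ofReal_pow ht.le, ENNReal.ofReal_toReal hMt]
  have hw : 0 < u ^ (-Real.logb b t) := Real.rpow_pos_of_pos hu0 _
  set v := ENNReal.ofReal (u ^ d) ^ q with hv
  have hsplit : ENNReal.ofReal (u ^ ((d : ℝ) * q - Real.logb b t)) =
      v * ENNReal.ofReal (u ^ (-Real.logb b t)) := by
    rw [hv, sub_eq_add_neg, Real.rpow_add hu0, ENNReal.ofReal_mul (by positivity),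
      ENNReal.ofReal_rpow_of_pos (by positivity), Real.rpow_mul hu0.le, Real.rpow_natCast]
  have hB := surf_cap_ne_zero θ hu0 hu1
  rw [IsLimitingMeasure.lintegral_rpow_eq hB hq.le]
  constructor
  · calc ENNReal.ofReal (A.toReal * u ^ ((d : ℝ) * q - Real.logb b t))
        = A * (v * ENNReal.ofReal (u ^ (-Real.logb b t))) := by
          rw [ENNReal.ofReal_mul ENNReal.toReal_nonneg, ENNReal.ofReal_toReal hAt, hsplit]
      _ ≤ A * (v * (ENNReal.ofReal D * M ^ n)) := by
          gcongr
          rw [hMn, ← ENNReal.ofReal_mul hDpos.le]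
          exact ENNReal.ofReal_le_ofReal hpow2
      _ = (ENNReal.ofReal D * (ENNReal.ofReal D)⁻¹) * (v * cg ^ q * (c * M ^ n)) := by
          rw [hA, div_eq_mul_inv]
          ring
      _ = (ENNReal.ofReal (u ^ d) * cg) ^ q * (c * M ^ n) := by
          rw [ENNReal.mul_inv_cancel hD0 ENNReal.ofReal_ne_top, one_mul, hv,
            ENNReal.mul_rpow_of_nonneg _ _ hq.le]
      _ ≤ _ := mul_le_mul' (ENNReal.rpow_le_rpow (hcg θ u hu0 hu1) hq.le)
          (hc n θ u hu0 hu1 hn1.le hn2)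
  · calc surf d (cap θ u) ^ q * ∫⁻ ω, ((surf d (cap θ u))⁻¹ * μ ω (cap θ u)) ^ q ∂P
        ≤ (ENNReal.ofReal (u ^ d) * Cg) ^ q * (C * M ^ n) :=
          mul_le_mul' (ENNReal.rpow_le_rpow (hCg θ u hu0 hu1.le) hq.le)
            (hC n θ u hu0 hu1 hn1.le hn2)
      _ ≤ (ENNReal.ofReal (u ^ d) * Cg) ^ q *
          (C * (ENNReal.ofReal D * ENNReal.ofReal (u ^ (-Real.logb b t)))) := by
          gcongr
          rw [hMn, ← ENNReal.ofReal_mul hDpos.le]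
          exact ENNReal.ofReal_le_ofReal hpow1
      _ = A' * (v * ENNReal.ofReal (u ^ (-Real.logb b t))) := by
          rw [ENNReal.mul_rpow_of_nonneg _ _ hq.le, hA', hv]
          ring
      _ = ENNReal.ofReal (A'.toReal * u ^ ((d : ℝ) * q - Real.logb b t)) := by
          rw [ENNReal.ofReal_mul ENNReal.toReal_nonneg, ENNReal.ofReal_toReal hAt', hsplit]
      _ ≤ _ := by
          refine ENNReal.ofReal_le_ofReal ?_
          gcongr
          linarith

end Scaling

end SphField

theorem lemma3 {Ω : Type*} [MeasurableSpace Ω] (P : Measure Ω) [IsProbabilityMeasure P]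
    (d : ℕ) (hd : 1 ≤ d) (Λ : ℕ → SphField.Sph d → Ω → ℝ)
    (b : ℝ) (k : ℕ) (pvec : Fin k → ℝ) (p : ℝ) (hp : ∑ j, pvec j = p) (ρ : ℝ → ℝ)
    (hconv : SphField.ConvergenceConditions P Λ b pvec ρ)
    (hiso : SphField.IsotropicEqualMoments P Λ p) :
    (∃ μ : Ω → Measure (SphField.Sph d), SphField.IsLimitingMeasure P Λ μ) ∧
    ∀ μ : Ω → Measure (SphField.Sph d), SphField.IsLimitingMeasure P Λ μ →
      (∀ B, MeasurableSet B → ∫⁻ ω, μ ω B ^ p ∂P < ∞) ∧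
      ∀ q : ℝ, 0 < q → q ≤ p →
        (q < 1 → ∃ ρq : ℝ → ℝ, SphField.SmallExponentCondition P Λ b q ρq) →
        (1 ≤ q → ∃ (θ₀ : SphField.Sph d) (m : ℕ) (υ : ℝ → ℝ),
          SphField.NondegeneracyCondition P Λ b q θ₀ m υ) →
        ∃ C₁ C₂ : ℝ, 0 < C₁ ∧ 0 < C₂ ∧ ∀ᶠ u in 𝓝[>] (0 : ℝ), ∀ θ : SphField.Sph d,
          ENNReal.ofReal (C₁ * u ^ ((d : ℝ) * q -
              Real.logb b (SphField.moment P (Λ 0 (SphField.northPole d)) q).toReal)) ≤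
            ∫⁻ ω, μ ω (SphField.cap θ u) ^ q ∂P ∧
          ∫⁻ ω, μ ω (SphField.cap θ u) ^ q ∂P ≤
            ENNReal.ofReal (C₂ * u ^ ((d : ℝ) * q -
              Real.logb b (SphField.moment P (Λ 0 (SphField.northPole d)) q).toReal)) := by
  subst hp
  refine ⟨hconv.exists_isLimitingMeasure hd, fun μ hμ =>
    ⟨fun B _ => hμ.lintegral_rpow_sum_lt_top hd hconv B, fun q hq0 hqp hsmall hlarge => ?_⟩⟩
  have hM0 : SphField.moment P (Λ 0 (SphField.northPole d)) q ≠ 0 :=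
    hconv.isIndepMeanOne.lintegral_rpow_ne_zero hq0 0 _
  have hMt := hconv.moment_ne_top hq0.le hqp 0 (SphField.northPole d)
  have hM (i : ℕ) (θ : SphField.Sph d) :
      SphField.moment P (Λ i θ) q = SphField.moment P (Λ 0 (SphField.northPole d)) q :=
    (hiso.moment_eq q ⟨hq0.le, hqp⟩ 0 i θ).symm
  rcases lt_or_ge q 1 with hq | hq
  · obtain ⟨ρq, hs⟩ := hsmall hq
    obtain ⟨C, hCt, hC⟩ := hs.exists_lintegral_rpow_le hconv hq0 hq hM0 hMt hM
    obtain ⟨c, hc0, hct, hc⟩ := hconv.exists_le_lintegral_rpow_of_lt_one hd hq0 hq hM0 hMt hM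
    exact SphField.exists_rpow_bounds_of_pow_bounds hconv.one_lt_scale hq0 hM0 hMt
      ⟨C, hCt, fun n θ u hu hu1 _ hnu => hC μ hμ n θ u hu hu1 hnu⟩
      ⟨c, hc0, hct, fun n θ u hu hu1 hnu _ => hc μ hμ n θ u hu hu1 hnu⟩
  · obtain ⟨θ₀, m, υ, hn⟩ := hlarge hq
    obtain ⟨C, hCt, hC⟩ := hconv.exists_lintegral_rpow_le_of_one_le hd hq hqp hM
    obtain ⟨c, hc0, hct, hc⟩ :=
      hn.exists_le_lintegral_rpow hd hconv hq hiso.isotropic hM0 hMt hM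
    exact SphField.exists_rpow_bounds_of_pow_bounds hconv.one_lt_scale hq0 hM0 hMt
      ⟨C, hCt, fun n θ u hu hu1 hnu _ => hC μ hμ n θ u hu hu1 hnu⟩
      ⟨c, hc0, hct, fun n θ u hu hu1 _ hnu => hc μ hμ n θ u hu hu1 hnu⟩
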